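/- **Setting.** Let $\mathbb K$ be $\mathbb R$ or $\mathbb C$ (or any subfield of $\mathbb C$), let $\alpha\in\mathbb K$, $\alpha\neq 0$, and suppose that either $\lambda=\alpha$ and $\alpha\notin\mathbb N=\{0,1,2,\dots\}$, or $\lambda=1$ and $\alpha^{-1}\notin\mathbb N$. Put $\beta=\alpha$, $(i,j)=(1,2)$ if $\lambda=\alpha$, and $\beta=\alpha^{-1}$, $(i,j)=(2,1)$ if $\lambda=1$. *The Lie superalgebra.* $D_\alpha$ is the Jordan superalgebra over $\mathbb K$ with even basis $e_1,e_2$, odd basis $\xi,\eta$ and supercommutative product $e_ie_i=e_i$, $e_1e_2=0$, $e_i\xi=\tfrac12\xi$, $e_i\eta=\tfrac12\eta$, $\xi\eta=e_1+\alpha e_2$. Let $L_a$ be left multiplication by $a$, let $D_\alpha^+$ and $D_\alpha^-$ be two copies of $D_\alpha$ (the basis of $D_\alpha^-$ corresponding to $e_1,e_2,\xi,\eta$ is written $x_1,x_2,x_3,x_4$ below), and let $$\mathfrak g=\mathrm{TKK}(D_\alpha)=D_\alpha^-\oplus\mathfrak{str}\oplus D_\alpha^+,\qquad \mathfrak{str}=\{L_a\mid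 a\in D_\alpha\}\oplus \mathrm{Der}(D_\alpha)$$ with the brackets $[L_a,x]=ax$, $[I,x]=Ix$, $[L_a,u]=-au$, $[I,u]=Iu$, $[x,u]=2L_{xu}+2[L_x,L_u]$, $[x,y]=[u,v]=0$ for $x,y\in D_\alpha^+$, $u,v\in D_\alpha^-$, $I\in \mathrm{Der}(D_\alpha)$, and the supercommutator on $\mathfrak{str}$ (so $\mathfrak g\cong D(2,1;\alpha)$). Let $\mathfrak k=\{(a,I,-a)\mid a\in D_\alpha,\ I\in\mathrm{Der}(D_\alpha)\}$ and $\mathfrak k_0=\mathfrak k\cap\mathfrak{str}=\mathrm{Der}(D_\alpha)$. *The representation.* On the complex-valued smooth superfunctions on $\mathbb R^{2|2}$, with even coordinates $x_1,x_2$ and odd coordinates $x_3,x_4$, put $\pi_\lambda(u)=-2\imath u$ (multiplication) for $u\in D_\alpha^-$; $\pi_\lambda(Z)=\lambda(Z)+\sum_{l=1}^4[Z,x_l]\partial_l$ for $Z\in\mathfrak{str}$, where $\lambda:\mathfrak{str}\to\mathbb K$ is the linear map with $\lambda(2L_{e_1})=\lambda$, $\lambda(2L_{e_2})=\lambda/\alpha$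 that vanishes on $L_\xi$, $L_\eta$ and $\mathrm{Der}(D_\alpha)$; and $\pi_\lambda(x)=-\tfrac{\imath}{2}\mathcal B_\lambda(x)$ for $x\in D_\alpha^+$, where $\mathcal B_\lambda$ is linear, its values at $e_1,e_2,\xi,\eta$ being respectively $$(-\lambda+x_1\partial_1+x_3\partial_3+x_4\partial_4)\partial_1-2\alpha x_2\partial_3\partial_4,$$ $$(-\tfrac{\lambda}{\alpha}+x_2\partial_2+x_3\partial_3+x_4\partial_4)\partial_2-2x_1\partial_3\partial_4,$$ $$(-2\lambda+2x_1\partial_1+2\alpha x_2\partial_2+2(1+\alpha)x_3\partial_3)\partial_4+x_3\partial_1\partial_2,$$ $$(2\lambda-2x_1\partial_1-2\alpha x_2\partial_2-2(1+\alpha)x_4\partial_4)\partial_3+x_4\partial_1\partial_2.$$ Let $\mathcal I_\lambda$ be the ideal of superfunctions generated by $2x_1x_2+x_3x_4,\ x_2^2,\ x_2x_3,\ x_2x_4$ if $\lambda=\alpha$, and by $2\alpha x_1x_2+x_3x_4,\ x_1^2,\ x_1x_3,\ x_1x_4$ if $\lambda=1$. The operators $\pi_\lambda(X)$, $X\in\mathfrak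 g$, preserve $\mathcal I_\lambda$ and so act on superfunctions modulo $\mathcal I_\lambda$. The Schrödinger model is $$W_\lambda=\mathcal P(\mathbb R^{2|2})\exp(-2(x_1+x_2)) \bmod \mathcal I_\lambda ,$$ with $\mathcal P(\mathbb R^{2|2})$ the polynomial superfunctions with complex coefficients. *The pieces.* For $k\in\mathbb N$ let $U(-k,b,t)=\sum_{l=0}^{k}\frac{(-1)^l}{l!}(-k)_l(1-k-b)_l\,t^{k-l}$ (Tricomi's function, with $(a)_l=a(a+1)\cdots(a+l-1)$), $\Omega_{\lambda,k}(x)=U(-k,-\beta,4x)$ and $V_{\lambda,k}(x)=U(-k,1-\beta,4x)$. Put $W_{\lambda,0}=\mathbb C\exp(-2(x_1+x_2))$ and, for $k\ge1$, modulo $\mathcal I_\lambda$, $$\begin{aligned} W_{\lambda,k}&=\mathbb C\,\Omega_{\lambda,k}(x_i)e^{-2(x_1+x_2)}+\mathbb C\,\Omega_{\lambda,k-1}(x_i)e^{-2(x_i-x_j)}+(\mathbb Cx_3+\mathbb Cx_4)V_{\lambda,k-1}(x_i)e^{-2x_i},\\ K_{\lambda,k}&=\mathbb C\bigl(\Omega_{\lambda,k}(x_i)e^{-2(x_1+x_2)}+(k-1-\beta)\Omega_{\lambda,k-1}(x_i)e^{-2(x_i-x_j)}\bigr)+(\mathbb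 Cx_3+\mathbb Cx_4)V_{\lambda,k-1}(x_i)e^{-2x_i},\\ R_{\lambda,k}&=\mathbb C\bigl(\Omega_{\lambda,k}(x_i)e^{-2(x_1+x_2)}+k\,\Omega_{\lambda,k-1}(x_i)e^{-2(x_i-x_j)}\bigr). \end{aligned}$$ **Theorem (Decomposition of $W$).** In this setting: 1. Let $k\ge 1$. (a) If $\alpha\neq-1$, then $W_{\lambda,k}=K_{\lambda,k}\oplus R_{\lambda,k}$, and $K_{\lambda,k}$ and $R_{\lambda,k}$ are irreducible $\mathfrak k_0$-modules. (b) If $\alpha=-1$, then $W_{\lambda,k}$ is an indecomposable, but not an irreducible, $\mathfrak k_0$-module. 2. For every $k\ge0$, $W_{\lambda,k}$ is an irreducible $\mathfrak k$-module. 3. $\pi_\lambda$ makes $W_\lambda$ a module over the Lie superalgebra $\mathfrak g$; this module is irreducible, and its $\mathfrak k$-type decomposition is $W_\lambda=\bigoplus_{k=0}^\infty W_{\lambda,k}$. -/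

import Mathlib

open scoped ContDiff

namespace DTwoOneAlpha

/-! ### The Jordan superalgebra `D_α` and the Lie superalgebra `TKK(D_α) = D(2,1;α)`

`𝕜` is the ground field (`ℝ` or `ℂ`, or any field with an embedding into `ℂ`). -/

section Algebra

variable {𝕜 : Type*} [Field 𝕜]

/-- Parity of the basis `e₁, e₂, ξ, η` (also of `f₁, f₂, ζ, θ` and of the coordinates
`x₁, x₂, x₃, x₄`); these are indexed by `0, 1, 2, 3`. -/
def par : Fin 4 → ZMod 2 := ![0, 0, 1, 1]

/-- The sign `(-1)^{pq}`. -/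
def sgn (p q : ZMod 2) : ℤ := if p = 1 ∧ q = 1 then -1 else 1

/-- The product of `D_α`, in coordinates with respect to `e₁, e₂, ξ, η`, determined by
`eᵢ eᵢ = eᵢ`, `e₁ e₂ = 0`, `eᵢ ξ = ξ / 2`, `eᵢ η = η / 2`, `ξ η = e₁ + α e₂` and
supercommutativity. -/
def jmul (α : 𝕜) (a b : Fin 4 → 𝕜) : Fin 4 → 𝕜 :=
  ![a 0 * b 0 + (a 2 * b 3 - a 3 * b 2),
    a 1 * b 1 + α * (a 2 * b 3 - a 3 * b 2),
    ((a 0 + a 1) * b 2 + a 2 * (b 0 + b 1)) / 2,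
    ((a 0 + a 1) * b 3 + a 3 * (b 0 + b 1)) / 2]

/-- The matrix of left multiplication `L_a` on `D_α`. -/
def jL (α : 𝕜) (a : Fin 4 → 𝕜) : Matrix (Fin 4) (Fin 4) 𝕜 :=
  Matrix.of fun i j => jmul α a (Pi.single j 1) i

/-- A vector of `D_α` is homogeneous of parity `p`. -/
def VecHom (p : ZMod 2) (a : Fin 4 → 𝕜) : Prop := ∀ i, par i ≠ p → a i = 0

/-- An endomorphism of `D_α` is homogeneous of parity `p`. -/
def MatHom (p : ZMod 2) (M : Matrix (Fin 4) (Fin 4) 𝕜) : Prop :=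
  ∀ i j, par i ≠ par j + p → M i j = 0

/-- The derivations `Der(D_α)`: the span of the homogeneous endomorphisms `M` with
`[M, L_a] = L_{M a}` (supercommutator) for all homogeneous `a`. -/
def jDer (α : 𝕜) : Submodule 𝕜 (Matrix (Fin 4) (Fin 4) 𝕜) :=
  Submodule.span 𝕜 {M | ∃ p, MatHom p M ∧ ∀ q a, VecHom q a →
    M * jL α a - sgn p q • (jL α a * M) = jL α (M.mulVec a)}

/-- The space `D_α⁻ ⊕ ⟨L_a⟩ ⊕ End(D_α) ⊕ D_α⁺`, whose element `(u, a, M, x)` stands for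
`(u, L_a + M, x)`; it contains `TKK(D_α) = D_α⁻ ⊕ (⟨L_a⟩ ⊕ Der(D_α)) ⊕ D_α⁺`. -/
abbrev Amb (𝕜 : Type*) : Type _ :=
  (Fin 4 → 𝕜) × (Fin 4 → 𝕜) × Matrix (Fin 4) (Fin 4) 𝕜 × (Fin 4 → 𝕜)

/-- `𝔤 = TKK(D_α)`. -/
def gAlg (α : 𝕜) : Submodule 𝕜 (Amb 𝕜) where
  carrier := {X | X.2.2.1 ∈ jDer α}
  add_mem' h h' := (jDer α).add_mem h h'
  zero_mem' := (jDer α).zero_mem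
  smul_mem' c _ h := (jDer α).smul_mem c h

/-- `𝔨 = {(a, I, -a) | I ∈ Der(D_α), a ∈ D_α}`. -/
def kAlg (α : 𝕜) : Set (gAlg α) :=
  {X | X.1.2.1 = 0 ∧ X.1.2.2.2 = -X.1.1}

/-- `𝔨₀ = 𝔨 ∩ 𝔰𝔱𝔯(D_α) = Der(D_α)`. -/
def k0Alg (α : 𝕜) : Set (gAlg α) :=
  {X | X ∈ kAlg α ∧ X.1.1 = 0 ∧ X.1.2.2.2 = 0}

/-- `X` is homogeneous of parity `p`. -/
def AmbHom (p : ZMod 2) (X : Amb 𝕜) : Prop :=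
  VecHom p X.1 ∧ VecHom p X.2.1 ∧ MatHom p X.2.2.1 ∧ VecHom p X.2.2.2

/-- The Lie superbracket of `TKK(D_α)` on homogeneous elements `X, Y`, with
`s = (-1)^{|X||Y|}`: it is determined by `[L_a, x] = ax`, `[I, x] = I x`, `[L_a, u] = -au`,
`[I, u] = I u`, `[x, u] = 2 L_{xu} + 2 [L_x, L_u]`, `[x, y] = [u, v] = 0`, the supercommutator on
`⟨L_a⟩ ⊕ Der(D_α)`, and super-antisymmetry. -/
def bracket (α : 𝕜) (s : ℤ) : Amb 𝕜 → Amb 𝕜 → Amb 𝕜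
  | (u, a, M, x), (v, b, N, y) =>
    ((M - jL α a).mulVec v - s • (N - jL α b).mulVec u,
      M.mulVec b - s • N.mulVec a + (2 : 𝕜) • jmul α x v - s • (2 : 𝕜) • jmul α y u,
      (jL α a * jL α b - s • (jL α b * jL α a)) + (M * N - s • (N * M))
        + (2 : 𝕜) • (jL α x * jL α v - s • (jL α v * jL α x))
        - s • (2 : 𝕜) • (jL α y * jL α u - s • (jL α u * jL α y)),
      (M + jL α a).mulVec y - s • (N + jL α b).mulVec x)

end Algebra

noncomputable section

/-! ### Smooth superfunctions on `ℝ^{2|2}` -/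

/-- The algebra of smooth complex-valued functions on `ℝ²`. -/
def smoothAlg : Subalgebra ℂ (ℝ × ℝ → ℂ) where
  carrier := {f | ContDiff ℝ ∞ f}
  mul_mem' := fun {f g} (h : ContDiff ℝ ∞ f) (h' : ContDiff ℝ ∞ g) => ContDiff.mul h h'
  add_mem' := fun {f g} (h : ContDiff ℝ ∞ f) (h' : ContDiff ℝ ∞ g) => ContDiff.add h h'
  algebraMap_mem' := fun c => (contDiff_const : ContDiff ℝ ∞ fun _ : ℝ × ℝ => c)

/-- Smooth complex-valued functions on `ℝ²`. -/
def Smooth2 : Type := smoothAlg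

instance : CommRing Smooth2 := inferInstanceAs (CommRing smoothAlg)

instance : Algebra ℂ Smooth2 := inferInstanceAs (Algebra ℂ smoothAlg)

theorem smooth2_contDiff (f : Smooth2) : ContDiff ℝ ∞ f.1 := f.2

theorem smooth2_diff (f : Smooth2) : Differentiable ℝ f.1 :=
  (smooth2_contDiff f).differentiable (by simp)

/-- Partial derivative in the direction `v`. -/
def pd (v : ℝ × ℝ) : Derivation ℂ Smooth2 Smooth2 :=
  Derivation.mk'
    { toFun := fun f => ⟨fun p => fderiv ℝ f.1 p v,
        ((smooth2_contDiff f).fderiv_right (m := ∞) (by simp)).clm_apply contDiff_const⟩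
      map_add' := fun f g => Subtype.ext <| funext fun p =>
        congrArg (fun L => L v) (fderiv_add (smooth2_diff f p) (smooth2_diff g p))
      map_smul' := fun c f => Subtype.ext <| funext fun p =>
        congrArg (fun L => L v) (fderiv_const_smul (smooth2_diff f p) c) }
    (fun f g => Subtype.ext <| funext fun p =>
        congrArg (fun L => L v) (fderiv_mul (smooth2_diff f p) (smooth2_diff g p)))

/-- The coordinate function `x₁`. -/
def cx1 : Smooth2 :=
  ⟨fun p => (p.1 : ℂ), show ContDiff ℝ ∞ _ from Complex.ofRealCLM.contDiff.comp contDiff_fst⟩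

/-- The coordinate function `x₂`. -/
def cx2 : Smooth2 :=
  ⟨fun p => (p.2 : ℂ), show ContDiff ℝ ∞ _ from Complex.ofRealCLM.contDiff.comp contDiff_snd⟩

/-- The function `exp(a x₁ + b x₂)`. -/
def expFun (a b : ℝ) : Smooth2 :=
  ⟨fun p => Complex.exp ((a * p.1 + b * p.2 : ℝ) : ℂ),
    show ContDiff ℝ ∞ _ from (Complex.ofRealCLM.contDiff.comp
      ((contDiff_const.mul contDiff_fst).add (contDiff_const.mul contDiff_snd))).cexp⟩

/-- Smooth superfunctions on `ℝ^{2|2}`: `F` stands for `F₀ + F₁ x₃ + F₂ x₄ + F₃ x₃ x₄`, with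
anticommuting `x₃, x₄` of square zero. -/
abbrev SF : Type := Fin 4 → Smooth2

/-- The product of superfunctions. -/
def sfMul : SF →ₗ[ℂ] SF →ₗ[ℂ] SF :=
  LinearMap.mk₂ ℂ
    (fun F G => ![F 0 * G 0, F 0 * G 1 + F 1 * G 0, F 0 * G 2 + F 2 * G 0,
      F 0 * G 3 + F 3 * G 0 + F 1 * G 2 - F 2 * G 1])
    (fun F F' G => by ext i : 1; fin_cases i <;> simp <;> ring)
    (fun c F G => by ext i : 1; fin_cases i <;> simp [smul_sub])
    (fun F G G' => by ext i : 1; fin_cases i <;> simp <;> ring)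
    (fun c F G => by ext i : 1; fin_cases i <;> simp [smul_sub])

/-- An ordinary function as a superfunction. -/
def ofFun (f : Smooth2) : SF := ![f, 0, 0, 0]

/-- The coordinates `x₁, x₂` (even) and `x₃, x₄` (odd) as superfunctions. -/
def coord : Fin 4 → SF := ![ofFun cx1, ofFun cx2, ![0, 1, 0, 0], ![0, 0, 1, 0]]

/-- Multiplication by a coordinate. -/
def mulX (i : Fin 4) : Module.End ℂ SF := sfMul (coord i)

/-- The derivatives `∂₁, ∂₂` and the (left) odd derivatives `∂₃, ∂₄`. -/
def del : Fin 4 → Module.End ℂ SF :=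
  ![{ toFun := fun F i => pd (1, 0) (F i)
      map_add' := fun F G => by ext i : 1; simp
      map_smul' := fun c F => by ext i : 1; simp },
    { toFun := fun F i => pd (0, 1) (F i)
      map_add' := fun F G => by ext i : 1; simp
      map_smul' := fun c F => by ext i : 1; simp },
    { toFun := fun F => ![F 1, 0, F 3, 0]
      map_add' := fun F G => by ext i : 1; fin_cases i <;> simp
      map_smul' := fun c F => by ext i : 1; fin_cases i <;> simp },
    { toFun := fun F => ![F 2, -F 3, 0, 0]
      map_add' := fun F G => by ext i : 1; fin_cases i <;> simp <;> ring
      map_smul' := fun c F => by ext i : 1; fin_cases i <;> simp }]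

/-! ### The representation `π_λ` by differential operators -/

/-- The Bessel operators `B_λ(x₁), …, B_λ(x₄)`. -/
def bessel (α lam : ℂ) : Fin 4 → Module.End ℂ SF :=
  ![(-lam • 1 + mulX 0 * del 0 + mulX 2 * del 2 + mulX 3 * del 3) * del 0
      - (2 * α) • (mulX 1 * del 2 * del 3),
    (-(lam / α) • 1 + mulX 1 * del 1 + mulX 2 * del 2 + mulX 3 * del 3) * del 1
      - (2 : ℂ) • (mulX 0 * del 2 * del 3),
    ((-2 * lam) • 1 + (2 : ℂ) • (mulX 0 * del 0) + (2 * α) • (mulX 1 * del 1)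
        + (2 * (1 + α)) • (mulX 2 * del 2)) * del 3
      + mulX 2 * del 0 * del 1,
    ((2 * lam) • 1 - (2 : ℂ) • (mulX 0 * del 0) - (2 * α) • (mulX 1 * del 1)
        - (2 * (1 + α)) • (mulX 3 * del 3)) * del 2
      + mulX 3 * del 0 * del 1]

variable {𝕜 : Type*} [Field 𝕜] [Algebra 𝕜 ℂ]

/-- The operator `π_λ(X)` on superfunctions. An element `u` of `D_α⁻` acts by multiplication with
`-2i u`; an element `Z = L_a + M` of `𝔰𝔱𝔯(D_α)` by `λ(Z) + ∑ᵢ [Z, xᵢ] ∂ᵢ`, where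
`[L_a + M, u] = (M - L_a) u` on `D_α⁻` and `λ` is the character with `λ(2 L_{e₁}) = λ`,
`λ(2 L_{e₂}) = λ / α`; an element `x` of `D_α⁺` by `-(i/2) B_λ(x)`. -/
def piOp (α lam : 𝕜) (X : Amb 𝕜) : Module.End ℂ SF :=
  (∑ i, algebraMap 𝕜 ℂ (X.1 i) • (-2 * Complex.I) • mulX i)
  + (algebraMap 𝕜 ℂ (X.2.1 0 * (lam / 2) + X.2.1 1 * (lam / α / 2)) • 1
      + ∑ i, ∑ j, algebraMap 𝕜 ℂ ((X.2.2.1 - jL α X.2.1) j i) • (mulX j * del i))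
  + ∑ i, algebraMap 𝕜 ℂ (X.2.2.2 i) •
      (-(Complex.I / 2)) • bessel (algebraMap 𝕜 ℂ α) (algebraMap 𝕜 ℂ lam) i

open Classical in
/-- The generators of the submodule `V_λ` of quadratic polynomials: for `λ = α` these are
`2 x₁ x₂ + x₃ x₄, x₂², x₂ x₃, x₂ x₄`, for `λ = 1` they are
`2 α x₁ x₂ + x₃ x₄, x₁², x₁ x₃, x₁ x₄`. -/
def vGen (α lam : 𝕜) : Set SF :=
  if lam = α then
    {(2 : ℂ) • sfMul (coord 0) (coord 1) + sfMul (coord 2) (coord 3),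
      sfMul (coord 1) (coord 1), sfMul (coord 1) (coord 2), sfMul (coord 1) (coord 3)}
  else
    {(2 * algebraMap 𝕜 ℂ α) • sfMul (coord 0) (coord 1) + sfMul (coord 2) (coord 3),
      sfMul (coord 0) (coord 0), sfMul (coord 0) (coord 2), sfMul (coord 0) (coord 3)}

/-- The ideal `𝓘_λ` of superfunctions generated by `V_λ`. -/
def ideal (α lam : 𝕜) : Submodule ℂ SF :=
  Submodule.span ℂ {F | ∃ G, ∃ v ∈ vGen α lam, F = sfMul G v}

/-- Superfunctions modulo `𝓘_λ`. -/
abbrev QF (α lam : 𝕜) : Type := SF ⧸ ideal α lam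

/-- The class modulo `𝓘_λ`. -/
abbrev cls (α lam : 𝕜) : SF →ₗ[ℂ] QF α lam := (ideal α lam).mkQ

/-- The standing hypothesis: `λ = α` and `α ∉ ℕ`, or `λ = 1`, `α ≠ 0` and `α⁻¹ ∉ ℕ`. -/
def Admissible (α lam : 𝕜) : Prop :=
  (lam = α ∧ ∀ n : ℕ, α ≠ n) ∨ (lam = 1 ∧ α ≠ 0 ∧ ∀ n : ℕ, α⁻¹ ≠ n)

/-! ### The ideal is stable under the operators `π_λ(X)`, `X ∈ 𝔤` -/

theorem csmul (c : ℂ) (f : Smooth2) : c • f = algebraMap ℂ Smooth2 c * f :=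
  Algebra.smul_def c f

theorem amap_two : algebraMap ℂ Smooth2 2 = 2 := map_ofNat _ 2

theorem mem_ideal_alpha (α : 𝕜) (F : SF) : F ∈ ideal α α ↔ ∃ c p q : Smooth2,
    F 0 = 2 * cx1 * cx2 * F 3 + cx2 ^ 2 * c ∧ F 1 = cx2 * p ∧ F 2 = cx2 * q := by
  constructor
  · intro h
    induction h using Submodule.span_induction with
    | mem F h =>
      obtain ⟨G, v, hv, rfl⟩ := h
      simp only [vGen, if_pos, Set.mem_insert_iff, Set.mem_singleton_iff] at hv
      rcases hv with rfl | rfl | rfl | rfl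
      · exact ⟨-4 * cx1 ^ 2 * G 3, 2 * cx1 * G 1, 2 * cx1 * G 2, by
          simp [sfMul, coord, ofFun, csmul, amap_two]; ring, by
          simp [sfMul, coord, ofFun, csmul, amap_two]; ring, by
          simp [sfMul, coord, ofFun, csmul, amap_two]; ring⟩
      · exact ⟨G 0 - 2 * cx1 * cx2 * G 3, cx2 * G 1, cx2 * G 2, by
          simp [sfMul, coord, ofFun]; ring, by
          simp [sfMul, coord, ofFun]; ring, by
          simp [sfMul, coord, ofFun]; ring⟩
      · exact ⟨2 * cx1 * G 2, G 0, 0, by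
          simp [sfMul, coord, ofFun]; ring, by
          simp [sfMul, coord, ofFun]; ring, by
          simp [sfMul, coord, ofFun]⟩
      · exact ⟨-2 * cx1 * G 1, 0, G 0, by
          simp [sfMul, coord, ofFun]; ring, by
          simp [sfMul, coord, ofFun], by
          simp [sfMul, coord, ofFun]; ring⟩
    | zero => exact ⟨0, 0, 0, by simp, by simp, by simp⟩
    | add F G _ _ hF hG =>
      obtain ⟨c, p, q, h0, h1, h2⟩ := hF
      obtain ⟨c', p', q', h0', h1', h2'⟩ := hG
      exact ⟨c + c', p + p', q + q', by simp [h0, h0']; ring, by simp [h1, h1']; ring,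
        by simp [h2, h2']; ring⟩
    | smul r F _ hF =>
      obtain ⟨c, p, q, h0, h1, h2⟩ := hF
      exact ⟨r • c, r • p, r • q, by simp [h0, csmul, amap_two]; ring,
        by simp [h1], by simp [h2]⟩
  · rintro ⟨c, p, q, h0, h1, h2⟩
    have key : F = sfMul (ofFun (F 3)) ((2 : ℂ) • sfMul (coord 0) (coord 1)
          + sfMul (coord 2) (coord 3))
        + sfMul (ofFun c) (sfMul (coord 1) (coord 1))
        + sfMul (ofFun p) (sfMul (coord 1) (coord 2))
        + sfMul (ofFun q) (sfMul (coord 1) (coord 3)) := by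
      ext i : 1
      fin_cases i <;> simp [sfMul, coord, ofFun, csmul, h0, h1, h2, amap_two] <;> ring
    rw [key]
    refine Submodule.add_mem _ (Submodule.add_mem _ (Submodule.add_mem _ ?_ ?_) ?_) ?_ <;>
      refine Submodule.subset_span ⟨_, _, ?_, rfl⟩ <;> simp [vGen]

theorem mem_ideal_one (α : 𝕜) (hα : (1 : 𝕜) ≠ α) (F : SF) :
    F ∈ ideal α 1 ↔ ∃ c p q : Smooth2,
      F 0 = 2 * algebraMap ℂ Smooth2 (algebraMap 𝕜 ℂ α) * cx1 * cx2 * F 3 + cx1 ^ 2 * c ∧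
      F 1 = cx1 * p ∧ F 2 = cx1 * q := by
  set a := algebraMap ℂ Smooth2 (algebraMap 𝕜 ℂ α) with ha
  constructor
  · intro h
    induction h using Submodule.span_induction with
    | mem F h =>
      obtain ⟨G, v, hv, rfl⟩ := h
      simp only [vGen, if_neg hα, Set.mem_insert_iff, Set.mem_singleton_iff] at hv
      rcases hv with rfl | rfl | rfl | rfl
      · exact ⟨-4 * a ^ 2 * cx2 ^ 2 * G 3, 2 * a * cx2 * G 1, 2 * a * cx2 * G 2, by
          simp [sfMul, coord, ofFun, csmul, ← ha, amap_two]; ring, by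
          simp [sfMul, coord, ofFun, csmul, ← ha, amap_two]; ring, by
          simp [sfMul, coord, ofFun, csmul, ← ha, amap_two]; ring⟩
      · exact ⟨G 0 - 2 * a * cx1 * cx2 * G 3, cx1 * G 1, cx1 * G 2, by
          simp [sfMul, coord, ofFun]; ring, by
          simp [sfMul, coord, ofFun]; ring, by
          simp [sfMul, coord, ofFun]; ring⟩
      · exact ⟨2 * a * cx2 * G 2, G 0, 0, by
          simp [sfMul, coord, ofFun]; ring, by
          simp [sfMul, coord, ofFun]; ring, by
          simp [sfMul, coord, ofFun]⟩
      · exact ⟨-2 * a * cx2 * G 1, 0, G 0, by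
          simp [sfMul, coord, ofFun]; ring, by
          simp [sfMul, coord, ofFun], by
          simp [sfMul, coord, ofFun]; ring⟩
    | zero => exact ⟨0, 0, 0, by simp, by simp, by simp⟩
    | add F G _ _ hF hG =>
      obtain ⟨c, p, q, h0, h1, h2⟩ := hF
      obtain ⟨c', p', q', h0', h1', h2'⟩ := hG
      exact ⟨c + c', p + p', q + q', by simp [h0, h0']; ring, by simp [h1, h1']; ring,
        by simp [h2, h2']; ring⟩
    | smul r F _ hF =>
      obtain ⟨c, p, q, h0, h1, h2⟩ := hF
      exact ⟨r • c, r • p, r • q, by simp [h0, csmul, amap_two]; ring,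
        by simp [h1], by simp [h2]⟩
  · rintro ⟨c, p, q, h0, h1, h2⟩
    have key : F = sfMul (ofFun (F 3)) ((2 * algebraMap 𝕜 ℂ α) • sfMul (coord 0) (coord 1)
          + sfMul (coord 2) (coord 3))
        + sfMul (ofFun c) (sfMul (coord 0) (coord 0))
        + sfMul (ofFun p) (sfMul (coord 0) (coord 2))
        + sfMul (ofFun q) (sfMul (coord 0) (coord 3)) := by
      ext i : 1
      fin_cases i <;> simp [sfMul, coord, ofFun, csmul, h0, h1, h2, ← ha, amap_two] <;> ring
    rw [key]
    refine Submodule.add_mem _ (Submodule.add_mem _ (Submodule.add_mem _ ?_ ?_) ?_) ?_ <;>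
      refine Submodule.subset_span ⟨_, _, ?_, rfl⟩ <;> simp [vGen, hα]

theorem mem_jDer_entries (α : 𝕜) (M : Matrix (Fin 4) (Fin 4) 𝕜) (h : M ∈ jDer α) :
    (M 0 0 = 0 ∧ M 0 1 = 0 ∧ M 1 0 = 0 ∧ M 1 1 = 0) ∧
    (M 0 3 = -2 * M 2 0 ∧ M 1 3 = 2 * α * M 2 0 ∧ M 2 1 = -M 2 0) ∧
    (M 0 2 = 2 * M 3 0 ∧ M 1 2 = -2 * α * M 3 0 ∧ M 3 1 = -M 3 0) ∧ M 3 3 = -M 2 2 := by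
  have : CharZero 𝕜 := (algebraMap 𝕜 ℂ).charZero
  induction h using Submodule.span_induction with
  | mem M h =>
    obtain ⟨p, hp, h⟩ := h
    have h0 := h 0 ![1, 0, 0, 0] (by intro i; fin_cases i <;> simp [par])
    have h1 := h 0 ![0, 1, 0, 0] (by intro i; fin_cases i <;> simp [par])
    have h2 := h 1 ![0, 0, 1, 0] (by intro i; fin_cases i <;> simp [par])
    have h3 := h 1 ![0, 0, 0, 1] (by intro i; fin_cases i <;> simp [par])
    clear h
    have e0 (i j) := congrFun (congrFun h0 i) j
    have e1 (i j) := congrFun (congrFun h1 i) j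
    have e2 (i j) := congrFun (congrFun h2 i) j
    have e3 (i j) := congrFun (congrFun h3 i) j
    clear h0 h1 h2 h3
    simp only [Fin.forall_fin_succ, Fin.forall_fin_zero, MatHom] at e0 e1 e2 e3 hp
    have hp2 : ∀ p : ZMod 2, p = 0 ∨ p = 1 := by decide
    rcases hp2 p with rfl | rfl
    · simp [par, sgn, jL, jmul, Matrix.mul_apply, Fin.sum_univ_four, Matrix.mulVec, dotProduct,
        Pi.single_apply] at hp e0 e1 e2 e3
      grind
    · simp [par, sgn, jL, jmul, Matrix.mul_apply, Fin.sum_univ_four, Matrix.mulVec, dotProduct,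
        Pi.single_apply] at hp e0 e1 e2 e3
      grind
  | zero => simp
  | add M N _ _ hM hN => simp only [Matrix.add_apply]; grind
  | smul r M _ hM => simp only [Matrix.smul_apply, smul_eq_mul]; grind
set_option linter.unusedSimpArgs false


theorem pd_cx1 (v : ℝ × ℝ) : pd v cx1 = algebraMap ℂ Smooth2 v.1 := by
  refine Subtype.ext (funext fun p => ?_)
  have h : HasFDerivAt (fun p : ℝ × ℝ => (p.1 : ℂ))
      (Complex.ofRealCLM.comp (ContinuousLinearMap.fst ℝ ℝ ℝ)) p :=
    Complex.ofRealCLM.hasFDerivAt.comp p hasFDerivAt_fst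
  exact congrArg (fun L => L v) h.fderiv

theorem pd_cx2 (v : ℝ × ℝ) : pd v cx2 = algebraMap ℂ Smooth2 v.2 := by
  refine Subtype.ext (funext fun p => ?_)
  have h : HasFDerivAt (fun p : ℝ × ℝ => (p.2 : ℂ))
      (Complex.ofRealCLM.comp (ContinuousLinearMap.snd ℝ ℝ ℝ)) p :=
    Complex.ofRealCLM.hasFDerivAt.comp p hasFDerivAt_snd
  exact congrArg (fun L => L v) h.fderiv

theorem pd_two (v : ℝ × ℝ) : pd v 2 = 0 := by
  rw [← amap_two, Derivation.map_algebraMap]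

theorem mulX_zero (F : SF) : mulX 0 F 0 = cx1 * F 0 ∧ mulX 0 F 1 = cx1 * F 1 ∧
    mulX 0 F 2 = cx1 * F 2 ∧ mulX 0 F 3 = cx1 * F 3 := by
  simp [mulX, sfMul, coord, ofFun]

theorem mulX_one (F : SF) : mulX 1 F 0 = cx2 * F 0 ∧ mulX 1 F 1 = cx2 * F 1 ∧
    mulX 1 F 2 = cx2 * F 2 ∧ mulX 1 F 3 = cx2 * F 3 := by
  simp [mulX, sfMul, coord, ofFun]

theorem mulX_two (F : SF) : mulX 2 F 0 = 0 ∧ mulX 2 F 1 = F 0 ∧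
    mulX 2 F 2 = 0 ∧ mulX 2 F 3 = F 2 := by
  simp [mulX, sfMul, coord, ofFun]

theorem mulX_three (F : SF) : mulX 3 F 0 = 0 ∧ mulX 3 F 1 = 0 ∧
    mulX 3 F 2 = F 0 ∧ mulX 3 F 3 = -F 1 := by
  simp [mulX, sfMul, coord, ofFun]

theorem del_zero (F : SF) : del 0 F 0 = pd (1, 0) (F 0) ∧ del 0 F 1 = pd (1, 0) (F 1) ∧
    del 0 F 2 = pd (1, 0) (F 2) ∧ del 0 F 3 = pd (1, 0) (F 3) := by
  simp [del]

theorem del_one (F : SF) : del 1 F 0 = pd (0, 1) (F 0) ∧ del 1 F 1 = pd (0, 1) (F 1) ∧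
    del 1 F 2 = pd (0, 1) (F 2) ∧ del 1 F 3 = pd (0, 1) (F 3) := by
  simp [del]

theorem del_two (F : SF) : del 2 F 0 = F 1 ∧ del 2 F 1 = 0 ∧
    del 2 F 2 = F 3 ∧ del 2 F 3 = 0 := by
  simp [del]

theorem del_three (F : SF) : del 3 F 0 = F 2 ∧ del 3 F 1 = -F 3 ∧
    del 3 F 2 = 0 ∧ del 3 F 3 = 0 := by
  simp [del]

/-- The operators of which `π_λ(X)`, `X ∈ 𝔤`, is a linear combination. -/
def elemOps (α lam : 𝕜) : Set (Module.End ℂ SF) :=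
  {mulX 0, mulX 1, mulX 2, mulX 3,
    (2 : ℂ) • (mulX 0 * del 0) + mulX 2 * del 2 + mulX 3 * del 3,
    (2 : ℂ) • (mulX 1 * del 1) + mulX 2 * del 2 + mulX 3 * del 3,
    mulX 2 * del 0 + (2 * algebraMap 𝕜 ℂ α) • (mulX 1 * del 3),
    mulX 2 * del 1 + (2 : ℂ) • (mulX 0 * del 3),
    mulX 3 * del 0 - (2 * algebraMap 𝕜 ℂ α) • (mulX 1 * del 2),
    mulX 3 * del 1 - (2 : ℂ) • (mulX 0 * del 2),
    mulX 2 * del 3,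
    mulX 3 * del 2,
    mulX 2 * del 2 - mulX 3 * del 3,
    bessel (algebraMap 𝕜 ℂ α) (algebraMap 𝕜 ℂ lam) 0,
    bessel (algebraMap 𝕜 ℂ α) (algebraMap 𝕜 ℂ lam) 1,
    bessel (algebraMap 𝕜 ℂ α) (algebraMap 𝕜 ℂ lam) 2,
    bessel (algebraMap 𝕜 ℂ α) (algebraMap 𝕜 ℂ lam) 3}

set_option maxHeartbeats 1000000 in
theorem elemOps_alpha (α : 𝕜) (hα : α ≠ 0) (T : Module.End ℂ SF) (hT : T ∈ elemOps α α)
    (F : SF) (hF : F ∈ ideal α α) : T F ∈ ideal α α := by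
  have hb : algebraMap 𝕜 ℂ α / algebraMap 𝕜 ℂ α = 1 := div_self (by simpa using hα)
  rw [mem_ideal_alpha] at hF ⊢
  obtain ⟨c, p, q, h0, h1, h2⟩ := hF
  set a := algebraMap ℂ Smooth2 (algebraMap 𝕜 ℂ α) with ha
  have pd_a (v) : pd v a = 0 := by rw [ha, Derivation.map_algebraMap]
  simp only [elemOps, Set.mem_insert_iff, Set.mem_singleton_iff] at hT
  rcases hT with rfl | rfl | rfl | rfl | rfl | rfl | rfl | rfl | rfl | rfl | rfl | rfl | rfl | rfl | rfl | rfl | rfl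
  refine ⟨cx1 * c, cx1 * p, cx1 * q, ?_, ?_, ?_⟩
  rotate_left 3
  refine ⟨cx2 * c, cx2 * p, cx2 * q, ?_, ?_, ?_⟩
  rotate_left 3
  refine ⟨-2 * cx1 * q, cx2 * c + 2 * cx1 * F 3, 0, ?_, ?_, ?_⟩
  rotate_left 3
  refine ⟨2 * cx1 * p, 0, cx2 * c + 2 * cx1 * F 3, ?_, ?_, ?_⟩
  rotate_left 3
  refine ⟨2 * cx1 * (pd (1, 0) c),
    p + 2 * cx1 * (pd (1, 0) p),
    q + 2 * cx1 * (pd (1, 0) q), ?_, ?_, ?_⟩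
  rotate_left 3
  refine ⟨4 * c + 2 * cx2 * (pd (0, 1) c),
    3 * p + 2 * cx2 * (pd (0, 1) p),
    3 * q + 2 * cx2 * (pd (0, 1) q), ?_, ?_, ?_⟩
  rotate_left 3
  refine ⟨2 * a * q - 2 * cx1 * (pd (1, 0) q),
    2 * F 3 - 2 * a * F 3 + cx2 * (pd (1, 0) c) + 2 * cx1 * (pd (1, 0) (F 3)),
    0, ?_, ?_, ?_⟩
  rotate_left 3
  refine ⟨-2 * cx1 * (pd (0, 1) q),
    2 * c + cx2 * (pd (0, 1) c) + 2 * cx1 * (pd (0, 1) (F 3)),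
    0, ?_, ?_, ?_⟩
  rotate_left 3
  refine ⟨-2 * a * p + 2 * cx1 * (pd (1, 0) p),
    0,
    2 * F 3 - 2 * a * F 3 + cx2 * (pd (1, 0) c) + 2 * cx1 * (pd (1, 0) (F 3)), ?_, ?_, ?_⟩
  rotate_left 3
  refine ⟨2 * cx1 * (pd (0, 1) p),
    0,
    2 * c + cx2 * (pd (0, 1) c) + 2 * cx1 * (pd (0, 1) (F 3)), ?_, ?_, ?_⟩
  rotate_left 3
  refine ⟨0, q, 0, ?_, ?_, ?_⟩
  rotate_left 3
  refine ⟨0, 0, p, ?_, ?_, ?_⟩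
  rotate_left 3
  refine ⟨0, p, -q, ?_, ?_, ?_⟩
  rotate_left 3
  refine ⟨-a * (pd (1, 0) c) + cx1 * (pd (1, 0) (pd (1, 0) c)),
    (pd (1, 0) p) - a * (pd (1, 0) p) + cx1 * (pd (1, 0) (pd (1, 0) p)),
    (pd (1, 0) q) - a * (pd (1, 0) q) + cx1 * (pd (1, 0) (pd (1, 0) q)), ?_, ?_, ?_⟩
  rotate_left 3
  refine ⟨3 * (pd (0, 1) c) + cx2 * (pd (0, 1) (pd (0, 1) c)),
    2 * (pd (0, 1) p) + cx2 * (pd (0, 1) (pd (0, 1) p)),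
    2 * (pd (0, 1) q) + cx2 * (pd (0, 1) (pd (0, 1) q)), ?_, ?_, ?_⟩
  rotate_left 3
  refine ⟨2 * a * (pd (0, 1) q) - 2 * cx1 * (pd (1, 0) (pd (0, 1) q)),
    2 * (pd (1, 0) c) + 2 * (pd (0, 1) (F 3)) - 2 * a * (pd (0, 1) (F 3)) + cx2 * (pd (1, 0) (pd (0, 1) c)) + 2 * cx1 * (pd (1, 0) (pd (0, 1) (F 3))),
    0, ?_, ?_, ?_⟩
  rotate_left 3
  refine ⟨-2 * a * (pd (0, 1) p) + 2 * cx1 * (pd (1, 0) (pd (0, 1) p)),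
    0,
    2 * (pd (1, 0) c) + 2 * (pd (0, 1) (F 3)) - 2 * a * (pd (0, 1) (F 3)) + cx2 * (pd (1, 0) (pd (0, 1) c)) + 2 * cx1 * (pd (1, 0) (pd (0, 1) (F 3))), ?_, ?_, ?_⟩
  rotate_left 3
  all_goals
    simp [bessel, mulX_zero, mulX_one, mulX_two, mulX_three, del_zero, del_one, del_two, del_three,
      csmul, amap_two, pd_two, pd_cx1, pd_cx2, pd_a, Derivation.leibniz_pow, h0, h1, h2, ← ha, hb]
  all_goals ring

set_option maxHeartbeats 1000000 in
theorem elemOps_one (α : 𝕜) (hα : α ≠ 0) (hα1 : (1 : 𝕜) ≠ α) (T : Module.End ℂ SF)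
    (hT : T ∈ elemOps α 1) (F : SF) (hF : F ∈ ideal α 1) : T F ∈ ideal α 1 := by
  have hα' : algebraMap 𝕜 ℂ α ≠ 0 := by simpa using hα
  rw [mem_ideal_one α hα1] at hF ⊢
  obtain ⟨c, p, q, h0, h1, h2⟩ := hF
  set a := algebraMap ℂ Smooth2 (algebraMap 𝕜 ℂ α) with ha
  have pd_a (v) : pd v a = 0 := by rw [ha, Derivation.map_algebraMap]
  set b := algebraMap ℂ Smooth2 (algebraMap 𝕜 ℂ α)⁻¹ with hb
  have hab : a * b = 1 := by rw [ha, hb, ← map_mul, mul_inv_cancel₀ hα', map_one]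
  simp only [elemOps, Set.mem_insert_iff, Set.mem_singleton_iff] at hT
  rcases hT with rfl | rfl | rfl | rfl | rfl | rfl | rfl | rfl | rfl | rfl | rfl | rfl | rfl | rfl | rfl | rfl | rfl
  refine ⟨cx1 * c, cx1 * p, cx1 * q, ?_, ?_, ?_⟩
  rotate_left 3
  refine ⟨cx2 * c, cx2 * p, cx2 * q, ?_, ?_, ?_⟩
  rotate_left 3
  refine ⟨-2 * a * cx2 * q, 2 * a * cx2 * F 3 + cx1 * c, 0, ?_, ?_, ?_⟩
  rotate_left 3
  refine ⟨2 * a * cx2 * p, 0, 2 * a * cx2 * F 3 + cx1 * c, ?_, ?_, ?_⟩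
  rotate_left 3
  refine ⟨4 * c + 2 * cx1 * (pd (1, 0) c),
    3 * p + 2 * cx1 * (pd (1, 0) p),
    3 * q + 2 * cx1 * (pd (1, 0) q), ?_, ?_, ?_⟩
  rotate_left 3
  refine ⟨2 * cx2 * (pd (0, 1) c),
    p + 2 * cx2 * (pd (0, 1) p),
    q + 2 * cx2 * (pd (0, 1) q), ?_, ?_, ?_⟩
  rotate_left 3
  refine ⟨-2 * a * cx2 * (pd (1, 0) q),
    2 * c + 2 * a * cx2 * (pd (1, 0) (F 3)) + cx1 * (pd (1, 0) c),
    0, ?_, ?_, ?_⟩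
  rotate_left 3
  refine ⟨2 * q - 2 * a * cx2 * (pd (0, 1) q),
    -2 * F 3 + 2 * a * F 3 + 2 * a * cx2 * (pd (0, 1) (F 3)) + cx1 * (pd (0, 1) c),
    0, ?_, ?_, ?_⟩
  rotate_left 3
  refine ⟨2 * a * cx2 * (pd (1, 0) p),
    0,
    2 * c + 2 * a * cx2 * (pd (1, 0) (F 3)) + cx1 * (pd (1, 0) c), ?_, ?_, ?_⟩
  rotate_left 3
  refine ⟨-2 * p + 2 * a * cx2 * (pd (0, 1) p),
    0,
    -2 * F 3 + 2 * a * F 3 + 2 * a * cx2 * (pd (0, 1) (F 3)) + cx1 * (pd (0, 1) c), ?_, ?_, ?_⟩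
  rotate_left 3
  refine ⟨0, q, 0, ?_, ?_, ?_⟩
  rotate_left 3
  refine ⟨0, 0, p, ?_, ?_, ?_⟩
  rotate_left 3
  refine ⟨0, p, -q, ?_, ?_, ?_⟩
  rotate_left 3
  refine ⟨3 * (pd (1, 0) c) + cx1 * (pd (1, 0) (pd (1, 0) c)),
    2 * (pd (1, 0) p) + cx1 * (pd (1, 0) (pd (1, 0) p)),
    2 * (pd (1, 0) q) + cx1 * (pd (1, 0) (pd (1, 0) q)), ?_, ?_, ?_⟩
  rotate_left 3
  refine ⟨-b * (pd (0, 1) c) + cx2 * (pd (0, 1) (pd (0, 1) c)),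
    (pd (0, 1) p) - b * (pd (0, 1) p) + cx2 * (pd (0, 1) (pd (0, 1) p)),
    (pd (0, 1) q) - b * (pd (0, 1) q) + cx2 * (pd (0, 1) (pd (0, 1) q)), ?_, ?_, ?_⟩
  rotate_left 3
  refine ⟨2 * (pd (1, 0) q) - 2 * a * cx2 * (pd (1, 0) (pd (0, 1) q)),
    2 * (pd (0, 1) c) - 2 * (pd (1, 0) (F 3)) + 2 * a * (pd (1, 0) (F 3)) + 2 * a * cx2 * (pd (1, 0) (pd (0, 1) (F 3))) + cx1 * (pd (1, 0) (pd (0, 1) c)),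
    0, ?_, ?_, ?_⟩
  rotate_left 3
  refine ⟨-2 * (pd (1, 0) p) + 2 * a * cx2 * (pd (1, 0) (pd (0, 1) p)),
    0,
    2 * (pd (0, 1) c) - 2 * (pd (1, 0) (F 3)) + 2 * a * (pd (1, 0) (F 3)) + 2 * a * cx2 * (pd (1, 0) (pd (0, 1) (F 3))) + cx1 * (pd (1, 0) (pd (0, 1) c)), ?_, ?_, ?_⟩
  rotate_left 3
  all_goals
    simp [bessel, mulX_zero, mulX_one, mulX_two, mulX_three, del_zero, del_one, del_two, del_three,
      csmul, amap_two, pd_two, pd_cx1, pd_cx2, pd_a, Derivation.leibniz_pow, h0, h1, h2, ← ha, ← hb]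
  all_goals first | ring1 | linear_combination (-2 * cx1 * F 3) * hab

set_option maxHeartbeats 1000000 in
theorem piOp_mem (α lam : 𝕜) (X : Amb 𝕜) (hX : X ∈ gAlg α) :
    piOp α lam X ∈ Submodule.span ℂ (insert 1 (elemOps α lam)) := by
  have hs (c : ℂ) (T : Module.End ℂ SF) (h : T ∈ insert 1 (elemOps α lam)) :
      c • T ∈ Submodule.span ℂ (insert 1 (elemOps α lam)) :=
    Submodule.smul_mem _ _ (Submodule.subset_span h)
  obtain ⟨u, a, M, x⟩ := X
  obtain ⟨⟨h1, h2, h3, h4⟩, ⟨h5, h6, h7⟩, ⟨h8, h9, h10⟩, h11⟩ := mem_jDer_entries α M hX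
  have key : ∑ i, ∑ j, algebraMap 𝕜 ℂ ((M - jL α a) j i) • (mulX j * del i) =
      (-algebraMap 𝕜 ℂ (a 0) / 2) •
          ((2 : ℂ) • (mulX 0 * del 0) + mulX 2 * del 2 + mulX 3 * del 3)
        + (-algebraMap 𝕜 ℂ (a 1) / 2) •
          ((2 : ℂ) • (mulX 1 * del 1) + mulX 2 * del 2 + mulX 3 * del 3)
        + (algebraMap 𝕜 ℂ (M 2 0) - algebraMap 𝕜 ℂ (a 2) / 2) •
          (mulX 2 * del 0 + (2 * algebraMap 𝕜 ℂ α) • (mulX 1 * del 3))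
        + (-algebraMap 𝕜 ℂ (M 2 0) - algebraMap 𝕜 ℂ (a 2) / 2) •
          (mulX 2 * del 1 + (2 : ℂ) • (mulX 0 * del 3))
        + (algebraMap 𝕜 ℂ (M 3 0) - algebraMap 𝕜 ℂ (a 3) / 2) •
          (mulX 3 * del 0 - (2 * algebraMap 𝕜 ℂ α) • (mulX 1 * del 2))
        + (-algebraMap 𝕜 ℂ (M 3 0) - algebraMap 𝕜 ℂ (a 3) / 2) •
          (mulX 3 * del 1 - (2 : ℂ) • (mulX 0 * del 2))
        + algebraMap 𝕜 ℂ (M 2 3) • (mulX 2 * del 3)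
        + algebraMap 𝕜 ℂ (M 3 2) • (mulX 3 * del 2)
        + algebraMap 𝕜 ℂ (M 2 2) • (mulX 2 * del 2 - mulX 3 * del 3) := by
    have hj : jL α a = !![a 0, 0, -a 3, a 2; 0, a 1, -(α * a 3), α * a 2;
        a 2 / 2, a 2 / 2, (a 0 + a 1) / 2, 0; a 3 / 2, a 3 / 2, 0, (a 0 + a 1) / 2] := by
      ext i j
      fin_cases i <;> fin_cases j <;> simp [jL, jmul]
    have hm : M = !![0, 0, 2 * M 3 0, -2 * M 2 0; 0, 0, -2 * α * M 3 0, 2 * α * M 2 0;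
        M 2 0, -M 2 0, M 2 2, M 2 3; M 3 0, -M 3 0, M 3 2, -M 2 2] := by
      ext i j
      fin_cases i <;> fin_cases j <;> simp [*]
    rw [hm, hj]
    simp only [Fin.sum_univ_four, Matrix.sub_apply, Matrix.of_apply, Matrix.cons_val', Matrix.cons_val,
      map_sub, map_neg, map_add, map_mul, map_div₀, map_zero, map_ofNat]
    module
  unfold piOp
  rw [key]
  simp only [Fin.sum_univ_four]
  repeat' apply Submodule.add_mem
  all_goals try rw [smul_smul]
  all_goals refine hs _ _ ?_
  all_goals simp only [elemOps, Set.mem_insert_iff, Set.mem_singleton_iff, true_or, or_true]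

theorem piOp_stable {α lam : 𝕜} (h : Admissible α lam) (X : gAlg α) :
    ideal α lam ≤ (ideal α lam).comap (piOp α lam X.1) := by
  intro F hF
  have key : ∀ T ∈ Submodule.span ℂ (insert 1 (elemOps α lam)), T F ∈ ideal α lam := by
    intro T hT
    induction hT using Submodule.span_induction with
    | mem T hT =>
      rcases hT with rfl | hT
      · exact hF
      rcases h with ⟨rfl, hα⟩ | ⟨rfl, hα, hα'⟩
      · exact elemOps_alpha lam (by simpa using hα 0) T hT F hF
      · refine elemOps_one α hα (fun h1 => hα' 1 ?_) T hT F hF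
        simp [← h1]
    | zero => exact Submodule.zero_mem _
    | add S T _ _ hS hT => exact Submodule.add_mem _ hS hT
    | smul c T _ hT => exact Submodule.smul_mem _ c hT
  exact key _ (piOp_mem α lam X.1 X.2)

/-- The representation `π_λ` of `𝔤` on superfunctions modulo `𝓘_λ`. -/
def rep {α lam : 𝕜} (h : Admissible α lam) (X : gAlg α) : Module.End ℂ (QF α lam) :=
  (ideal α lam).mapQ (ideal α lam) (piOp α lam X.1) (piOp_stable h X)

/-! ### The Schrödinger model -/

/-- Superfunctions with polynomial coefficients. -/
def polySF : Submodule ℂ SF :=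
  Submodule.pi Set.univ fun _ => Subalgebra.toSubmodule (Algebra.adjoin ℂ {cx1, cx2})

/-- `W_λ = 𝓟(ℝ^{2|2}) exp(-2(x₁ + x₂)) mod 𝓘_λ`. -/
def W (α lam : 𝕜) : Submodule ℂ (QF α lam) :=
  (polySF.map (sfMul (ofFun (expFun (-2) (-2))))).map (cls α lam)

/-- Tricomi's function `U(-k, b, t) = t^k ₂F₀(-k, 1 - k - b; -1/t)` for `k ∈ ℕ`, a polynomial
in `t`. -/
def tricomiU (k : ℕ) (b : ℂ) : Polynomial ℂ :=
  ∑ i ∈ Finset.range (k + 1), Polynomial.monomial (k - i)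
    ((-1) ^ i / (i.factorial : ℂ) * (ascPochhammer ℂ i).eval (-(k : ℂ))
      * (ascPochhammer ℂ i).eval (1 - k - b))

open Classical in
/-- The parameter `β`: `α` if `λ = α`, and `α⁻¹` if `λ = 1`. -/
def betaC (α lam : 𝕜) : ℂ := algebraMap 𝕜 ℂ (if lam = α then α else α⁻¹)

open Classical in
/-- The even variable `xᵢ`: `x₁` if `λ = α`, and `x₂` if `λ = 1`. -/
def mainVar (α lam : 𝕜) : Smooth2 := if lam = α then cx1 else cx2

open Classical in
/-- `exp(s xᵢ + t xⱼ)`, where `(i, j) = (1, 2)` if `λ = α`, and `(i, j) = (2, 1)` if `λ = 1`. -/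
def mainExp (α lam : 𝕜) (s t : ℝ) : Smooth2 := if lam = α then expFun s t else expFun t s

/-- `Ω_{λ,k}(xᵢ) = U(-k, -β, 4 xᵢ)`. -/
def Omega (α lam : 𝕜) (k : ℕ) : Smooth2 :=
  Polynomial.aeval ((4 : ℂ) • mainVar α lam) (tricomiU k (-betaC α lam))

/-- `V_{λ,k}(xᵢ) = U(-k, 1 - β, 4 xᵢ)`. -/
def Vfun (α lam : 𝕜) (k : ℕ) : Smooth2 :=
  Polynomial.aeval ((4 : ℂ) • mainVar α lam) (tricomiU k (1 - betaC α lam))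

/-- The class of `Ω_{λ,k}(xᵢ) exp(-2(x₁ + x₂))`. -/
def genA (α lam : 𝕜) (k : ℕ) : QF α lam :=
  cls α lam (ofFun (Omega α lam k * mainExp α lam (-2) (-2)))

/-- The class of `Ω_{λ,k-1}(xᵢ) exp(-2(xᵢ - xⱼ))`. -/
def genB (α lam : 𝕜) (k : ℕ) : QF α lam :=
  cls α lam (ofFun (Omega α lam (k - 1) * mainExp α lam (-2) 2))

/-- The class of `x₃ V_{λ,k-1}(xᵢ) exp(-2 xᵢ)`. -/
def genC (α lam : 𝕜) (k : ℕ) : QF α lam :=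
  cls α lam (mulX 2 (ofFun (Vfun α lam (k - 1) * mainExp α lam (-2) 0)))

/-- The class of `x₄ V_{λ,k-1}(xᵢ) exp(-2 xᵢ)`. -/
def genD (α lam : 𝕜) (k : ℕ) : QF α lam :=
  cls α lam (mulX 3 (ofFun (Vfun α lam (k - 1) * mainExp α lam (-2) 0)))

/-- `W_{λ,k}`: spanned by `exp(-2(x₁ + x₂))` if `k = 0`, and by
`Ω_{λ,k}(xᵢ) exp(-2(x₁ + x₂))`, `Ω_{λ,k-1}(xᵢ) exp(-2(xᵢ - xⱼ))` and
`x₃ V_{λ,k-1}(xᵢ) exp(-2 xᵢ)`, `x₄ V_{λ,k-1}(xᵢ) exp(-2 xᵢ)` if `k ≥ 1`. -/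
def Wk (α lam : 𝕜) (k : ℕ) : Submodule ℂ (QF α lam) :=
  if k = 0 then Submodule.span ℂ {cls α lam (ofFun (expFun (-2) (-2)))}
  else Submodule.span ℂ {genA α lam k, genB α lam k, genC α lam k, genD α lam k}

/-- `K_{λ,k}`, for `k ≥ 1`. -/
def Kk (α lam : 𝕜) (k : ℕ) : Submodule ℂ (QF α lam) :=
  Submodule.span ℂ {genA α lam k + ((k : ℂ) - 1 - betaC α lam) • genB α lam k,
    genC α lam k, genD α lam k}

/-- `R_{λ,k}`, for `k ≥ 1`. -/
def Rk (α lam : 𝕜) (k : ℕ) : Submodule ℂ (QF α lam) :=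
  Submodule.span ℂ {genA α lam k + (k : ℂ) • genB α lam k}

/-! ### Modules -/

/-- `N` is stable under the operators `π_λ(X)`, `X ∈ 𝔩`. -/
def Invariant {α lam : 𝕜} (h : Admissible α lam) (l : Set (gAlg α))
    (N : Submodule ℂ (QF α lam)) : Prop :=
  ∀ X ∈ l, ∀ w ∈ N, rep h X w ∈ N

/-- `N` is an irreducible `𝔩`-module. -/
def IsIrred {α lam : 𝕜} (h : Admissible α lam) (l : Set (gAlg α))
    (N : Submodule ℂ (QF α lam)) : Prop :=
  Invariant h l N ∧ N ≠ ⊥ ∧ ∀ N' ≤ N, Invariant h l N' → N' = ⊥ ∨ N' = N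

/-- `N` is an indecomposable `𝔩`-module. -/
def IsIndecomp {α lam : 𝕜} (h : Admissible α lam) (l : Set (gAlg α))
    (N : Submodule ℂ (QF α lam)) : Prop :=
  Invariant h l N ∧ N ≠ ⊥ ∧ ∀ N₁ ≤ N, ∀ N₂ ≤ N, Invariant h l N₁ → Invariant h l N₂ →
    N₁ ⊓ N₂ = ⊥ → N₁ ⊔ N₂ = N → N₁ = ⊥ ∨ N₂ = ⊥

/-- Parity of the superfunctions `1, x₃, x₄, x₃ x₄`. -/
def sfPar : Fin 4 → ZMod 2 := ![0, 1, 1, 0]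

/-- Classes of superfunctions of parity `q`. -/
def QHom (α lam : 𝕜) (q : ZMod 2) (w : QF α lam) : Prop :=
  ∃ F : SF, (∀ i, sfPar i ≠ q → F i = 0) ∧ w = cls α lam F

/-- `π_λ` makes `N` a module over the Lie superalgebra `𝔤`: `N` is stable, `π_λ` is linear in
`X ∈ 𝔤`, compatible with parities, and takes the superbracket to the supercommutator. -/
def IsSuperModule {α lam : 𝕜} (h : Admissible α lam) (N : Submodule ℂ (QF α lam)) : Prop :=
  Invariant h Set.univ N ∧
  (∀ (c : 𝕜) (X Y : gAlg α), ∀ w ∈ N,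
    rep h (c • X + Y) w = algebraMap 𝕜 ℂ c • rep h X w + rep h Y w) ∧
  (∀ (p q : ZMod 2) (X : gAlg α), AmbHom p X.1 → ∀ w ∈ N, QHom α lam q w →
    QHom α lam (p + q) (rep h X w)) ∧
  ∀ (p q : ZMod 2) (X Y : gAlg α), AmbHom p X.1 → AmbHom q Y.1 →
    ∃ Z : gAlg α, Z.1 = bracket α (sgn p q) X.1 Y.1 ∧
      ∀ w ∈ N, rep h Z w = rep h X (rep h Y w) - sgn p q • rep h Y (rep h X w)

end

end DTwoOneAlpha

set_option linter.unusedSimpArgs false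

namespace DTwoOneAlpha

/-! Modulo 𝓘_λ there is essentially one variable left. Write x = xᵢ and y = xⱼ. The ideal amounts to
y² = y x₃ = y x₄ = 0 and x₃x₄ = -2δxy, with δ = 1 if λ = α and δ = α if λ = 1. Every class in W_λ is
therefore (a + b y + c x₃ + d x₄) exp(-2x) for unique polynomials a, b, c, d in x, where exp(ty) is
read as 1 + ty. The map `Chart.toQF` from quadruples of polynomials is thus injective with image W_λ
(`Chart.toQF_injective`, `Chart.range_toQF`).

In this model every π_λ(X) is a combination of 18 explicit operators `pmOp`. The two cases coincide:
exchanging e₁ and e₂ and replacing ξ by α⁻¹ξ identifies D_α with D_{α⁻¹} and turns λ = 1 into the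
case λ = α for the parameter α⁻¹. Hence β is the only parameter. That π_λ respects brackets is a
comparison of structure constants (`pmOp_bracket`).

Contiguity relations of Tricomi's polynomials give the matrices of 𝔨 on the four vectors A, B, C, D
spanning the k-th piece, k = n + 1 (`pmOp_mA_succ`, `pmOp_mB`, `pmOp_mC`, `pmOp_mD`). Over 𝔨₀, the
vector V = A + (n - β)B generates, and is reached from, the odd vectors C, D when β ≠ -1, while R =
A + (n + 1)B is killed. Any vector of the piece that is not a multiple of R generates span(V, C, D).
If β ≠ -1, then V and R are independent and K ⊕ R is the whole piece. If β = -1, then V = R lies in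
every nonzero submodule, so there is no splitting, and K is a proper submodule.

An element of 𝔨 outside 𝔨₀ has eigenvalues 2 and -2 on A and B and so separates them. As n ≠ β, the
piece is generated by any nonzero vector (`mW_irred`). The pieces are independent because another
element of 𝔨 acts on the k-th one by the scalar 2β + 2 - 4k, and they exhaust W_λ because Ω and V
have one polynomial in each degree.

For 𝔤, the Bessel operator of x becomes X d²/dX² - β d/dX after removing the exponential. It sends
X^(n+1) to (n + 1)(n - β)X^n, so with β ∉ ℕ any nonzero submodule reaches exp(-2x), and
multiplication by the coordinates then produces everything (`model_irred`). -/

/-! ### Tricomi's polynomials and their contiguity relations. -/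

open Polynomial in
theorem tricomiU_eq (k : ℕ) (b : ℂ) : tricomiU k b =
    ∑ i ∈ Finset.range (k + 1), C ((k.choose i : ℂ) * (ascPochhammer ℂ i).eval (1 - k - b))
      * X ^ (k - i) := by
  unfold tricomiU
  refine Finset.sum_congr rfl fun i _ => ?_
  rw [← C_mul_X_pow_eq_monomial]
  congr 3
  -- (-k)_i equals (-1)^i times a falling factorial, so the prefactor is a binomial coefficient.
  have h := ascPochhammer_eval_neg_eq_descPochhammer ℂ k i
  rw [h, descPochhammer_eval_eq_descFactorial, Nat.descFactorial_eq_factorial_mul_choose]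
  have : (i.factorial : ℂ) ≠ 0 := by exact_mod_cast i.factorial_ne_zero
  have h1 : ((-1 : ℂ) ^ i) * (-1) ^ i = 1 := by rw [← mul_pow]; simp
  push_cast
  field_simp
  linear_combination (k.choose i : ℂ) * h1

open Polynomial in
theorem tricomiU_zero (b : ℂ) : tricomiU 0 b = 1 := by
  simp [tricomiU_eq]

-- Pascal's rule splits each coefficient in two, and (-(n+b))_{i+1} = -(n+b)(1-n-b)_i turns the
-- second half into a multiple of the polynomial with the same b.
open Polynomial in
theorem tricomiU_succ (n : ℕ) (b : ℂ) :
    tricomiU (n + 1) b = X * tricomiU n (b + 1) - C (n + b) * tricomiU n b := by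
  rw [tricomiU_eq (n + 1), Finset.sum_range_succ', tricomiU_eq n (b + 1), tricomiU_eq n b,
    Finset.mul_sum, Finset.mul_sum]
  have e1 : (1 : ℂ) - n - (b + 1) = -(n + b) := by ring
  have e2 : (1 : ℂ) - (n + 1 : ℕ) - b = -(n + b) := by push_cast; ring
  have e3 : (1 : ℂ) - n - b = -(n + b) + 1 := by ring
  rw [e1, e2, e3]
  have step (i : ℕ) : (ascPochhammer ℂ (i + 1)).eval (-(n + b)) =
      -(n + b) * (ascPochhammer ℂ i).eval (-(n + b : ℂ) + 1) := by
    rw [ascPochhammer_succ_left]; simp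
  have hb (i : ℕ) : C (((n + 1).choose (i + 1) : ℂ) *
        (ascPochhammer ℂ (i + 1)).eval (-(n + b))) * X ^ (n + 1 - (i + 1)) =
      C ((n.choose (i + 1) : ℂ) * (ascPochhammer ℂ (i + 1)).eval (-(n + b))) * X ^ (n - i)
      - C (n + b) * (C ((n.choose i : ℂ) * (ascPochhammer ℂ i).eval (-(n + b) + 1))
        * X ^ (n - i)) := by
    rw [Nat.choose_succ_succ, step, Nat.add_sub_add_right]
    simp only [map_mul, map_add, map_neg, map_natCast, Nat.cast_add]
    ring
  rw [Finset.sum_congr rfl fun i _ => hb i, Finset.sum_sub_distrib, Finset.sum_range_succ,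
    Finset.sum_range_succ' (fun i => X * _)]
  have hc : ∀ i ∈ Finset.range n,
      C ((n.choose (i + 1) : ℂ) * (ascPochhammer ℂ (i + 1)).eval (-(n + b))) * X ^ (n - i) =
      X * (C ((n.choose (i + 1) : ℂ) * (ascPochhammer ℂ (i + 1)).eval (-(n + b)))
        * X ^ (n - (i + 1))) := by
    intro i hi
    rw [Finset.mem_range] at hi
    rw [show n - i = (n - (i + 1)) + 1 by omega, pow_succ]
    ring
  rw [Finset.sum_congr rfl hc]
  simp
  ring

-- The three relations are proved together, for all b at once: the step from n to n + 1 at b needs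
-- the relations for n at both b and b + 1.
open Polynomial in
theorem tricomiU_relations (n : ℕ) : ∀ b : ℂ,
    tricomiU n b - derivative (tricomiU n b) = tricomiU n (b + 1) ∧
    X * derivative (tricomiU n (b + 1)) + C b * tricomiU n (b + 1) =
      C (n + b) * tricomiU n b ∧
    derivative (tricomiU (n + 1) b) = (n + 1) * tricomiU n (b + 1) := by
  -- The derivative formula in degree n + 1 follows from the other two relations in degree n by
  -- differentiating `tricomiU_succ`.
  have d1 (n : ℕ) (b : ℂ) (h2 : tricomiU n b - derivative (tricomiU n b) = tricomiU n (b + 1))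
      (h4 : X * derivative (tricomiU n (b + 1)) + C b * tricomiU n (b + 1) =
        C (n + b) * tricomiU n b) :
      derivative (tricomiU (n + 1) b) = (n + 1) * tricomiU n (b + 1) := by
    rw [tricomiU_succ]
    simp only [derivative_sub, derivative_mul, derivative_X, derivative_C, derivative_natCast,
      map_add,
      map_natCast]
      at h4 ⊢
    linear_combination h4 + (n + C b) * h2
  induction n with
  | zero =>
    intro b
    have := d1 0 b
    simp [tricomiU_zero] at this ⊢
    exact this
  | succ n ih =>
    intro b
    obtain ⟨h2, h4, h1⟩ := ih b
    obtain ⟨h2', h4', h1'⟩ := ih (b + 1)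
    have k2 : tricomiU (n + 1) b - derivative (tricomiU (n + 1) b) = tricomiU (n + 1) (b + 1) := by
      rw [h1, tricomiU_succ, tricomiU_succ]
      simp only [map_add, map_natCast, map_one] at h4 ⊢
      linear_combination X * h2' + h4
    have k4 : X * derivative (tricomiU (n + 1) (b + 1)) + C b * tricomiU (n + 1) (b + 1) =
        C ((n + 1 : ℕ) + b) * tricomiU (n + 1) b := by
      have := tricomiU_succ n (b + 1)
      rw [h1'] 
      simp only [map_add, map_natCast, map_one, Nat.cast_add, Nat.cast_one] at this ⊢
      linear_combination -(n + 1) * this - (n + 1 + C b) * k2 - (n + 1 + C b) * h1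
    exact ⟨k2, k4, d1 _ _ k2 k4⟩

-- One monic polynomial in each degree: this is what makes Ω and V bases of ℂ[X].
open Polynomial in
theorem tricomiU_monic (n : ℕ) : ∀ b : ℂ, (tricomiU n b).Monic ∧ (tricomiU n b).natDegree = n := by
  induction n with
  | zero => intro b; simp [tricomiU_zero]
  | succ n ih =>
    intro b
    have h1 : (X * tricomiU n (b + 1)).Monic := monic_X.mul (ih _).1
    have h2 : (X * tricomiU n (b + 1)).natDegree = n + 1 := by
      rw [natDegree_X_mul (ih _).1.ne_zero, (ih _).2]
    have h3 : (C (n + b) * tricomiU n b).natDegree < (X * tricomiU n (b + 1)).natDegree := by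
      rw [h2]
      exact (natDegree_C_mul_le _ _).trans_lt (by rw [(ih b).2]; exact Nat.lt_succ_self n)
    rw [tricomiU_succ]
    exact ⟨h1.sub_of_left (degree_lt_degree h3),
      by rw [natDegree_sub_eq_left_of_natDegree_lt h3, h2]⟩

/-! ### The polynomial model of `W_λ` -/

noncomputable section

open Polynomial

/-- The derivation of `ℂ[X]` twisted by `exp(-2 X)`: `p ↦ p' - 2 p`. -/
def tD : ℂ[X] →ₗ[ℂ] ℂ[X] := derivative - (2 : ℂ) • LinearMap.id

theorem tD_apply (p : ℂ[X]) : tD p = derivative p - C 2 * p := by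
  simp [tD, smul_eq_C_mul]

theorem tD_X_mul (p : ℂ[X]) : tD (X * p) = p + X * tD p := by
  simp only [tD_apply, derivative_mul, derivative_X]; ring

theorem tD_C_mul (c : ℂ) (p : ℂ[X]) : tD (C c * p) = C c * tD p := by
  rw [← smul_eq_C_mul, map_smul, smul_eq_C_mul]

theorem tD_two_mul (p : ℂ[X]) : tD (2 * p) = 2 * tD p := by
  rw [show (2 : ℂ[X]) = C 2 from rfl, tD_C_mul]

/-- Quadruples `(a, b, c, d)` of polynomials, standing for the superfunctions
`(a + b y + c x₃ + d x₄) exp(-2 x)`. -/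
abbrev PM : Type := Fin 4 → ℂ[X]

/-- The linear combination, with coefficients `t`, of the elementary differential operators on
quadruples of polynomials (multiplications by `x, y, x₃, x₄`, vector fields, Bessel operators,
identity). -/
def pmOp (β : ℂ) (t : Fin 18 → ℂ) : PM →ₗ[ℂ] PM where
  toFun p :=
    ![C (t 0) * (X * p 0) + C (t 4) * (2 * (X * tD (p 0))) + C (t 7) * (2 * (X * p 3))
        - C (t 9) * (2 * (X * p 2)) + C (t 13) * (X * tD (tD (p 0)) - C β * tD (p 0))
        - C (t 14) * p 1 + C (t 15) * (2 * (X * tD (p 3)) - 2 * (C β * p 3))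
        + C (t 16) * (2 * (C β * p 2) - 2 * (X * tD (p 2))) + C (t 17) * p 0,
      C (t 0) * (X * p 1) + C (t 1) * p 0 - C (t 2) * (2 * (X * p 3)) + C (t 3) * (2 * (X * p 2))
        + C (t 4) * (2 * (X * tD (p 1))) + C (t 5) * (2 * p 1)
        + C (t 6) * (2 * (C β * p 3) - 2 * (X * tD (p 3)))
        + C (t 8) * (2 * (X * tD (p 2)) - 2 * (C β * p 2))
        + C (t 13) * (X * tD (tD (p 1)) - C β * tD (p 1)) + C (t 17) * p 1,
      C (t 0) * (X * p 2) + C (t 2) * p 0 + C (t 4) * (2 * (X * tD (p 2)) + p 2) + C (t 5) * p 2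
        + C (t 6) * tD (p 0) + C (t 7) * p 1 + C (t 10) * p 3 + C (t 12) * p 2
        + C (t 13) * (X * tD (tD (p 2)) + tD (p 2) - C β * tD (p 2)) + C (t 15) * tD (p 1)
        + C (t 17) * p 2,
      C (t 0) * (X * p 3) + C (t 3) * p 0 + C (t 4) * (2 * (X * tD (p 3)) + p 3) + C (t 5) * p 3
        + C (t 8) * tD (p 0) + C (t 9) * p 1 + C (t 11) * p 2 - C (t 12) * p 3
        + C (t 13) * (X * tD (tD (p 3)) + tD (p 3) - C β * tD (p 3)) + C (t 16) * tD (p 1)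
        + C (t 17) * p 3]
  map_add' p q := by
    ext i : 1
    fin_cases i <;> simp [Pi.add_apply] <;> ring
  map_smul' c p := by
    ext i : 1
    fin_cases i <;> simp [Pi.smul_apply, smul_eq_C_mul, tD_C_mul] <;> ring

/-- The four components come from applying the differential operators to (a + b y + c x₃ + d x₄)
exp(-2x) and reducing by y² = y x₃ = y x₄ = 0, x₃x₄ = -2xy. The derivative ∂ₓ becomes `tD`. The
indices are 0–3 multiplications, 4–12 vector fields, 13–16 Bessel operators, 17 the identity. -/
theorem pmOp_apply_zero (β : ℂ) (t : Fin 18 → ℂ) (p : PM) : pmOp β t p 0 =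
      C (t 0) * (X * p 0) + C (t 4) * (2 * (X * tD (p 0))) + C (t 7) * (2 * (X * p 3))
        - C (t 9) * (2 * (X * p 2)) + C (t 13) * (X * tD (tD (p 0)) - C β * tD (p 0))
        - C (t 14) * p 1 + C (t 15) * (2 * (X * tD (p 3)) - 2 * (C β * p 3))
        + C (t 16) * (2 * (C β * p 2) - 2 * (X * tD (p 2))) + C (t 17) * p 0 := rfl

theorem pmOp_apply_one (β : ℂ) (t : Fin 18 → ℂ) (p : PM) : pmOp β t p 1 =
      C (t 0) * (X * p 1) + C (t 1) * p 0 - C (t 2) * (2 * (X * p 3)) + C (t 3) * (2 * (X * p 2))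
        + C (t 4) * (2 * (X * tD (p 1))) + C (t 5) * (2 * p 1)
        + C (t 6) * (2 * (C β * p 3) - 2 * (X * tD (p 3)))
        + C (t 8) * (2 * (X * tD (p 2)) - 2 * (C β * p 2))
        + C (t 13) * (X * tD (tD (p 1)) - C β * tD (p 1)) + C (t 17) * p 1 := rfl

theorem pmOp_apply_two (β : ℂ) (t : Fin 18 → ℂ) (p : PM) : pmOp β t p 2 =
      C (t 0) * (X * p 2) + C (t 2) * p 0 + C (t 4) * (2 * (X * tD (p 2)) + p 2) + C (t 5) * p 2
        + C (t 6) * tD (p 0) + C (t 7) * p 1 + C (t 10) * p 3 + C (t 12) * p 2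
        + C (t 13) * (X * tD (tD (p 2)) + tD (p 2) - C β * tD (p 2)) + C (t 15) * tD (p 1)
        + C (t 17) * p 2 := rfl

theorem pmOp_apply_three (β : ℂ) (t : Fin 18 → ℂ) (p : PM) : pmOp β t p 3 =
      C (t 0) * (X * p 3) + C (t 3) * p 0 + C (t 4) * (2 * (X * tD (p 3)) + p 3) + C (t 5) * p 3
        + C (t 8) * tD (p 0) + C (t 9) * p 1 + C (t 11) * p 2 - C (t 12) * p 3
        + C (t 13) * (X * tD (tD (p 3)) + tD (p 3) - C β * tD (p 3)) + C (t 16) * tD (p 1)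
        + C (t 17) * p 3 := rfl

-- Linearity in the coefficients lets the comparison with π_λ be made on the 18 unit vectors only.
set_option maxHeartbeats 1000000 in
theorem pmOp_add (β : ℂ) (s t : Fin 18 → ℂ) (p : PM) :
    pmOp β (s + t) p = pmOp β s p + pmOp β t p := by
  funext i
  fin_cases i
  · change pmOp _ _ _ 0 = pmOp _ _ _ 0 + pmOp _ _ _ 0
    simp only [pmOp_apply_zero, Pi.add_apply, map_add]; ring
  · change pmOp _ _ _ 1 = pmOp _ _ _ 1 + pmOp _ _ _ 1
    simp only [pmOp_apply_one, Pi.add_apply, map_add]; ring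
  · change pmOp _ _ _ 2 = pmOp _ _ _ 2 + pmOp _ _ _ 2
    simp only [pmOp_apply_two, Pi.add_apply, map_add]; ring
  · change pmOp _ _ _ 3 = pmOp _ _ _ 3 + pmOp _ _ _ 3
    simp only [pmOp_apply_three, Pi.add_apply, map_add]; ring

set_option maxHeartbeats 1000000 in
theorem pmOp_smul (β c : ℂ) (t : Fin 18 → ℂ) (p : PM) :
    pmOp β (c • t) p = c • pmOp β t p := by
  funext i
  fin_cases i
  · change pmOp _ _ _ 0 = c • pmOp _ _ _ 0
    simp only [pmOp_apply_zero, Pi.smul_apply, smul_eq_mul, smul_eq_C_mul, map_mul]; ring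
  · change pmOp _ _ _ 1 = c • pmOp _ _ _ 1
    simp only [pmOp_apply_one, Pi.smul_apply, smul_eq_mul, smul_eq_C_mul, map_mul]; ring
  · change pmOp _ _ _ 2 = c • pmOp _ _ _ 2
    simp only [pmOp_apply_two, Pi.smul_apply, smul_eq_mul, smul_eq_C_mul, map_mul]; ring
  · change pmOp _ _ _ 3 = c • pmOp _ _ _ 3
    simp only [pmOp_apply_three, Pi.smul_apply, smul_eq_mul, smul_eq_C_mul, map_mul]; ring

/-! ### Entrywise computation in size four. -/

theorem vec_ext_four {R : Type*} {v w : Fin 4 → R} (h0 : v 0 = w 0) (h1 : v 1 = w 1)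
    (h2 : v 2 = w 2) (h3 : v 3 = w 3) : v = w := by
  funext i
  fin_cases i <;> assumption

theorem mat_ext_four {R : Type*} {M N : Matrix (Fin 4) (Fin 4) R}
    (h0 : M 0 0 = N 0 0 ∧ M 0 1 = N 0 1 ∧ M 0 2 = N 0 2 ∧ M 0 3 = N 0 3)
    (h1 : M 1 0 = N 1 0 ∧ M 1 1 = N 1 1 ∧ M 1 2 = N 1 2 ∧ M 1 3 = N 1 3)
    (h2 : M 2 0 = N 2 0 ∧ M 2 1 = N 2 1 ∧ M 2 2 = N 2 2 ∧ M 2 3 = N 2 3)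
    (h3 : M 3 0 = N 3 0 ∧ M 3 1 = N 3 1 ∧ M 3 2 = N 3 2 ∧ M 3 3 = N 3 3) : M = N :=
  vec_ext_four (vec_ext_four h0.1 h0.2.1 h0.2.2.1 h0.2.2.2)
    (vec_ext_four h1.1 h1.2.1 h1.2.2.1 h1.2.2.2) (vec_ext_four h2.1 h2.2.1 h2.2.2.1 h2.2.2.2)
    (vec_ext_four h3.1 h3.2.1 h3.2.2.1 h3.2.2.2)

theorem mulVec_four {R : Type*} [CommRing R] (M : Matrix (Fin 4) (Fin 4) R) (v : Fin 4 → R)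
    (i : Fin 4) : M.mulVec v i = M i 0 * v 0 + M i 1 * v 1 + M i 2 * v 2 + M i 3 * v 3 := by
  simp [Matrix.mulVec, dotProduct, Fin.sum_univ_four]

theorem mul_four {R : Type*} [CommRing R] (M N : Matrix (Fin 4) (Fin 4) R) (i j : Fin 4) :
    (M * N) i j = M i 0 * N 0 j + M i 1 * N 1 j + M i 2 * N 2 j + M i 3 * N 3 j := by
  simp [Matrix.mul_apply, Fin.sum_univ_four]

theorem jL_eq {𝕜 : Type*} [Field 𝕜] (α : 𝕜) (a : Fin 4 → 𝕜) :
    jL α a = !![a 0, 0, -a 3, a 2; 0, a 1, -(α * a 3), α * a 2;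
        a 2 / 2, a 2 / 2, (a 0 + a 1) / 2, 0; a 3 / 2, a 3 / 2, 0, (a 0 + a 1) / 2] := by
  ext i j
  fin_cases i <;> fin_cases j <;> simp [jL, jmul]

variable {𝕜 : Type*} [Field 𝕜] [Algebra 𝕜 ℂ]

/-- The coefficients of `π_λ(X)` with respect to the elementary operators on superfunctions. -/
def sfCoef (α lam : 𝕜) (Z : Amb 𝕜) : Fin 18 → ℂ :=
  let u := fun i => algebraMap 𝕜 ℂ (Z.1 i)
  let a := fun i => algebraMap 𝕜 ℂ (Z.2.1 i)
  let M := fun i j => algebraMap 𝕜 ℂ (Z.2.2.1 i j)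
  let x := fun i => algebraMap 𝕜 ℂ (Z.2.2.2 i)
  ![-2 * Complex.I * u 0, -2 * Complex.I * u 1, -2 * Complex.I * u 2, -2 * Complex.I * u 3,
    -a 0 / 2, -a 1 / 2, M 2 0 - a 2 / 2, -M 2 0 - a 2 / 2, M 3 0 - a 3 / 2, -M 3 0 - a 3 / 2,
    M 2 3, M 3 2, M 2 2,
    -(Complex.I / 2) * x 0, -(Complex.I / 2) * x 1, -(Complex.I / 2) * x 2,
    -(Complex.I / 2) * x 3,
    a 0 * (algebraMap 𝕜 ℂ lam / 2) + a 1 * (algebraMap 𝕜 ℂ lam / algebraMap 𝕜 ℂ α / 2)]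

/-- The change of coefficients for `λ = 1`, where `x = x₂`, `y = x₁` and `x₃` is rescaled. -/
def swapCoef (α : ℂ) (s : Fin 18 → ℂ) : Fin 18 → ℂ :=
  ![s 1, s 0, α * s 2, s 3, s 5, s 4, α * s 7, α * s 6, s 9, s 8, α * s 10, α⁻¹ * s 11, s 12,
    s 14, s 13, α * s 15, s 16, s 17]

/-! ### Derivations of `D_α` -/

/-- The general derivation of `D_α`. -/
def derMat (α m n r s t : 𝕜) : Matrix (Fin 4) (Fin 4) 𝕜 :=
  !![0, 0, 2 * n, -2 * m; 0, 0, -2 * α * n, 2 * α * m; m, -m, r, s; n, -n, t, -r]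

-- `jDer` is spanned by homogeneous derivations, so the even part (r, s, t) and the odd part (m, n)
-- are treated separately.
set_option maxHeartbeats 2000000 in
theorem derMat_mem (α m n r s t : 𝕜) : derMat α m n r s t ∈ jDer α := by
  have : CharZero 𝕜 := (algebraMap 𝕜 ℂ).charZero
  have key : derMat α m n r s t = derMat α 0 0 r s t + derMat α m n 0 0 0 := by
    ext i j
    fin_cases i <;> fin_cases j <;> simp [derMat]
  rw [key]
  have hp2 : ∀ p : ZMod 2, p = 0 ∨ p = 1 := by decide
  have vec {q a} (ha : VecHom (𝕜 := 𝕜) q a) :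
      (q = 0 ∧ a = ![a 0, a 1, 0, 0]) ∨ (q = 1 ∧ a = ![0, 0, a 2, a 3]) := by
    simp only [Fin.forall_fin_succ, Fin.forall_fin_zero, VecHom] at ha
    rcases hp2 q with rfl | rfl
    · refine Or.inl ⟨rfl, funext fun i => ?_⟩
      fin_cases i <;> simp [par] at ha ⊢ <;> simp [ha]
    · refine Or.inr ⟨rfl, funext fun i => ?_⟩
      fin_cases i <;> simp [par] at ha ⊢ <;> simp [ha]
  refine Submodule.add_mem _ (Submodule.subset_span ⟨0, ?_, ?_⟩)
    (Submodule.subset_span ⟨1, ?_, ?_⟩)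
  · intro i j
    fin_cases i <;> fin_cases j <;> simp [par, derMat]
  · intro q a ha
    rcases vec ha with ⟨rfl, h⟩ | ⟨rfl, h⟩ <;> rw [h] <;>
    refine mat_ext_four ⟨?_, ?_, ?_, ?_⟩ ⟨?_, ?_, ?_, ?_⟩ ⟨?_, ?_, ?_, ?_⟩ ⟨?_, ?_, ?_, ?_⟩ <;>
    simp only [show sgn 0 0 = 1 from rfl, show sgn 0 1 = 1 from rfl, jL_eq, derMat, mulVec_four,
      mul_four, Matrix.sub_apply, Matrix.smul_apply, Matrix.neg_apply,
      Matrix.of_apply, Matrix.cons_val, Matrix.cons_val', one_smul, neg_smul, mul_zero, zero_mul,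
      add_zero, zero_add, sub_zero, neg_zero, zero_div] <;>
    ring
  · intro i j
    fin_cases i <;> fin_cases j <;> simp [par, derMat, show (1 : ZMod 2) + 1 = 0 from rfl]
  · intro q a ha
    rcases vec ha with ⟨rfl, h⟩ | ⟨rfl, h⟩ <;> rw [h] <;>
    refine mat_ext_four ⟨?_, ?_, ?_, ?_⟩ ⟨?_, ?_, ?_, ?_⟩ ⟨?_, ?_, ?_, ?_⟩ ⟨?_, ?_, ?_, ?_⟩ <;>
    simp only [show sgn 1 0 = 1 from rfl, show sgn 1 1 = -1 from rfl, jL_eq, derMat, mulVec_four,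
      mul_four, Matrix.sub_apply, Matrix.smul_apply, Matrix.neg_apply,
      Matrix.of_apply, Matrix.cons_val, Matrix.cons_val', one_smul, neg_smul, mul_zero, zero_mul,
      add_zero, zero_add, sub_zero, neg_zero, zero_div] <;>
    ring

/-- With `derMat_mem`, this identifies Der(D_α) with a five-parameter family of matrices, three
parameters even and two odd. -/
theorem eq_derMat (α : 𝕜) (M : Matrix (Fin 4) (Fin 4) 𝕜) (h : M ∈ jDer α) :
    M = derMat α (M 2 0) (M 3 0) (M 2 2) (M 2 3) (M 3 2) := by
  obtain ⟨⟨h1, h2, h3, h4⟩, ⟨h5, h6, h7⟩, ⟨h8, h9, h10⟩, h11⟩ := mem_jDer_entries α M h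
  ext i j
  fin_cases i <;> fin_cases j <;> simp [derMat, *]

end

noncomputable section

open Polynomial

/-! ### The commutation relations of the elementary operators -/

/-- The coefficients of an even operator from `𝔤`. -/
def evenCoef (β : ℂ) (v : Fin 9 → ℂ) : Fin 18 → ℂ :=
  ![v 0, v 1, 0, 0, v 2, v 3, 0, 0, 0, 0, v 4, v 5, v 6, v 7, v 8, 0, 0, -(β * v 2 + v 3)]

/-- The coefficients of an odd operator from `𝔤`. -/
def oddCoef (v : Fin 8 → ℂ) : Fin 18 → ℂ :=
  ![0, 0, v 0, v 1, 0, 0, v 2, v 3, v 4, v 5, 0, 0, 0, 0, 0, v 6, v 7, 0]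

/-- The coefficients of the supercommutator of two even operators. -/
def evenBracket (v : Fin 9 → ℂ) (w : Fin 9 → ℂ) : Fin 9 → ℂ :=
  ![-2 * v 0 * w 2 + 2 * v 2 * w 0,
    -2 * v 1 * w 3 + 2 * v 3 * w 1,
    -v 0 * w 7 + v 7 * w 0,
    -v 1 * w 8 + v 8 * w 1,
    -2 * v 4 * w 6 + 2 * v 6 * w 4,
    2 * v 5 * w 6 - 2 * v 6 * w 5,
    v 4 * w 5 - v 5 * w 4,
    -2 * v 2 * w 7 + 2 * v 7 * w 2,
    -2 * v 3 * w 8 + 2 * v 8 * w 3]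

/-- The coefficients of the supercommutator of an even and an odd operator. -/
def mixedBracket (v : Fin 9 → ℂ) (w : Fin 8 → ℂ) : Fin 8 → ℂ :=
  ![-v 0 * w 2 - v 1 * w 3 + v 2 * w 0 + v 3 * w 0 + v 4 * w 1 + v 6 * w 0,
    -v 0 * w 4 - v 1 * w 5 + v 2 * w 1 + v 3 * w 1 + v 5 * w 0 - v 6 * w 1,
    -v 1 * w 6 - v 2 * w 2 + v 3 * w 2 + v 4 * w 4 + v 6 * w 2 + v 7 * w 0,
    -v 0 * w 6 + v 2 * w 3 - v 3 * w 3 + v 4 * w 5 + v 6 * w 3 + v 8 * w 0,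
    -v 1 * w 7 - v 2 * w 4 + v 3 * w 4 + v 5 * w 2 - v 6 * w 4 + v 7 * w 1,
    -v 0 * w 7 + v 2 * w 5 - v 3 * w 5 + v 5 * w 3 - v 6 * w 5 + v 8 * w 1,
    -v 2 * w 6 - v 3 * w 6 + v 4 * w 7 + v 6 * w 6 + v 7 * w 3 + v 8 * w 2,
    -v 2 * w 7 - v 3 * w 7 + v 5 * w 6 - v 6 * w 7 + v 7 * w 5 + v 8 * w 4]

/-- The coefficients of the supercommutator of two odd operators. -/
def oddBracket (β : ℂ) (v : Fin 8 → ℂ) (w : Fin 8 → ℂ) : Fin 9 → ℂ :=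
  ![-2 * v 0 * w 5 + 2 * v 1 * w 3 + 2 * v 3 * w 1 - 2 * v 5 * w 0,
    β * (-2 * v 0 * w 4 + 2 * v 1 * w 2 + 2 * v 2 * w 1 - 2 * v 4 * w 0),
    -v 0 * w 7 + v 1 * w 6 - v 2 * w 5 + v 3 * w 4 + v 4 * w 3 - v 5 * w 2 + v 6 * w 1 - v 7 * w 0,
    β * (-v 0 * w 7 + v 1 * w 6 + v 2 * w 5 - v 3 * w 4 - v 4 * w 3 + v 5 * w 2 + v 6 * w 1 - v 7 * w 0),
    (1 + β) * (-2 * v 0 * w 6 + 2 * v 2 * w 3 + 2 * v 3 * w 2 - 2 * v 6 * w 0),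
    (1 + β) * (2 * v 1 * w 7 - 2 * v 4 * w 5 - 2 * v 5 * w 4 + 2 * v 7 * w 1),
    (1 + β) * (v 0 * w 7 + v 1 * w 6 - v 2 * w 5 - v 3 * w 4 - v 4 * w 3 - v 5 * w 2 + v 6 * w 1 + v 7 * w 0),
    -2 * v 2 * w 7 + 2 * v 4 * w 6 + 2 * v 6 * w 4 - 2 * v 7 * w 2,
    β * (-2 * v 3 * w 7 + 2 * v 5 * w 6 + 2 * v 6 * w 5 - 2 * v 7 * w 3)]

-- Moving `tD` past X and the constants leaves a commutative identity. The identity coefficient in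
-- `evenCoef` is forced: for instance [X tD² - β tD, X] = 2X tD - β.
set_option maxHeartbeats 4000000 in
theorem pmOp_evenBracket (β : ℂ) (v : Fin 9 → ℂ) (w : Fin 9 → ℂ) (p : PM) :
    pmOp β (evenCoef β (evenBracket v w)) p =
      pmOp β (evenCoef β v) (pmOp β (evenCoef β w) p) - pmOp β (evenCoef β w) (pmOp β (evenCoef β v) p) := by
  funext i
  fin_cases i
  · change pmOp _ _ _ 0 = pmOp _ _ _ 0 - pmOp _ _ _ 0
    simp only [pmOp_apply_zero, pmOp_apply_one, pmOp_apply_two, pmOp_apply_three, evenCoef,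
      oddCoef, evenBracket, Matrix.cons_val, C_0, zero_mul, mul_zero, add_zero, zero_add, sub_zero,
      zero_sub, neg_zero, map_zero, map_add, map_sub, map_neg, map_mul, map_one, map_ofNat,
      neg_mul, add_mul, mul_assoc, tD_X_mul, tD_C_mul, tD_two_mul]
    ring
  · change pmOp _ _ _ 1 = pmOp _ _ _ 1 - pmOp _ _ _ 1
    simp only [pmOp_apply_zero, pmOp_apply_one, pmOp_apply_two, pmOp_apply_three, evenCoef,
      oddCoef, evenBracket, Matrix.cons_val, C_0, zero_mul, mul_zero, add_zero, zero_add, sub_zero,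
      zero_sub, neg_zero, map_zero, map_add, map_sub, map_neg, map_mul, map_one, map_ofNat,
      neg_mul, add_mul, mul_assoc, tD_X_mul, tD_C_mul, tD_two_mul]
    ring
  · change pmOp _ _ _ 2 = pmOp _ _ _ 2 - pmOp _ _ _ 2
    simp only [pmOp_apply_zero, pmOp_apply_one, pmOp_apply_two, pmOp_apply_three, evenCoef,
      oddCoef, evenBracket, Matrix.cons_val, C_0, zero_mul, mul_zero, add_zero, zero_add, sub_zero,
      zero_sub, neg_zero, map_zero, map_add, map_sub, map_neg, map_mul, map_one, map_ofNat,
      neg_mul, add_mul, mul_assoc, tD_X_mul, tD_C_mul, tD_two_mul]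
    ring
  · change pmOp _ _ _ 3 = pmOp _ _ _ 3 - pmOp _ _ _ 3
    simp only [pmOp_apply_zero, pmOp_apply_one, pmOp_apply_two, pmOp_apply_three, evenCoef,
      oddCoef, evenBracket, Matrix.cons_val, C_0, zero_mul, mul_zero, add_zero, zero_add, sub_zero,
      zero_sub, neg_zero, map_zero, map_add, map_sub, map_neg, map_mul, map_one, map_ofNat,
      neg_mul, add_mul, mul_assoc, tD_X_mul, tD_C_mul, tD_two_mul]
    ring

set_option maxHeartbeats 4000000 in
theorem pmOp_mixedBracket (β : ℂ) (v : Fin 9 → ℂ) (w : Fin 8 → ℂ) (p : PM) :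
    pmOp β (oddCoef (mixedBracket v w)) p =
      pmOp β (evenCoef β v) (pmOp β (oddCoef w) p) - pmOp β (oddCoef w) (pmOp β (evenCoef β v) p) := by
  funext i
  fin_cases i
  · change pmOp _ _ _ 0 = pmOp _ _ _ 0 - pmOp _ _ _ 0
    simp only [pmOp_apply_zero, pmOp_apply_one, pmOp_apply_two, pmOp_apply_three, evenCoef,
      oddCoef, mixedBracket, Matrix.cons_val, C_0, zero_mul, mul_zero, add_zero, zero_add, sub_zero,
      zero_sub, neg_zero, map_zero, map_add, map_sub, map_neg, map_mul, map_one, map_ofNat,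
      neg_mul, add_mul, mul_assoc, tD_X_mul, tD_C_mul, tD_two_mul]
    ring
  · change pmOp _ _ _ 1 = pmOp _ _ _ 1 - pmOp _ _ _ 1
    simp only [pmOp_apply_zero, pmOp_apply_one, pmOp_apply_two, pmOp_apply_three, evenCoef,
      oddCoef, mixedBracket, Matrix.cons_val, C_0, zero_mul, mul_zero, add_zero, zero_add, sub_zero,
      zero_sub, neg_zero, map_zero, map_add, map_sub, map_neg, map_mul, map_one, map_ofNat,
      neg_mul, add_mul, mul_assoc, tD_X_mul, tD_C_mul, tD_two_mul]
    ring
  · change pmOp _ _ _ 2 = pmOp _ _ _ 2 - pmOp _ _ _ 2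
    simp only [pmOp_apply_zero, pmOp_apply_one, pmOp_apply_two, pmOp_apply_three, evenCoef,
      oddCoef, mixedBracket, Matrix.cons_val, C_0, zero_mul, mul_zero, add_zero, zero_add, sub_zero,
      zero_sub, neg_zero, map_zero, map_add, map_sub, map_neg, map_mul, map_one, map_ofNat,
      neg_mul, add_mul, mul_assoc, tD_X_mul, tD_C_mul, tD_two_mul]
    ring
  · change pmOp _ _ _ 3 = pmOp _ _ _ 3 - pmOp _ _ _ 3
    simp only [pmOp_apply_zero, pmOp_apply_one, pmOp_apply_two, pmOp_apply_three, evenCoef,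
      oddCoef, mixedBracket, Matrix.cons_val, C_0, zero_mul, mul_zero, add_zero, zero_add, sub_zero,
      zero_sub, neg_zero, map_zero, map_add, map_sub, map_neg, map_mul, map_one, map_ofNat,
      neg_mul, add_mul, mul_assoc, tD_X_mul, tD_C_mul, tD_two_mul]
    ring

-- Two odd operators have an anticommutator, hence the plus sign.
set_option maxHeartbeats 4000000 in
theorem pmOp_oddBracket (β : ℂ) (v : Fin 8 → ℂ) (w : Fin 8 → ℂ) (p : PM) :
    pmOp β (evenCoef β (oddBracket β v w)) p =
      pmOp β (oddCoef v) (pmOp β (oddCoef w) p) + pmOp β (oddCoef w) (pmOp β (oddCoef v) p) := by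
  funext i
  fin_cases i
  · change pmOp _ _ _ 0 = pmOp _ _ _ 0 + pmOp _ _ _ 0
    simp only [pmOp_apply_zero, pmOp_apply_one, pmOp_apply_two, pmOp_apply_three, evenCoef,
      oddCoef, oddBracket, Matrix.cons_val, C_0, zero_mul, mul_zero, add_zero, zero_add, sub_zero,
      zero_sub, neg_zero, map_zero, map_add, map_sub, map_neg, map_mul, map_one, map_ofNat,
      neg_mul, add_mul, mul_assoc, tD_X_mul, tD_C_mul, tD_two_mul]
    ring
  · change pmOp _ _ _ 1 = pmOp _ _ _ 1 + pmOp _ _ _ 1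
    simp only [pmOp_apply_zero, pmOp_apply_one, pmOp_apply_two, pmOp_apply_three, evenCoef,
      oddCoef, oddBracket, Matrix.cons_val, C_0, zero_mul, mul_zero, add_zero, zero_add, sub_zero,
      zero_sub, neg_zero, map_zero, map_add, map_sub, map_neg, map_mul, map_one, map_ofNat,
      neg_mul, add_mul, mul_assoc, tD_X_mul, tD_C_mul, tD_two_mul]
    ring
  · change pmOp _ _ _ 2 = pmOp _ _ _ 2 + pmOp _ _ _ 2
    simp only [pmOp_apply_zero, pmOp_apply_one, pmOp_apply_two, pmOp_apply_three, evenCoef,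
      oddCoef, oddBracket, Matrix.cons_val, C_0, zero_mul, mul_zero, add_zero, zero_add, sub_zero,
      zero_sub, neg_zero, map_zero, map_add, map_sub, map_neg, map_mul, map_one, map_ofNat,
      neg_mul, add_mul, mul_assoc, tD_X_mul, tD_C_mul, tD_two_mul]
    ring
  · change pmOp _ _ _ 3 = pmOp _ _ _ 3 + pmOp _ _ _ 3
    simp only [pmOp_apply_zero, pmOp_apply_one, pmOp_apply_two, pmOp_apply_three, evenCoef,
      oddCoef, oddBracket, Matrix.cons_val, C_0, zero_mul, mul_zero, add_zero, zero_add, sub_zero,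
      zero_sub, neg_zero, map_zero, map_add, map_sub, map_neg, map_mul, map_one, map_ofNat,
      neg_mul, add_mul, mul_assoc, tD_X_mul, tD_C_mul, tD_two_mul]
    ring

end

/-! ### Homogeneous elements of `𝔤` in coordinates -/

/-- The even element of `𝔤` with coordinates `e`. -/
def evenAmb {𝕜 : Type*} [Field 𝕜] (α : 𝕜) (e : Fin 9 → 𝕜) : Amb 𝕜 :=
  (![e 0, e 1, 0, 0], ![e 2, e 3, 0, 0], derMat α 0 0 (e 4) (e 5) (e 6), ![e 7, e 8, 0, 0])

/-- The odd element of `𝔤` with coordinates `e`. -/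
def oddAmb {𝕜 : Type*} [Field 𝕜] (α : 𝕜) (e : Fin 8 → 𝕜) : Amb 𝕜 :=
  (![0, 0, e 0, e 1], ![0, 0, e 2, e 3], derMat α (e 4) (e 5) 0 0 0, ![0, 0, e 6, e 7])

/-- The coordinates of the bracket of an even element and an even element of `𝔤`. -/
def ambEvenEven {𝕜 : Type*} [Field 𝕜] (e : Fin 9 → 𝕜) (f : Fin 9 → 𝕜) : Fin 9 → 𝕜 :=
  ![e 0 * f 2 - e 2 * f 0,
    e 1 * f 3 - e 3 * f 1,
    -2 * e 0 * f 7 + 2 * e 7 * f 0,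
    -2 * e 1 * f 8 + 2 * e 8 * f 1,
    e 5 * f 6 - e 6 * f 5,
    2 * e 4 * f 5 - 2 * e 5 * f 4,
    -2 * e 4 * f 6 + 2 * e 6 * f 4,
    e 2 * f 7 - e 7 * f 2,
    e 3 * f 8 - e 8 * f 3]

-- The middle component is first a matrix in End(D_α). Its agreement with a `derMat` is what shows
-- that the bracket stays in 𝔤.
set_option maxHeartbeats 4000000 in
theorem bracket_even_even {𝕜 : Type*} [Field 𝕜] [CharZero 𝕜] (α : 𝕜) (e : Fin 9 → 𝕜) (f : Fin 9 → 𝕜) :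
    bracket α 1 (evenAmb α e) (evenAmb α f) = evenAmb α (ambEvenEven e f) := by
  refine Prod.ext (vec_ext_four ?_ ?_ ?_ ?_) (Prod.ext (vec_ext_four ?_ ?_ ?_ ?_) (Prod.ext
    (mat_ext_four ⟨?_, ?_, ?_, ?_⟩ ⟨?_, ?_, ?_, ?_⟩ ⟨?_, ?_, ?_, ?_⟩ ⟨?_, ?_, ?_, ?_⟩)
    (vec_ext_four ?_ ?_ ?_ ?_))) <;>
  simp only [bracket, evenAmb, oddAmb, ambEvenEven, jL_eq, derMat, jmul, Pi.add_apply, Pi.sub_apply,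
    Pi.smul_apply, Matrix.add_apply, Matrix.sub_apply, Matrix.smul_apply, smul_eq_mul, one_smul,
    neg_smul, Pi.neg_apply, Matrix.neg_apply, mulVec_four, mul_four, Matrix.of_apply,
    Matrix.cons_val, Matrix.cons_val', mul_zero, zero_mul, add_zero, zero_add, sub_zero,
    neg_zero] <;>
  ring

/-- The coordinates of the bracket of an even element and an odd element of `𝔤`. -/
def ambEvenOdd {𝕜 : Type*} [Field 𝕜] (e : Fin 9 → 𝕜) (f : Fin 8 → 𝕜) : Fin 8 → 𝕜 :=
  ![e 0 * f 2 / 2 - e 0 * f 4 + e 1 * f 2 / 2 + e 1 * f 4 - e 2 * f 0 / 2 - e 3 * f 0 / 2 + e 4 * f 0 + e 5 * f 1,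
    e 0 * f 3 / 2 - e 0 * f 5 + e 1 * f 3 / 2 + e 1 * f 5 - e 2 * f 1 / 2 - e 3 * f 1 / 2 - e 4 * f 1 + e 6 * f 0,
    -e 0 * f 6 - e 1 * f 6 - e 2 * f 4 + e 3 * f 4 + e 4 * f 2 + e 5 * f 3 + e 7 * f 0 + e 8 * f 0,
    -e 0 * f 7 - e 1 * f 7 - e 2 * f 5 + e 3 * f 5 - e 4 * f 3 + e 6 * f 2 + e 7 * f 1 + e 8 * f 1,
    -e 0 * f 6 / 2 + e 1 * f 6 / 2 - e 2 * f 2 / 4 + e 3 * f 2 / 4 + e 4 * f 4 + e 5 * f 5 - e 7 * f 0 / 2 + e 8 * f 0 / 2,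
    -e 0 * f 7 / 2 + e 1 * f 7 / 2 - e 2 * f 3 / 4 + e 3 * f 3 / 4 - e 4 * f 5 + e 6 * f 4 - e 7 * f 1 / 2 + e 8 * f 1 / 2,
    e 2 * f 6 / 2 + e 3 * f 6 / 2 + e 4 * f 6 + e 5 * f 7 - e 7 * f 2 / 2 - e 7 * f 4 - e 8 * f 2 / 2 + e 8 * f 4,
    e 2 * f 7 / 2 + e 3 * f 7 / 2 - e 4 * f 7 + e 6 * f 6 - e 7 * f 3 / 2 - e 7 * f 5 - e 8 * f 3 / 2 + e 8 * f 5]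

set_option maxHeartbeats 4000000 in
theorem bracket_even_odd {𝕜 : Type*} [Field 𝕜] [CharZero 𝕜] (α : 𝕜) (e : Fin 9 → 𝕜) (f : Fin 8 → 𝕜) :
    bracket α 1 (evenAmb α e) (oddAmb α f) = oddAmb α (ambEvenOdd e f) := by
  refine Prod.ext (vec_ext_four ?_ ?_ ?_ ?_) (Prod.ext (vec_ext_four ?_ ?_ ?_ ?_) (Prod.ext
    (mat_ext_four ⟨?_, ?_, ?_, ?_⟩ ⟨?_, ?_, ?_, ?_⟩ ⟨?_, ?_, ?_, ?_⟩ ⟨?_, ?_, ?_, ?_⟩)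
    (vec_ext_four ?_ ?_ ?_ ?_))) <;>
  simp only [bracket, evenAmb, oddAmb, ambEvenOdd, jL_eq, derMat, jmul, Pi.add_apply, Pi.sub_apply,
    Pi.smul_apply, Matrix.add_apply, Matrix.sub_apply, Matrix.smul_apply, smul_eq_mul, one_smul,
    neg_smul, Pi.neg_apply, Matrix.neg_apply, mulVec_four, mul_four, Matrix.of_apply,
    Matrix.cons_val, Matrix.cons_val', mul_zero, zero_mul, add_zero, zero_add, sub_zero,
    neg_zero] <;>
  ring

/-- The coordinates of the bracket of an odd element and an odd element of `𝔤`. -/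
def ambOddOdd {𝕜 : Type*} [Field 𝕜] (α : 𝕜) (e : Fin 8 → 𝕜) (f : Fin 8 → 𝕜) : Fin 9 → 𝕜 :=
  ![e 0 * f 3 + 2 * e 0 * f 5 - e 1 * f 2 - 2 * e 1 * f 4 - e 2 * f 1 + e 3 * f 0 - 2 * e 4 * f 1 + 2 * e 5 * f 0,
    α * (e 0 * f 3 - 2 * e 0 * f 5 - e 1 * f 2 + 2 * e 1 * f 4 - e 2 * f 1 + e 3 * f 0 + 2 * e 4 * f 1 - 2 * e 5 * f 0),
    -2 * e 0 * f 7 + 2 * e 1 * f 6 + 2 * e 2 * f 5 - 2 * e 3 * f 4 - 2 * e 4 * f 3 + 2 * e 5 * f 2 + 2 * e 6 * f 1 - 2 * e 7 * f 0,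
    α * (-2 * e 0 * f 7 + 2 * e 1 * f 6 - 2 * e 2 * f 5 + 2 * e 3 * f 4 + 2 * e 4 * f 3 - 2 * e 5 * f 2 + 2 * e 6 * f 1 - 2 * e 7 * f 0),
    (1 + α) * (-e 0 * f 7 - e 1 * f 6 - e 2 * f 3 / 2 - e 3 * f 2 / 2 + 2 * e 4 * f 5 + 2 * e 5 * f 4 - e 6 * f 1 - e 7 * f 0),
    (1 + α) * (2 * e 0 * f 6 + e 2 * f 2 - 4 * e 4 * f 4 + 2 * e 6 * f 0),
    (1 + α) * (-2 * e 1 * f 7 - e 3 * f 3 + 4 * e 5 * f 5 - 2 * e 7 * f 1),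
    e 2 * f 7 - e 3 * f 6 - 2 * e 4 * f 7 + 2 * e 5 * f 6 - e 6 * f 3 + 2 * e 6 * f 5 + e 7 * f 2 - 2 * e 7 * f 4,
    α * (e 2 * f 7 - e 3 * f 6 + 2 * e 4 * f 7 - 2 * e 5 * f 6 - e 6 * f 3 - 2 * e 6 * f 5 + e 7 * f 2 + 2 * e 7 * f 4)]

-- The even derivation part carries the factor 1 + α. At α = -1 the odd derivations anticommute,
-- which is the source of the exceptional case.
set_option maxHeartbeats 4000000 in
theorem bracket_odd_odd {𝕜 : Type*} [Field 𝕜] [CharZero 𝕜] (α : 𝕜) (e : Fin 8 → 𝕜) (f : Fin 8 → 𝕜) :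
    bracket α (-1) (oddAmb α e) (oddAmb α f) = evenAmb α (ambOddOdd α e f) := by
  refine Prod.ext (vec_ext_four ?_ ?_ ?_ ?_) (Prod.ext (vec_ext_four ?_ ?_ ?_ ?_) (Prod.ext
    (mat_ext_four ⟨?_, ?_, ?_, ?_⟩ ⟨?_, ?_, ?_, ?_⟩ ⟨?_, ?_, ?_, ?_⟩ ⟨?_, ?_, ?_, ?_⟩)
    (vec_ext_four ?_ ?_ ?_ ?_))) <;>
  simp only [bracket, evenAmb, oddAmb, ambOddOdd, jL_eq, derMat, jmul, Pi.add_apply, Pi.sub_apply,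
    Pi.smul_apply, Matrix.add_apply, Matrix.sub_apply, Matrix.smul_apply, smul_eq_mul, one_smul,
    neg_smul, Pi.neg_apply, Matrix.neg_apply, mulVec_four, mul_four, Matrix.of_apply,
    Matrix.cons_val, Matrix.cons_val', mul_zero, zero_mul, add_zero, zero_add, sub_zero,
    neg_zero] <;>
  ring

/-! ### From brackets in coordinates to supercommutators of operators. -/

noncomputable section

variable {𝕜 : Type*} [Field 𝕜] [Algebra 𝕜 ℂ]

theorem exists_evenAmb {α : 𝕜} {X : Amb 𝕜} (hX : X ∈ gAlg α) (h : AmbHom 0 X) :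
    ∃ e, X = evenAmb α e := by
  obtain ⟨u, a, M, x⟩ := X
  have hM := eq_derMat α M hX
  obtain ⟨h1, h2, h3, h4⟩ := h
  refine ⟨![u 0, u 1, a 0, a 1, M 2 2, M 2 3, M 3 2, x 0, x 1], ?_⟩
  have m1 : M 2 0 = 0 := h3 2 0 (by simp [par])
  have m2 : M 3 0 = 0 := h3 3 0 (by simp [par])
  rw [m1, m2] at hM
  simp only [evenAmb, Prod.mk.injEq]
  refine ⟨vec_ext_four rfl rfl (h1 2 ?_) (h1 3 ?_), vec_ext_four rfl rfl (h2 2 ?_) (h2 3 ?_), hM,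
    vec_ext_four rfl rfl (h4 2 ?_) (h4 3 ?_)⟩ <;> simp [par]

theorem exists_oddAmb {α : 𝕜} {X : Amb 𝕜} (hX : X ∈ gAlg α) (h : AmbHom 1 X) :
    ∃ e, X = oddAmb α e := by
  obtain ⟨u, a, M, x⟩ := X
  have hM := eq_derMat α M hX
  obtain ⟨h1, h2, h3, h4⟩ := h
  refine ⟨![u 2, u 3, a 2, a 3, M 2 0, M 3 0, x 2, x 3], ?_⟩
  have two : (0 : ZMod 2) = 1 + 1 := rfl
  have m1 : M 2 2 = 0 := h3 2 2 (by simp [par])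
  have m2 : M 2 3 = 0 := h3 2 3 (by simp [par])
  have m3 : M 3 2 = 0 := h3 3 2 (by simp [par])
  rw [m1, m2, m3] at hM
  simp only [oddAmb, Prod.mk.injEq]
  refine ⟨vec_ext_four (h1 0 ?_) (h1 1 ?_) rfl rfl, vec_ext_four (h2 0 ?_) (h2 1 ?_) rfl rfl, hM,
    vec_ext_four (h4 0 ?_) (h4 1 ?_) rfl rfl⟩ <;> simp [par]

/-- Reduces the odd–even bracket to the even–odd one. -/
theorem bracket_swap {𝕜 : Type*} [Field 𝕜] (α : 𝕜) (X Y : Amb 𝕜) :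
    bracket α 1 X Y = -bracket α 1 Y X := by
  obtain ⟨u, a, M, x⟩ := X
  obtain ⟨v, b, N, y⟩ := Y
  simp only [bracket, one_smul, Prod.neg_mk, Prod.mk.injEq, smul_sub]
  refine ⟨by abel, by abel, by abel, by abel⟩

theorem evenAmb_mem (α : 𝕜) (e : Fin 9 → 𝕜) : evenAmb α e ∈ gAlg α :=
  derMat_mem (𝕜 := 𝕜) α 0 0 (e 4) (e 5) (e 6)

theorem oddAmb_mem (α : 𝕜) (e : Fin 8 → 𝕜) : oddAmb α e ∈ gAlg α :=
  derMat_mem (𝕜 := 𝕜) α (e 4) (e 5) 0 0 0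

/-- A linear map from `𝔤` to coefficients of operators that respects parities and brackets
in coordinates intertwines the superbracket with the supercommutator of operators. -/
theorem pmOp_bracket {α : 𝕜} {β : ℂ} {κ : Amb 𝕜 → Fin 18 → ℂ} {ε : (Fin 9 → 𝕜) → Fin 9 → ℂ}
    {o : (Fin 8 → 𝕜) → Fin 8 → ℂ} (hneg : ∀ X, κ (-X) = -κ X)
    (hε : ∀ e, κ (evenAmb α e) = evenCoef β (ε e)) (ho : ∀ e, κ (oddAmb α e) = oddCoef (o e))
    (hεε : ∀ e f, ε (ambEvenEven e f) = evenBracket (ε e) (ε f))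
    (hεo : ∀ e f, o (ambEvenOdd e f) = mixedBracket (ε e) (o f))
    (hoo : ∀ e f, ε (ambOddOdd α e f) = oddBracket β (o e) (o f))
    {p q : ZMod 2} {X Y : Amb 𝕜} (hX : X ∈ gAlg α) (hY : Y ∈ gAlg α)
    (hp : AmbHom p X) (hq : AmbHom q Y) :
    bracket α (sgn p q) X Y ∈ gAlg α ∧ ∀ w, pmOp β (κ (bracket α (sgn p q) X Y)) w =
      pmOp β (κ X) (pmOp β (κ Y) w) - sgn p q • pmOp β (κ Y) (pmOp β (κ X) w) := by
  have : CharZero 𝕜 := (algebraMap 𝕜 ℂ).charZero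
  have hp2 : ∀ p : ZMod 2, p = 0 ∨ p = 1 := by decide
  -- The sign is 1 for mixed parities in either order, so this one computation serves two of the
  -- four cases.
  have mixed (e f) : bracket α 1 (evenAmb α e) (oddAmb α f) ∈ gAlg α ∧
      ∀ w, pmOp β (κ (bracket α 1 (evenAmb α e) (oddAmb α f))) w =
      pmOp β (κ (evenAmb α e)) (pmOp β (κ (oddAmb α f)) w) -
        pmOp β (κ (oddAmb α f)) (pmOp β (κ (evenAmb α e)) w) := by
    refine ⟨by rw [bracket_even_odd]; exact oddAmb_mem α _, fun w => ?_⟩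
    rw [bracket_even_odd, ho, hε, ho, hεo, pmOp_mixedBracket]
  rcases hp2 p with rfl | rfl <;> rcases hp2 q with rfl | rfl
  · obtain ⟨e, rfl⟩ := exists_evenAmb hX hp
    obtain ⟨f, rfl⟩ := exists_evenAmb hY hq
    rw [show sgn 0 0 = 1 from rfl, bracket_even_even]
    refine ⟨evenAmb_mem α _, fun w => ?_⟩
    rw [hε, hε, hε, hεε, pmOp_evenBracket, one_smul]
  · obtain ⟨e, rfl⟩ := exists_evenAmb hX hp
    obtain ⟨f, rfl⟩ := exists_oddAmb hY hq
    rw [show sgn 0 1 = 1 from rfl]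
    simpa only [one_smul] using mixed e f
  · obtain ⟨e, rfl⟩ := exists_oddAmb hX hp
    obtain ⟨f, rfl⟩ := exists_evenAmb hY hq
    rw [show sgn 1 0 = 1 from rfl, bracket_swap]
    refine ⟨Submodule.neg_mem _ (mixed f e).1, fun w => ?_⟩
    rw [hneg, ← neg_one_smul ℂ, pmOp_smul, (mixed f e).2, one_smul, neg_one_smul, neg_sub]
  · obtain ⟨e, rfl⟩ := exists_oddAmb hX hp
    obtain ⟨f, rfl⟩ := exists_oddAmb hY hq
    rw [show sgn 1 1 = -1 from rfl, bracket_odd_odd]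
    refine ⟨evenAmb_mem α _, fun w => ?_⟩
    rw [hε, ho, ho, hoo, pmOp_oddBracket, neg_one_smul, sub_neg_eq_add]

theorem sfCoef_add (α lam : 𝕜) (X Y : Amb 𝕜) :
    sfCoef α lam (X + Y) = sfCoef α lam X + sfCoef α lam Y := by
  funext i
  fin_cases i <;> simp only [sfCoef, Fin.zero_eta, Fin.mk_one, Fin.reduceFinMk, Fin.isValue,
    Matrix.cons_val, Prod.fst_add, Prod.snd_add, Pi.add_apply, Matrix.add_apply, map_add] <;> ring

theorem sfCoef_smul (α lam c : 𝕜) (X : Amb 𝕜) :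
    sfCoef α lam (c • X) = algebraMap 𝕜 ℂ c • sfCoef α lam X := by
  funext i
  fin_cases i <;> simp [sfCoef] <;> ring

theorem swapCoef_add (α : ℂ) (s t : Fin 18 → ℂ) :
    swapCoef α (s + t) = swapCoef α s + swapCoef α t := by
  funext i
  fin_cases i <;> simp [swapCoef, mul_add]

theorem swapCoef_smul (α c : ℂ) (s : Fin 18 → ℂ) : swapCoef α (c • s) = c • swapCoef α s := by
  funext i
  fin_cases i <;> simp [swapCoef] <;> ring

/-- The coefficients of an even element of `𝔤` for `λ = α`. -/
def evenTr (e : Fin 9 → 𝕜) : Fin 9 → ℂ :=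
  let m := fun i => algebraMap 𝕜 ℂ (e i)
  ![-2 * Complex.I * m 0, -2 * Complex.I * m 1, -m 2 / 2, -m 3 / 2, m 5, m 6, m 4,
    -(Complex.I / 2) * m 7, -(Complex.I / 2) * m 8]

/-- The coefficients of an odd element of `𝔤` for `λ = α`. -/
def oddTr (e : Fin 8 → 𝕜) : Fin 8 → ℂ :=
  let m := fun i => algebraMap 𝕜 ℂ (e i)
  ![-2 * Complex.I * m 0, -2 * Complex.I * m 1, m 4 - m 2 / 2, -m 4 - m 2 / 2, m 5 - m 3 / 2,
    -m 5 - m 3 / 2, -(Complex.I / 2) * m 6, -(Complex.I / 2) * m 7]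

/-- The coefficients of an even element of `𝔤` for `λ = 1`. -/
def evenTrSwap (a : ℂ) (e : Fin 9 → 𝕜) : Fin 9 → ℂ :=
  let m := fun i => algebraMap 𝕜 ℂ (e i)
  ![-2 * Complex.I * m 1, -2 * Complex.I * m 0, -m 3 / 2, -m 2 / 2, a * m 5, a⁻¹ * m 6, m 4,
    -(Complex.I / 2) * m 8, -(Complex.I / 2) * m 7]

/-- The coefficients of an odd element of `𝔤` for `λ = 1`. -/
def oddTrSwap (a : ℂ) (e : Fin 8 → 𝕜) : Fin 8 → ℂ :=
  let m := fun i => algebraMap 𝕜 ℂ (e i)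
  ![a * (-2 * Complex.I * m 0), -2 * Complex.I * m 1, a * (-m 4 - m 2 / 2), a * (m 4 - m 2 / 2),
    -m 5 - m 3 / 2, m 5 - m 3 / 2, a * (-(Complex.I / 2) * m 6), -(Complex.I / 2) * m 7]

-- What remains is that `evenTr` and `oddTr` carry the structure constants of 𝔤 to those of the
-- operators. The factors -2i of D_α⁻ and -i/2 of D_α⁺ multiply to -1, whence `Complex.I_sq`.
set_option maxHeartbeats 1000000 in
theorem pmOp_sfCoef_bracket {α : 𝕜} (hα : α ≠ 0) {p q : ZMod 2} {X Y : Amb 𝕜} (hX : X ∈ gAlg α)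
    (hY : Y ∈ gAlg α) (hp : AmbHom p X) (hq : AmbHom q Y) :
    bracket α (sgn p q) X Y ∈ gAlg α ∧
      ∀ w, pmOp (algebraMap 𝕜 ℂ α) (sfCoef α α (bracket α (sgn p q) X Y)) w =
        pmOp (algebraMap 𝕜 ℂ α) (sfCoef α α X) (pmOp (algebraMap 𝕜 ℂ α) (sfCoef α α Y) w) -
        sgn p q • pmOp (algebraMap 𝕜 ℂ α) (sfCoef α α Y)
          (pmOp (algebraMap 𝕜 ℂ α) (sfCoef α α X) w) := by
  have ha : algebraMap 𝕜 ℂ α ≠ 0 := by simpa using hα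
  refine pmOp_bracket (ε := evenTr) (o := oddTr) (fun X => ?_) (fun e => ?_) (fun e => ?_)
    (fun e f => ?_) (fun e f => ?_) (fun e f => ?_) hX hY hp hq
  · simpa using sfCoef_smul α α (-1) X
  · funext i
    fin_cases i <;> simp [sfCoef, evenAmb, derMat, evenCoef, evenTr]
    field_simp
    ring
  · funext i
    fin_cases i <;> simp only [sfCoef, oddAmb, derMat, oddCoef, oddTr, Fin.zero_eta, Fin.mk_one,
      Fin.reduceFinMk, Fin.isValue, Matrix.cons_val, Matrix.cons_val', Matrix.of_apply, map_zero,
      map_neg, mul_zero, zero_mul, zero_div, neg_zero, add_zero]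
  all_goals
    funext i
    fin_cases i <;> simp only [ambEvenEven, ambEvenOdd, ambOddOdd, evenBracket, mixedBracket,
      oddBracket, evenTr, oddTr, Fin.zero_eta, Fin.mk_one, Fin.reduceFinMk, Fin.isValue,
      Matrix.cons_val, map_add, map_sub, map_mul, map_div₀, map_neg, map_ofNat, map_one,
      map_zero] <;> ring_nf <;> (try simp only [Complex.I_sq]) <;> (try ring1)

-- The same comparison through the isomorphism D_α ≅ D_{α⁻¹} that exchanges e₁ and e₂ and rescales
-- ξ.
set_option maxHeartbeats 1000000 in
theorem pmOp_swapCoef_bracket {α : 𝕜} (hα : α ≠ 0) {p q : ZMod 2} {X Y : Amb 𝕜} (hX : X ∈ gAlg α)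
    (hY : Y ∈ gAlg α) (hp : AmbHom p X) (hq : AmbHom q Y) (κ : Amb 𝕜 → Fin 18 → ℂ)
    (hκ : ∀ Z, κ Z = swapCoef (algebraMap 𝕜 ℂ α) (sfCoef α 1 Z)) :
    bracket α (sgn p q) X Y ∈ gAlg α ∧
      ∀ w, pmOp (algebraMap 𝕜 ℂ α)⁻¹ (κ (bracket α (sgn p q) X Y)) w =
        pmOp (algebraMap 𝕜 ℂ α)⁻¹ (κ X) (pmOp (algebraMap 𝕜 ℂ α)⁻¹ (κ Y) w) -
        sgn p q • pmOp (algebraMap 𝕜 ℂ α)⁻¹ (κ Y) (pmOp (algebraMap 𝕜 ℂ α)⁻¹ (κ X) w) := by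
  have ha : algebraMap 𝕜 ℂ α ≠ 0 := by simpa using hα
  refine pmOp_bracket (ε := evenTrSwap (algebraMap 𝕜 ℂ α)) (o := oddTrSwap (algebraMap 𝕜 ℂ α))
    (fun X => ?_) (fun e => ?_) (fun e => ?_)
    (fun e f => ?_) (fun e f => ?_) (fun e f => ?_) hX hY hp hq
  · have := sfCoef_smul α 1 (-1) X
    rw [neg_one_smul] at this
    rw [hκ, hκ, this, swapCoef_smul]
    simp
  · rw [hκ]
    funext i
    fin_cases i <;> simp [sfCoef, swapCoef, evenAmb, derMat, evenCoef, evenTrSwap]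
    field_simp
  · rw [hκ]
    funext i
    fin_cases i <;> simp only [sfCoef, swapCoef, oddAmb, derMat, oddCoef, oddTrSwap, Fin.zero_eta,
      Fin.mk_one, Fin.reduceFinMk, Fin.isValue, Matrix.cons_val, Matrix.cons_val', Matrix.of_apply,
      map_zero, map_neg, mul_zero, zero_mul, zero_div, neg_zero, add_zero]
  all_goals
    funext i
    fin_cases i <;> simp only [ambEvenEven, ambEvenOdd, ambOddOdd, evenBracket, mixedBracket,
      oddBracket, evenTrSwap, oddTrSwap, Fin.zero_eta, Fin.mk_one, Fin.reduceFinMk, Fin.isValue,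
      Matrix.cons_val, map_add, map_sub, map_mul, map_div₀, map_neg, map_ofNat, map_one,
      map_zero] <;> field_simp <;> ring_nf <;> (try simp only [Complex.I_sq]) <;> (try ring1)

end

noncomputable section

open Polynomial

/-! ### Superfunctions modulo `𝓘_λ` in one variable -/

/-- Evaluation of a smooth function at a point. -/
def evalAt (z : ℝ × ℝ) : Smooth2 →ₐ[ℂ] ℂ :=
  (Pi.evalAlgHom ℂ (fun _ : ℝ × ℝ => ℂ) z).comp smoothAlg.val

/-- `exp(t z)` is `1 + t z + z² h(z)` with `h` smooth. -/
theorem exp_taylor (t : ℝ) : ∃ h : ℝ → ℂ, ContDiff ℝ ∞ h ∧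
    ∀ z : ℝ, Complex.exp ((t * z : ℝ) : ℂ) = 1 + t * z + z ^ 2 * h z := by
  set f : ℂ → ℂ := fun z => Complex.exp (t * z) with hf
  have hd : Differentiable ℂ f := by fun_prop
  -- The remainder h is the second divided difference of an entire function at 0. Divided
  -- differences of entire functions are entire, hence smooth on the real line.
  have ds (f : ℂ → ℂ) (hf : Differentiable ℂ f) : Differentiable ℂ (dslope f 0) := by
    rw [← differentiableOn_univ] at hf ⊢
    exact (Complex.differentiableOn_dslope Filter.univ_mem).2 hf
  have h1 := ds f hd
  have h2 := ds _ h1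
  refine ⟨fun z => dslope (dslope f 0) 0 z, ?_, fun z => ?_⟩
  · have : ContDiff ℂ ∞ (dslope (dslope f 0) 0) := h2.contDiff
    exact (this.restrict_scalars ℝ).comp Complex.ofRealCLM.contDiff
  · have e1 := sub_smul_dslope f 0 (z : ℂ)
    have e2 := sub_smul_dslope (dslope f 0) 0 (z : ℂ)
    have e3 : deriv f 0 = t := by
      have : HasDerivAt f (Complex.exp (t * 0) * (t * 1)) 0 :=
        ((hasDerivAt_id (0 : ℂ)).const_mul (t : ℂ)).cexp
      simpa using this.deriv
    rw [dslope_same, e3] at e2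
    simp only [sub_zero, smul_eq_mul] at e1 e2
    have e4 : f 0 = 1 := by simp [hf]
    have e5 : f z = Complex.exp ((t * z : ℝ) : ℂ) := by simp [hf]
    rw [← e5]
    rw [e4] at e1
    linear_combination -e1 - z * e2

variable {𝕜 : Type*} [Field 𝕜] [Algebra 𝕜 ℂ]

/-- Coordinates `x = xᵢ` and `y = xⱼ` adapted to the ideal `𝓘_λ`, which is described by
`x₃ x₄ = -2 δ x y`, `y² = y x₃ = y x₄ = 0`. -/
structure Chart (α lam : 𝕜) where
  /-- the main coordinate -/
  x : Smooth2
  /-- the other even coordinate -/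
  y : Smooth2
  /-- the direction of `x` -/
  dx : ℝ × ℝ
  /-- the direction of `y` -/
  dy : ℝ × ℝ
  /-- the structure constant of the ideal -/
  δ : ℂ
  /-- the points with `y = 0` -/
  pt : ℝ → ℝ × ℝ
  δ_ne_zero : δ ≠ 0
  x_eq : x = mainVar α lam
  x_pt : ∀ r, evalAt (pt r) x = r
  y_pt : ∀ r, evalAt (pt r) y = 0
  dx_x : pd dx x = 1
  dx_y : pd dx y = 0
  dy_x : pd dy x = 0
  dy_y : pd dy y = 1
  dx_exp : pd dx (mainExp α lam (-2) 0) = -2 * mainExp α lam (-2) 0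
  dy_exp : pd dy (mainExp α lam (-2) 0) = 0
  exp_pt : ∀ z, evalAt z (mainExp α lam (-2) 0) ≠ 0
  exp_mul : ∀ t : ℝ, ∃ h, mainExp α lam (-2) t =
    mainExp α lam (-2) 0 * (1 + algebraMap ℂ Smooth2 t * y + y ^ 2 * h)
  exp_eq : mainExp α lam (-2) (-2) = expFun (-2) (-2)
  adjoin_eq : Algebra.adjoin ℂ {cx1, cx2} = Algebra.adjoin ℂ {x, y}
  mem_ideal : ∀ F : SF, F ∈ ideal α lam ↔ ∃ c p q : Smooth2,
    F 0 = 2 * algebraMap ℂ Smooth2 δ * x * y * F 3 + y ^ 2 * c ∧ F 1 = y * p ∧ F 2 = y * q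

namespace Chart

variable {α lam : 𝕜} (S : Chart α lam)

/-- `p ↦ p(x) exp(-2 x)`. -/
def emb : ℂ[X] →ₗ[ℂ] Smooth2 where
  toFun p := aeval S.x p * mainExp α lam (-2) 0
  map_add' p q := by rw [map_add, add_mul]
  map_smul' c p := by simp

theorem emb_apply (p : ℂ[X]) : S.emb p = aeval S.x p * mainExp α lam (-2) 0 := rfl

theorem emb_X_mul (p : ℂ[X]) : S.emb (X * p) = S.x * S.emb p := by
  simp [emb_apply, mul_assoc]

theorem emb_C_mul (c : ℂ) (p : ℂ[X]) : S.emb (C c * p) = algebraMap ℂ Smooth2 c * S.emb p := by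
  simp [emb_apply, mul_assoc]

theorem emb_two_mul (p : ℂ[X]) : S.emb (2 * p) = 2 * S.emb p := by
  rw [show (2 : ℂ[X]) = C 2 from rfl, emb_C_mul, amap_two]

theorem pd_dx_emb (p : ℂ[X]) : pd S.dx (S.emb p) = S.emb (tD p) := by
  rw [tD_apply, map_sub, emb_C_mul, emb_apply, Derivation.leibniz, Derivation.map_aeval, S.dx_x,
    S.dx_exp, emb_apply, amap_two]
  simp only [smul_eq_mul]
  ring

theorem pd_dy_emb (p : ℂ[X]) : pd S.dy (S.emb p) = 0 := by
  rw [emb_apply, Derivation.leibniz, Derivation.map_aeval, S.dy_x, S.dy_exp]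
  simp

/-- The exponential never vanishes, and a polynomial with all real numbers as roots is zero. -/
theorem emb_injective_at {p : ℂ[X]} (h : ∀ r, evalAt (S.pt r) (S.emb p) = 0) : p = 0 := by
  have h1 (r : ℝ) : p.eval (r : ℂ) = 0 := by
    have := h r
    rw [emb_apply, map_mul, ← aeval_algHom_apply, S.x_pt] at this
    simpa [S.exp_pt] using this
  refine Polynomial.eq_zero_of_infinite_isRoot p (Set.Infinite.mono ?_
    (Set.infinite_range_of_injective Complex.ofReal_injective))
  rintro _ ⟨r, rfl⟩
  exact h1 r

/-- The superfunction represented by a quadruple of polynomials. -/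
def lift : PM →ₗ[ℂ] SF where
  toFun p := ![S.emb (p 0) + S.y * S.emb (p 1), algebraMap ℂ Smooth2 S.δ⁻¹ * S.emb (p 2),
    S.emb (p 3), 0]
  map_add' p q := by ext i : 1; fin_cases i <;> simp <;> ring
  map_smul' c p := by ext i : 1; fin_cases i <;> simp [csmul] <;> ring

theorem lift_apply (p : PM) : S.lift p = ![S.emb (p 0) + S.y * S.emb (p 1),
    algebraMap ℂ Smooth2 S.δ⁻¹ * S.emb (p 2), S.emb (p 3), 0] := rfl

/-- The class modulo `𝓘_λ` represented by a quadruple of polynomials. -/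
def toQF : PM →ₗ[ℂ] QF α lam := (cls α lam).comp S.lift

theorem cls_eq_iff (F G : SF) : cls α lam F = cls α lam G ↔ F - G ∈ ideal α lam :=
  Submodule.Quotient.eq _

theorem algebraMap_inv_mul : algebraMap ℂ Smooth2 S.δ * algebraMap ℂ Smooth2 S.δ⁻¹ = 1 := by
  rw [← map_mul, mul_inv_cancel₀ S.δ_ne_zero, map_one]

/-- A representative has no x₃x₄ term, so membership in the ideal says that its even part is
divisible by y² and its odd coefficients by y. Restriction to y = 0 recovers the polynomials. -/
theorem toQF_injective : Function.Injective S.toQF := by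
  rw [← LinearMap.ker_eq_bot, LinearMap.ker_eq_bot']
  intro p hp
  have h : S.lift p ∈ ideal α lam := (Submodule.Quotient.mk_eq_zero _).1 hp
  obtain ⟨c, q, r, h0, h1, h2⟩ := (S.mem_ideal _).1 h
  simp only [lift_apply, Matrix.cons_val, mul_zero, zero_add] at h0 h1 h2
  have h1' : S.emb (p 2) = S.y * (algebraMap ℂ Smooth2 S.δ * q) := by
    linear_combination algebraMap ℂ Smooth2 S.δ * h1 - S.emb (p 2) * S.algebraMap_inv_mul
  -- The coefficient of y is read off by differentiating in y before restricting to y = 0.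
  have d0 := congrArg (pd S.dy) h0
  simp only [map_add, Derivation.leibniz, Derivation.leibniz_pow, S.dy_y, pd_dy_emb,
    smul_eq_mul] at d0
  funext i
  fin_cases i
  · refine S.emb_injective_at fun z => ?_
    simpa [S.y_pt] using congrArg (evalAt (S.pt z)) h0
  · refine S.emb_injective_at fun z => ?_
    simpa [S.y_pt] using congrArg (evalAt (S.pt z)) d0
  · refine S.emb_injective_at fun z => ?_
    simpa [S.y_pt] using congrArg (evalAt (S.pt z)) h1'
  · refine S.emb_injective_at fun z => ?_
    simpa [S.y_pt] using congrArg (evalAt (S.pt z)) h2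

/-- The class of a superfunction with known expansions in `y`. -/
theorem cls_eq_toQF (F : SF) (p q : Fin 4 → ℂ[X]) (c : SF)
    (h : ∀ i, F i = S.emb (p i) + S.y * S.emb (q i) + S.y ^ 2 * c i) :
    cls α lam F = S.toQF ![p 0, q 0 - C (2 * S.δ) * (X * p 3), C S.δ * p 1, p 2] := by
  rw [toQF, LinearMap.comp_apply, cls_eq_iff, S.mem_ideal]
  -- Replacing x₃x₄ by -2δxy moves `p 3` into the coefficient of y. The higher terms of the x₃x₄
  -- component already come with y², so they enter only this witness.
  refine ⟨c 0 - 2 * algebraMap ℂ Smooth2 S.δ * S.x * (S.emb (q 3) + S.y * c 3),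
    S.emb (q 1) + S.y * c 1, S.emb (q 2) + S.y * c 2, ?_, ?_, ?_⟩
  · simp only [lift_apply, Pi.sub_apply, h, Matrix.cons_val, map_sub, emb_C_mul, emb_X_mul,
      map_mul (algebraMap ℂ Smooth2), amap_two]
    ring
  · simp only [lift_apply, Pi.sub_apply, h, Matrix.cons_val, map_sub, emb_C_mul, emb_X_mul]
    linear_combination -S.emb (p 1) * S.algebraMap_inv_mul
  · simp only [lift_apply, Pi.sub_apply, h, Matrix.cons_val, map_sub, emb_C_mul, emb_X_mul]
    ring

/-- Taylor expansion in y to second order; the form is preserved by sums and products. -/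
theorem exists_expansion {f : Smooth2} (hf : f ∈ Algebra.adjoin ℂ {cx1, cx2}) :
    ∃ (p q : ℂ[X]) (c : Smooth2), f = aeval S.x p + S.y * aeval S.x q + S.y ^ 2 * c := by
  rw [S.adjoin_eq] at hf
  induction hf using Algebra.adjoin_induction with
  | mem f h =>
    rcases h with rfl | rfl
    · exact ⟨X, 0, 0, by simp⟩
    · exact ⟨0, 1, 0, by simp⟩
  | algebraMap r => exact ⟨C r, 0, 0, by simp⟩
  | add f g _ _ hf hg =>
    obtain ⟨p, q, c, rfl⟩ := hf
    obtain ⟨p', q', c', rfl⟩ := hg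
    exact ⟨p + p', q + q', c + c', by simp only [map_add]; ring⟩
  | mul f g _ _ hf hg =>
    obtain ⟨p, q, c, rfl⟩ := hf
    obtain ⟨p', q', c', rfl⟩ := hg
    exact ⟨p * p', p * q' + q * p', aeval S.x p * c' + c * aeval S.x p'
      + aeval S.x q * aeval S.x q' + S.y * (aeval S.x q * c' + c * aeval S.x q') + S.y ^ 2 * c * c',
      by simp only [map_add, map_mul]; ring⟩

theorem aeval_mem (p q : ℂ[X]) :
    aeval S.x p + S.y * aeval S.x q ∈ Algebra.adjoin ℂ {cx1, cx2} := by
  rw [S.adjoin_eq]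
  have hx : S.x ∈ Algebra.adjoin ℂ {S.x, S.y} := Algebra.subset_adjoin (by simp)
  have hy : S.y ∈ Algebra.adjoin ℂ {S.x, S.y} := Algebra.subset_adjoin (by simp)
  have h (p : ℂ[X]) : aeval S.x p ∈ Algebra.adjoin ℂ {S.x, S.y} :=
    Algebra.adjoin_mono (by simp) (aeval_mem_adjoin_singleton ℂ S.x)
  exact add_mem (h p) (mul_mem hy (h q))

/-- Since exp(-2y) is 1 - 2y modulo y², passing between exp(-2x) and exp(-2(x + y)) only shears the
coefficient of y. -/
theorem range_toQF : LinearMap.range S.toQF = W α lam := by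
  obtain ⟨g, hg⟩ := S.exp_mul (-2)
  rw [S.exp_eq] at hg
  have hm : algebraMap ℂ Smooth2 ((-2 : ℝ) : ℂ) = -2 := by
    rw [Complex.ofReal_neg, map_neg, Complex.ofReal_ofNat, amap_two]
  rw [hm] at hg
  have hmul (F : SF) (i : Fin 4) :
      sfMul (ofFun (expFun (-2) (-2))) F i = expFun (-2) (-2) * F i := by
    fin_cases i <;> simp [sfMul, ofFun]
  apply le_antisymm
  · rintro _ ⟨p, rfl⟩
    -- The summand 2 `p 0` compensates the term -2y of the exponential.
    let F : SF := ![aeval S.x (p 0) + S.y * aeval S.x (p 1 + 2 * p 0),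
      aeval S.x (C S.δ⁻¹ * p 2) + S.y * aeval S.x (0 : ℂ[X]),
      aeval S.x (p 3) + S.y * aeval S.x (0 : ℂ[X]), 0]
    refine ⟨_, ⟨F, ?_, rfl⟩, ?_⟩
    · intro i _
      fin_cases i
      · exact S.aeval_mem _ _
      · exact S.aeval_mem _ _
      · exact S.aeval_mem _ _
      · exact Subalgebra.zero_mem _
    · rw [S.cls_eq_toQF _ ![p 0, C S.δ⁻¹ * p 2, p 3, 0] ![p 1, -2 * (C S.δ⁻¹ * p 2), -2 * p 3, 0]
        ![mainExp α lam (-2) 0 * (g * aeval S.x (p 0) + (g * S.y - 2) * aeval S.x (p 1 + 2 * p 0)),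
          mainExp α lam (-2) 0 * g * aeval S.x (C S.δ⁻¹ * p 2),
          mainExp α lam (-2) 0 * g * aeval S.x (p 3), 0]]
      · congr 1
        funext i
        fin_cases i <;> simp
        rw [← mul_assoc, ← C_mul, mul_inv_cancel₀ S.δ_ne_zero, C_1, one_mul]
      · intro i
        rw [hmul, hg]
        fin_cases i <;> simp [F, emb_apply, map_ofNat] <;> ring
  · rintro _ ⟨_, ⟨F, hF, rfl⟩, rfl⟩
    choose p q c h using fun i => S.exists_expansion (hF i (Set.mem_univ i))
    -- Multiplying p + yq by 1 - 2y + y²g gives p + y(q - 2p) modulo y².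
    refine ⟨_, (S.cls_eq_toQF _ p (fun i => q i - 2 * p i) (fun i => mainExp α lam (-2) 0 *
      (c i + g * aeval S.x (p i) + (S.y * g - 2) * aeval S.x (q i)
        + (S.y * S.y * g - 2 * S.y) * c i)) ?_).symm⟩
    intro i
    rw [hmul, hg, h]
    simp only [emb_apply, map_sub, map_mul, map_ofNat]
    ring

/-- The values t = -2 and t = 2 produce the even vectors `mA` and `mB`, which differ only in the
sign of the y coefficient. -/
theorem cls_ofFun (p : ℂ[X]) (t : ℝ) :
    cls α lam (ofFun (aeval S.x p * mainExp α lam (-2) t)) =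
      S.toQF ![p, C (t : ℂ) * p, 0, 0] := by
  obtain ⟨g, hg⟩ := S.exp_mul t
  rw [S.cls_eq_toQF _ ![p, 0, 0, 0] ![C (t : ℂ) * p, 0, 0, 0]
    ![g * aeval S.x p * mainExp α lam (-2) 0, 0, 0, 0]]
  · congr 1
    funext i
    fin_cases i <;> simp
  · intro i
    rw [hg]
    fin_cases i <;> simp [ofFun, emb_apply]
    ring

/-- The factor δ appears because the third slot of the model is the coefficient of x₃/δ, a
normalization that makes the product with x₄ equal to -2xy in both cases. -/
theorem cls_mulX_two (p : ℂ[X]) :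
    cls α lam (mulX 2 (ofFun (aeval S.x p * mainExp α lam (-2) 0))) =
      S.toQF ![0, 0, C S.δ * p, 0] := by
  rw [S.cls_eq_toQF _ ![0, p, 0, 0] 0 0]
  · congr 1
    funext i
    fin_cases i <;> simp
  · intro i
    fin_cases i <;> simp [ofFun, emb_apply, mulX_two]

theorem cls_mulX_three (p : ℂ[X]) :
    cls α lam (mulX 3 (ofFun (aeval S.x p * mainExp α lam (-2) 0))) =
      S.toQF ![0, 0, 0, p] := by
  rw [S.cls_eq_toQF _ ![0, 0, p, 0] 0 0]
  · congr 1
    funext i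
    fin_cases i <;> simp
  · intro i
    fin_cases i <;> simp [ofFun, emb_apply, mulX_three]

end Chart

end

noncomputable section

open Polynomial

/-! ### The two adapted coordinate systems -/

theorem pd_expFun (v : ℝ × ℝ) (a b : ℝ) :
    pd v (expFun a b) = algebraMap ℂ Smooth2 ((a * v.1 + b * v.2 : ℝ) : ℂ) * expFun a b := by
  refine Subtype.ext (funext fun p => ?_)
  have h : HasFDerivAt (fun p : ℝ × ℝ => a * p.1 + b * p.2)
      (a • ContinuousLinearMap.fst ℝ ℝ ℝ + b • ContinuousLinearMap.snd ℝ ℝ ℝ) p :=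
    (hasFDerivAt_fst.const_mul a).add (hasFDerivAt_snd.const_mul b)
  have h1 := (Complex.ofRealCLM.hasFDerivAt.comp p h).cexp
  refine (congrArg (fun L => L v) h1.fderiv).trans ?_
  change Complex.exp ((a * p.1 + b * p.2 : ℝ) : ℂ) * ((a * v.1 + b * v.2 : ℝ) : ℂ) =
    ((a * v.1 + b * v.2 : ℝ) : ℂ) * Complex.exp ((a * p.1 + b * p.2 : ℝ) : ℂ)
  ring

theorem evalAt_expFun_ne_zero (z : ℝ × ℝ) (a b : ℝ) : evalAt z (expFun a b) ≠ 0 :=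
  Complex.exp_ne_zero _

theorem expFun_mul_left (a t : ℝ) : ∃ h, expFun a t =
    expFun a 0 * (1 + algebraMap ℂ Smooth2 t * cx2 + cx2 ^ 2 * h) := by
  obtain ⟨h, hc, hh⟩ := exp_taylor t
  refine ⟨⟨fun p => h p.2, show ContDiff ℝ ∞ _ from hc.comp contDiff_snd⟩,
    Subtype.ext (funext fun p => ?_)⟩
  change Complex.exp ((a * p.1 + t * p.2 : ℝ) : ℂ) =
    Complex.exp ((a * p.1 + 0 * p.2 : ℝ) : ℂ) * (1 + t * p.2 + p.2 ^ 2 * h p.2)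
  rw [← hh, ← Complex.exp_add]
  push_cast
  ring_nf

theorem expFun_mul_right (a t : ℝ) : ∃ h, expFun t a =
    expFun 0 a * (1 + algebraMap ℂ Smooth2 t * cx1 + cx1 ^ 2 * h) := by
  obtain ⟨h, hc, hh⟩ := exp_taylor t
  refine ⟨⟨fun p => h p.1, show ContDiff ℝ ∞ _ from hc.comp contDiff_fst⟩,
    Subtype.ext (funext fun p => ?_)⟩
  change Complex.exp ((t * p.1 + a * p.2 : ℝ) : ℂ) =
    Complex.exp ((0 * p.1 + a * p.2 : ℝ) : ℂ) * (1 + t * p.1 + p.1 ^ 2 * h p.1)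
  rw [← hh, ← Complex.exp_add]
  push_cast
  ring_nf

variable {𝕜 : Type*} [Field 𝕜] [Algebra 𝕜 ℂ]

/-- The coordinates for `λ = α`. -/
def chartAlpha (α : 𝕜) : Chart α α where
  x := cx1
  y := cx2
  dx := (1, 0)
  dy := (0, 1)
  δ := 1
  pt r := (r, 0)
  δ_ne_zero := one_ne_zero
  x_eq := by simp [mainVar]
  x_pt r := rfl
  y_pt r := Complex.ofReal_zero
  dx_x := by simp [pd_cx1]
  dx_y := by simp [pd_cx2]
  dy_x := by simp [pd_cx1]
  dy_y := by simp [pd_cx2]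
  dx_exp := by simp [mainExp, pd_expFun, amap_two]
  dy_exp := by simp [mainExp, pd_expFun]
  exp_pt z := by simpa [mainExp] using evalAt_expFun_ne_zero z _ _
  exp_mul t := by simpa [mainExp] using expFun_mul_left _ t
  exp_eq := by simp [mainExp]
  adjoin_eq := rfl
  mem_ideal F := by
    rw [mem_ideal_alpha]
    simp

/-- The coordinates for `λ = 1`. -/
def chartOne (α : 𝕜) (hα : α ≠ 0) (h1 : (1 : 𝕜) ≠ α) : Chart α 1 where
  x := cx2
  y := cx1
  dx := (0, 1)
  dy := (1, 0)
  δ := algebraMap 𝕜 ℂ α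
  pt r := (0, r)
  δ_ne_zero := by simpa using hα
  x_eq := by simp [mainVar, h1]
  x_pt r := rfl
  y_pt r := Complex.ofReal_zero
  dx_x := by simp [pd_cx2]
  dx_y := by simp [pd_cx1]
  dy_x := by simp [pd_cx2]
  dy_y := by simp [pd_cx1]
  dx_exp := by simp [mainExp, h1, pd_expFun, amap_two]
  dy_exp := by simp [mainExp, h1, pd_expFun]
  exp_pt z := by simpa [mainExp, h1] using evalAt_expFun_ne_zero z _ _
  exp_mul t := by simpa [mainExp, h1] using expFun_mul_right _ t
  exp_eq := by simp [mainExp, h1]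
  adjoin_eq := by rw [Set.pair_comm]
  mem_ideal F := by
    rw [mem_ideal_one α h1]
    refine exists_congr fun c => exists_congr fun p => exists_congr fun q => ?_
    rw [mul_right_comm _ cx2 cx1]

/-! ### The action of `𝔤` in the polynomial model -/

/-- The elementary operators on superfunctions. -/
def sfElem (a l : ℂ) : Fin 18 → Module.End ℂ SF :=
  ![mulX 0, mulX 1, mulX 2, mulX 3,
    (2 : ℂ) • (mulX 0 * del 0) + mulX 2 * del 2 + mulX 3 * del 3,
    (2 : ℂ) • (mulX 1 * del 1) + mulX 2 * del 2 + mulX 3 * del 3,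
    mulX 2 * del 0 + (2 * a) • (mulX 1 * del 3),
    mulX 2 * del 1 + (2 : ℂ) • (mulX 0 * del 3),
    mulX 3 * del 0 - (2 * a) • (mulX 1 * del 2),
    mulX 3 * del 1 - (2 : ℂ) • (mulX 0 * del 2),
    mulX 2 * del 3,
    mulX 3 * del 2,
    mulX 2 * del 2 - mulX 3 * del 3,
    bessel a l 0, bessel a l 1, bessel a l 2, bessel a l 3, 1]

/-- Membership in 𝔤 is essential: only the relations among the entries of a derivation combine the
sixteen fields xⱼ∂ᵢ into the nine that preserve the ideal. -/
theorem piOp_eq (α lam : 𝕜) (X : Amb 𝕜) (hX : X ∈ gAlg α) :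
    piOp α lam X = ∑ i, sfCoef α lam X i •
      sfElem (algebraMap 𝕜 ℂ α) (algebraMap 𝕜 ℂ lam) i := by
  obtain ⟨u, a, M, x⟩ := X
  have hM := eq_derMat α M hX
  generalize M 2 0 = m20, M 3 0 = m30, M 2 2 = m22, M 2 3 = m23, M 3 2 = m32 at hM
  subst hM
  simp only [piOp, Fin.sum_univ_four]
  simp only [jL_eq, derMat, sfCoef, sfElem, Fin.sum_univ_succ,
    Fin.sum_univ_zero, Fin.reduceSucc, Fin.succ_zero_eq_one, Fin.succ_one_eq_two, Fin.isValue,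
    Matrix.sub_apply, Matrix.of_apply, Matrix.cons_val', Matrix.cons_val, Matrix.cons_val_zero,
    Matrix.cons_val_succ, map_sub, map_neg, map_add, map_mul, map_div₀, map_zero, map_ofNat]
  module

-- The formulas of `pmOp` are correct on each elementary operator, up to an element of the ideal.
set_option maxHeartbeats 2000000 in
theorem chartAlpha_sfElem (α : 𝕜) (hα : α ≠ 0) (p : PM) (i : Fin 18) :
    sfElem (algebraMap 𝕜 ℂ α) (algebraMap 𝕜 ℂ α) i ((chartAlpha α).lift p) -
      (chartAlpha α).lift (pmOp (algebraMap 𝕜 ℂ α) (Pi.single i 1) p) ∈ ideal α α := by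
  have ha : algebraMap 𝕜 ℂ α ≠ 0 := by simpa using hα
  set S := (chartAlpha α) with hS
  have hx : S.x = cx1 := rfl
  have hy : S.y = cx2 := rfl
  have hδ : S.δ = 1 := rfl
  have px (f) : pd (1, 0) (S.emb f) = S.emb (tD f) := S.pd_dx_emb f
  have py (f) : pd (0, 1) (S.emb f) = 0 := S.pd_dy_emb f
  clear_value S
  rw [S.mem_ideal]
  -- The witnesses collect the terms discarded through y² = y x₃ = y x₄ = 0. The x₃x₄ terms are
  -- absorbed by the summand 2δxy `F 3` of the membership criterion.
  refine ⟨![0, S.emb (p 1), 0, 0, 0, 0, 0, 0, 0, 0, 0, 0, 0, 0, 0, 0, 0, 0] i,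
    ![0, S.emb (p 2), S.emb (p 1), 0, 0, 0, S.emb (tD (p 1)), 0, 0, 0, 0, 0, 0, 0, 0, 0, 0, 0] i,
    ![0, S.emb (p 3), 0, S.emb (p 1), 0, 0, 0, 0, S.emb (tD (p 1)), 0, 0, 0, 0, 0, 0, 0, 0, 0] i,
    ?_, ?_, ?_⟩ <;>
  fin_cases i <;>
  simp only [Fin.reduceFinMk, Fin.isValue, Fin.zero_eta, Fin.mk_one, Matrix.cons_val,
    LinearMap.add_apply, LinearMap.sub_apply,
    LinearMap.smul_apply, LinearMap.neg_apply, Module.End.mul_apply, Module.End.one_apply,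
    Pi.add_apply, Pi.sub_apply,
    Pi.neg_apply, Pi.smul_apply, Pi.zero_apply, map_add, map_sub, map_neg, map_zero, map_one,
    map_mul, map_ofNat, map_smul, smul_eq_mul,
    Derivation.leibniz, Derivation.map_algebraMap, Fin.reduceEq, if_true, if_false, mul_zero,
    zero_mul, mul_one, one_mul, add_zero,
    zero_add, sub_zero, zero_sub, neg_zero, neg_neg, neg_mul, mul_neg, sub_self, C_0, C_1, inv_one,
    inv_zero, Pi.single_apply, C_neg,
    Complex.ofReal_zero, Complex.ofReal_one, div_self ha, one_div, sfElem, bessel, S.lift_apply,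
    pmOp_apply_zero, pmOp_apply_one, pmOp_apply_two,
    pmOp_apply_three, Pi.single_apply, swapCoef, mulX_zero, mulX_one, mulX_two, mulX_three,
    del_zero, del_one,
    del_two, del_three, csmul, amap_two, pd_cx1, pd_cx2, S.emb_X_mul, S.emb_C_mul, S.emb_two_mul,
    px, py, hx, hy, hδ] <;> ring

-- Here `swapCoef` accounts for the exchange of x₁ and x₂ and for the rescaled x₃.
set_option maxHeartbeats 2000000 in
theorem chartOne_sfElem (α : 𝕜) (hα : α ≠ 0) (h1 : (1 : 𝕜) ≠ α) (p : PM) (i : Fin 18) :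
    sfElem (algebraMap 𝕜 ℂ α) (algebraMap 𝕜 ℂ 1) i ((chartOne α hα h1).lift p) -
      (chartOne α hα h1).lift (pmOp (algebraMap 𝕜 ℂ α)⁻¹ (swapCoef (algebraMap 𝕜 ℂ α) (Pi.single i 1)) p) ∈ ideal α 1 := by
  have ha : algebraMap 𝕜 ℂ α ≠ 0 := by simpa using hα
  set S := (chartOne α hα h1) with hS
  have hx : S.x = cx2 := rfl
  have hy : S.y = cx1 := rfl
  have hδ : S.δ = algebraMap 𝕜 ℂ α := rfl
  have px (f) : pd (0, 1) (S.emb f) = S.emb (tD f) := S.pd_dx_emb f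
  have py (f) : pd (1, 0) (S.emb f) = 0 := S.pd_dy_emb f
  have hb0 (v) : pd v (algebraMap ℂ Smooth2 (algebraMap 𝕜 ℂ α)⁻¹) = 0 :=
    Derivation.map_algebraMap ..
  generalize hb : algebraMap ℂ Smooth2 (algebraMap 𝕜 ℂ α) = b
  generalize hb' : algebraMap ℂ Smooth2 (algebraMap 𝕜 ℂ α)⁻¹ = b' at hb0
  have hbb : b * b' = 1 := by
    rw [← hb, ← hb', ← map_mul, mul_inv_cancel₀ ha, map_one]
  clear_value S
  rw [S.mem_ideal]
  refine ⟨![S.emb (p 1), 0, 0, 0, 0, 0, 0, 0, 0, 0, 0, 0, 0, 0, 0, 0, 0, 0] i,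
    ![b' * S.emb (p 2), 0, S.emb (p 1), 0, 0, 0, 0, S.emb (tD (p 1)), 0, 0, 0, 0, 0, 0, 0, 0, 0,
    0] i,
    ![S.emb (p 3), 0, 0, S.emb (p 1), 0, 0, 0, 0, 0, S.emb (tD (p 1)), 0, 0, 0, 0, 0, 0, 0, 0] i,
    ?_, ?_, ?_⟩ <;>
  fin_cases i <;>
  simp only [Fin.reduceFinMk, Fin.isValue, Fin.zero_eta, Fin.mk_one, Matrix.cons_val,
    LinearMap.add_apply, LinearMap.sub_apply,
    LinearMap.smul_apply, LinearMap.neg_apply, Module.End.mul_apply, Module.End.one_apply,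
    Pi.add_apply, Pi.sub_apply,
    Pi.neg_apply, Pi.smul_apply, Pi.zero_apply, map_add, map_sub, map_neg, map_zero, map_one,
    map_mul, map_ofNat, map_smul, smul_eq_mul,
    Derivation.leibniz, Derivation.map_algebraMap, Fin.reduceEq, if_true, if_false, mul_zero,
    zero_mul, mul_one, one_mul, add_zero,
    zero_add, sub_zero, zero_sub, neg_zero, neg_neg, neg_mul, mul_neg, sub_self, C_0, C_1, inv_one,
    inv_zero, Pi.single_apply, C_neg,
    Complex.ofReal_zero, Complex.ofReal_one, div_self ha, one_div, sfElem, bessel, S.lift_apply,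
    pmOp_apply_zero, pmOp_apply_one, pmOp_apply_two,
    pmOp_apply_three, Pi.single_apply, swapCoef, mulX_zero, mulX_one, mulX_two, mulX_three,
    del_zero, del_one,
    del_two, del_three, csmul, amap_two, pd_cx1, pd_cx2, S.emb_X_mul, S.emb_C_mul, S.emb_two_mul,
    px, py, hx, hy, hδ, hb, hb', hb0] <;> (try ring1)
  -- In the remaining goals a factor α from the operator or the coefficients meets the α⁻¹ of the
  -- rescaled x₃ or of β.
  · linear_combination (2 * cx1 * cx2 * S.emb (p 2)) * hbb
  · linear_combination (-2 * cx1 * S.emb (p 3)) * hbb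
  · linear_combination (-2 * cx2 * S.emb (p 2)) * hbb
  · linear_combination (2 * cx1 * cx2 * S.emb (tD (p 2))) * hbb
  · linear_combination (2 * S.emb (p 3)) * hbb
  · linear_combination (-2 * cx2 * S.emb (tD (p 2))) * hbb
  · linear_combination (-S.emb (p 0)) * hbb
  · linear_combination (-S.emb (p 1)) * hbb
  · linear_combination (-S.emb (tD (p 0))) * hbb
  · linear_combination (-S.emb (p 3)) * hbb
  · linear_combination (-S.emb (tD (p 1))) * hbb

end

noncomputable section

open Polynomial

/-! ### `𝔨`-types in the polynomial model -/

/-- Coefficients of the operators from `𝔨`. -/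
def kCoef : Set (Fin 18 → ℂ) :=
  {t | t 4 = 0 ∧ t 5 = 0 ∧ t 17 = 0 ∧ t 7 = -t 6 ∧ t 9 = -t 8 ∧ t 0 = -4 * t 13 ∧
    t 1 = -4 * t 14 ∧ t 2 = -4 * t 15 ∧ t 3 = -4 * t 16}

/-- Coefficients of the operators from `𝔨₀`. -/
def k0Coef : Set (Fin 18 → ℂ) := {t | t ∈ kCoef ∧ t 0 = 0 ∧ t 1 = 0 ∧ t 2 = 0 ∧ t 3 = 0}

/-- `Ω_{λ,k}` as a polynomial. -/
def omP (β : ℂ) (k : ℕ) : ℂ[X] := (tricomiU k (-β)).comp (C 4 * X)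

/-- `V_{λ,k}` as a polynomial. -/
def vP (β : ℂ) (k : ℕ) : ℂ[X] := (tricomiU k (1 - β)).comp (C 4 * X)

/-- The model of `Ω_{λ,k}(xᵢ) exp(-2(x₁ + x₂))`. -/
def mA (β : ℂ) (k : ℕ) : PM := ![omP β k, -2 * omP β k, 0, 0]

/-- The model of `Ω_{λ,k}(xᵢ) exp(-2(xᵢ - xⱼ))`. -/
def mB (β : ℂ) (k : ℕ) : PM := ![omP β k, 2 * omP β k, 0, 0]

/-- The model of `x₃ V_{λ,k}(xᵢ) exp(-2 xᵢ)`. -/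
def mC (β : ℂ) (k : ℕ) : PM := ![0, 0, vP β k, 0]

/-- The model of `x₄ V_{λ,k}(xᵢ) exp(-2 xᵢ)`. -/
def mD (β : ℂ) (k : ℕ) : PM := ![0, 0, 0, vP β k]

theorem derivative_comp_four (p : ℂ[X]) :
    derivative (p.comp (C 4 * X)) = 4 * (derivative p).comp (C 4 * X) := by
  rw [derivative_comp]
  simp [show (C 4 : ℂ[X]) = 4 from rfl]

/-- This form of the derivative lowers the degree; `tD_omP` expresses it by V of the same degree.
The first serves A, the second B. The 4 is the scale of the argument 4x. -/
theorem tD_omP_succ (β : ℂ) (n : ℕ) :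
    tD (omP β (n + 1)) = C (4 * ((n : ℂ) + 1)) * vP β n - 2 * omP β (n + 1) := by
  rw [tD_apply, omP, derivative_comp_four, ((tricomiU_relations n (-β)).2.2), vP,
    show -β + 1 = 1 - β by ring, show (C 2 : ℂ[X]) = 2 from rfl]
  simp [map_ofNat, show ((n : ℂ[X]) + 1).comp (C 4 * X) = n + 1 by simp]
  ring

theorem tD_omP (β : ℂ) (n : ℕ) : tD (omP β n) = 2 * omP β n - 4 * vP β n := by
  have h := congrArg (fun p => p.comp (C 4 * X)) (tricomiU_relations n (-β)).1
  rw [show -β + 1 = 1 - β by ring] at h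
  simp only [sub_comp] at h
  rw [tD_apply, show (C 2 : ℂ[X]) = 2 from rfl, omP, derivative_comp_four, vP]
  linear_combination -4 * h

/-- The recursion `tricomiU_succ` at b = -β. Together with `X_mul_tD_vP` it expresses the action on
x₃V and x₄V through Ω_{n+1} and Ω_n. -/
theorem X_mul_vP (β : ℂ) (n : ℕ) :
    4 * (X * vP β n) = omP β (n + 1) + C (n - β) * omP β n := by
  have h := congrArg (fun p => p.comp (C 4 * X)) (tricomiU_succ n (-β))
  rw [show -β + 1 = 1 - β by ring] at h
  simp only [sub_comp, mul_comp, X_comp, C_comp] at h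
  rw [omP, omP, vP, h]
  simp only [map_add, map_neg, map_sub, map_ofNat]
  ring

theorem X_mul_tD_vP (β : ℂ) (n : ℕ) :
    2 * (X * tD (vP β n)) = C (n - β) * omP β n - omP β (n + 1) + 2 * (C β * vP β n) := by
  have h := congrArg (fun p => p.comp (C 4 * X)) (tricomiU_relations n (-β)).2.1
  rw [show -β + 1 = 1 - β by ring] at h
  simp only [add_comp, mul_comp, X_comp, C_comp] at h
  have h2 := X_mul_vP β n
  rw [tD_apply, show (C 2 : ℂ[X]) = 2 from rfl, vP, derivative_comp_four]
  rw [omP, omP, vP] at *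
  simp only [map_add, map_neg, map_sub, map_ofNat] at *
  linear_combination 2 * h - h2

theorem omP_zero (β : ℂ) : omP β 0 = 1 := by simp [omP, tricomiU_zero]

theorem degree_comp_four {p : ℂ[X]} {n : ℕ} (hp : p.Monic ∧ p.natDegree = n) :
    (p.comp (C 4 * X)).degree = n := by
  have h4 : (C 4 * X : ℂ[X]).natDegree = 1 := natDegree_C_mul_X _ (by norm_num)
  have h : (p.comp (C 4 * X)) ≠ 0 := by
    intro h
    rcases comp_eq_zero_iff.1 h with h | ⟨_, h⟩
    · exact hp.1.ne_zero h
    · rw [h, natDegree_C] at h4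
      exact zero_ne_one h4
  rw [degree_eq_natDegree h, natDegree_comp, h4, hp.2, mul_one]

theorem degree_omP (β : ℂ) (n : ℕ) : (omP β n).degree = n := degree_comp_four (tricomiU_monic n _)

theorem degree_vP (β : ℂ) (n : ℕ) : (vP β n).degree = n := degree_comp_four (tricomiU_monic n _)

theorem omP_ne_zero (β : ℂ) (n : ℕ) : omP β n ≠ 0 := by
  intro h; simpa [h] using degree_omP β n

theorem vP_ne_zero (β : ℂ) (n : ℕ) : vP β n ≠ 0 := by
  intro h; simpa [h] using degree_vP β n

theorem tD_four_mul (p : ℂ[X]) : tD (4 * p) = 4 * tD p := tD_C_mul 4 p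

theorem tD_natCast_mul (n : ℕ) (p : ℂ[X]) : tD ((n : ℂ[X]) * p) = n * tD p := by
  rw [← C_eq_natCast, tD_C_mul]

/-- The relations in `kCoef` tie each Bessel operator to -4 times the corresponding multiplication,
and exactly this combination keeps the action within the index n. -/
theorem pmOp_mA_succ {β : ℂ} {t : Fin 18 → ℂ} (ht : t ∈ kCoef) (n : ℕ) :
    pmOp β t (mA β (n + 1)) = (t 13 * (2 * β - 4 * (n + 1)) + 2 * t 14) • mA β (n + 1)
      + ((n + 1) * (4 * t 6 - 8 * t 15)) • mC β n + ((n + 1) * (4 * t 8 - 8 * t 16)) • mD β n := by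
  obtain ⟨h4, h5, h17, h7, h9, h0, h1, h2, h3⟩ := ht
  have hk := X_mul_vP β n
  have hk' := X_mul_tD_vP β n
  refine vec_ext_four ?_ ?_ ?_ ?_ <;>
  simp only [pmOp_apply_zero, pmOp_apply_one, pmOp_apply_two, pmOp_apply_three, h0, h1, h2, h3,
    h4, h5, h7, h9, h17, mA, mB, mC, mD, Matrix.cons_val, Pi.add_apply, Pi.sub_apply, Pi.smul_apply,
    smul_eq_C_mul, map_add, map_sub, map_mul, map_neg, map_ofNat, map_one, map_natCast, C_0,
    map_zero, mul_zero, zero_mul, add_zero, zero_add, sub_zero, zero_sub, neg_mul, mul_neg,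
    sub_self,
    neg_zero, add_mul, sub_mul, mul_assoc, neg_neg, one_mul, tD_two_mul, tD_four_mul,
    tD_natCast_mul, tD_C_mul, tD_omP_succ, tD_omP] at *
  -- The second-order term in x is reduced by eliminating X V and X `tD` V.
  · linear_combination C (t 13) * (n + 1) * (2 * hk' - 2 * hk)
  · linear_combination -2 * C (t 13) * (n + 1) * (2 * hk' - 2 * hk)
  · ring
  · ring

theorem pmOp_mB {β : ℂ} {t : Fin 18 → ℂ} (ht : t ∈ kCoef) (n : ℕ) :
    pmOp β t (mB β n) = (t 13 * (2 * β - 4 * n) - 2 * t 14) • mB β n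
      + (-4 * t 6 - 8 * t 15) • mC β n + (-4 * t 8 - 8 * t 16) • mD β n := by
  obtain ⟨h4, h5, h17, h7, h9, h0, h1, h2, h3⟩ := ht
  have hk := X_mul_vP β n
  have hk' := X_mul_tD_vP β n
  refine vec_ext_four ?_ ?_ ?_ ?_ <;>
  simp only [pmOp_apply_zero, pmOp_apply_one, pmOp_apply_two, pmOp_apply_three, h0, h1, h2, h3,
    h4, h5, h7, h9, h17, mA, mB, mC, mD, Matrix.cons_val, Pi.add_apply, Pi.sub_apply, Pi.smul_apply,
    smul_eq_C_mul, map_add, map_sub, map_mul, map_neg, map_ofNat, map_one, map_natCast, C_0,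
    map_zero, mul_zero, zero_mul, add_zero, zero_add, sub_zero, zero_sub, neg_mul, mul_neg,
    sub_self,
    neg_zero, add_mul, sub_mul, mul_assoc, neg_neg, one_mul, tD_two_mul, tD_four_mul,
    tD_natCast_mul, tD_C_mul, tD_omP_succ, tD_omP] at *
  · linear_combination C (t 13) * (-2 * hk' - 2 * hk)
  · linear_combination 2 * C (t 13) * (-2 * hk' - 2 * hk)
  · ring
  · ring

/-- The odd part of 𝔨₀ (`t 8`) yields A + (n - β)B, while the odd elements outside 𝔨₀ (`t 16`) yield
A - (n - β)B. -/
theorem pmOp_mC {β : ℂ} {t : Fin 18 → ℂ} (ht : t ∈ kCoef) (n : ℕ) :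
    pmOp β t (mC β n) = (t 12 - t 13 * (4 * n + 2 - 2 * β)) • mC β n
      + t 16 • (mA β (n + 1) - (n - β) • mB β n)
      + (t 8 * 2⁻¹) • (mA β (n + 1) + (n - β) • mB β n) + t 11 • mD β n := by
  obtain ⟨h4, h5, h17, h7, h9, h0, h1, h2, h3⟩ := ht
  have hk := X_mul_vP β n
  have hk' := X_mul_tD_vP β n
  have hh : C (2⁻¹ : ℂ) * 2 = 1 := by
    rw [show (2 : ℂ[X]) = C 2 from rfl, ← C_mul]; simp
  -- Differentiating the first-order relation supplies the second-order term X `tD`² V.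
  have hd := congrArg tD hk'
  refine vec_ext_four ?_ ?_ ?_ ?_ <;>
  simp only [pmOp_apply_zero, pmOp_apply_one, pmOp_apply_two, pmOp_apply_three, h0, h1, h2, h3,
    h4, h5, h7, h9, h17, mA, mB, mC, mD, Matrix.cons_val, Pi.add_apply, Pi.sub_apply, Pi.smul_apply,
    smul_eq_C_mul, map_add, map_sub, map_mul, map_neg, map_ofNat, map_one, map_natCast, C_0,
    map_zero, mul_zero, zero_mul, add_zero, zero_add, sub_zero, zero_sub, neg_mul, mul_neg,
    sub_self,
    neg_zero, add_mul, sub_mul, mul_assoc, neg_neg, one_mul, tD_two_mul, tD_four_mul,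
    tD_natCast_mul, tD_C_mul, tD_X_mul, tD_omP_succ, tD_omP] at *
  · linear_combination C (t 8) * C 2⁻¹ * hk - 2 * C (t 8) * X * vP β n * hh - C (t 16) * hk'
  · linear_combination -2 * C (t 16) * hk + C (t 8) * hk' + C (t 8) * (omP β (n + 1) - (n - C β) * omP β n) * hh
  · linear_combination C (t 13) * (C 2⁻¹ * hd - hk - ((tD (vP β n) + X * tD (tD (vP β n)) - C β * tD (vP β n)) - ((n - C β) * omP β n - 2 * (n - C β) * vP β n - 2 * (n + 1) * vP β n + omP β (n + 1))) * hh)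

theorem pmOp_mD {β : ℂ} {t : Fin 18 → ℂ} (ht : t ∈ kCoef) (n : ℕ) :
    pmOp β t (mD β n) = (-t 12 - t 13 * (4 * n + 2 - 2 * β)) • mD β n
      - t 15 • (mA β (n + 1) - (n - β) • mB β n)
      - (t 6 * 2⁻¹) • (mA β (n + 1) + (n - β) • mB β n) + t 10 • mC β n := by
  obtain ⟨h4, h5, h17, h7, h9, h0, h1, h2, h3⟩ := ht
  have hk := X_mul_vP β n
  have hk' := X_mul_tD_vP β n
  have hh : C (2⁻¹ : ℂ) * 2 = 1 := by
    rw [show (2 : ℂ[X]) = C 2 from rfl, ← C_mul]; simp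
  have hd := congrArg tD hk'
  refine vec_ext_four ?_ ?_ ?_ ?_ <;>
  simp only [pmOp_apply_zero, pmOp_apply_one, pmOp_apply_two, pmOp_apply_three, h0, h1, h2, h3,
    h4, h5, h7, h9, h17, mA, mB, mC, mD, Matrix.cons_val, Pi.add_apply, Pi.sub_apply, Pi.smul_apply,
    smul_eq_C_mul, map_add, map_sub, map_mul, map_neg, map_ofNat, map_one, map_natCast, C_0,
    map_zero, mul_zero, zero_mul, add_zero, zero_add, sub_zero, zero_sub, neg_mul, mul_neg,
    sub_self,
    neg_zero, add_mul, sub_mul, mul_assoc, neg_neg, one_mul, tD_two_mul, tD_four_mul,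
    tD_natCast_mul, tD_C_mul, tD_X_mul, tD_omP_succ, tD_omP] at *
  · linear_combination (-C (t 6)) * C 2⁻¹ * hk - 2 * (-C (t 6)) * X * vP β n * hh - (-C (t 15)) * hk'
  · linear_combination -2 * (-C (t 15)) * hk + (-C (t 6)) * hk' + (-C (t 6)) * (omP β (n + 1) - (n - C β) * omP β n) * hh
  · linear_combination C (t 13) * (C 2⁻¹ * hd - hk - ((tD (vP β n) + X * tD (tD (vP β n)) - C β * tD (vP β n)) - ((n - C β) * omP β n - 2 * (n - C β) * vP β n - 2 * (n + 1) * vP β n + omP β (n + 1))) * hh)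

theorem pmOp_mA_zero {β : ℂ} {t : Fin 18 → ℂ} (ht : t ∈ kCoef) :
    pmOp β t (mA β 0) = (t 13 * (2 * β) + 2 * t 14) • mA β 0 := by
  obtain ⟨h4, h5, h17, h7, h9, h0, h1, h2, h3⟩ := ht
  have h1' : tD (1 : ℂ[X]) = -2 := by simp [tD_apply, map_ofNat]
  have h2' : tD (2 : ℂ[X]) = -4 := by
    rw [← mul_one (2 : ℂ[X]), tD_two_mul, h1']; norm_num
  have h3' : tD (4 : ℂ[X]) = -8 := by
    rw [← mul_one (4 : ℂ[X]), tD_four_mul, h1']; norm_num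
  refine vec_ext_four ?_ ?_ ?_ ?_ <;>
  simp only [pmOp_apply_zero, pmOp_apply_one, pmOp_apply_two, pmOp_apply_three, h0, h1, h2, h3,
    h4, h5, h7, h9, h17, mA, omP_zero, Matrix.cons_val, Pi.add_apply, Pi.smul_apply,
    smul_eq_C_mul, map_add, map_sub, map_mul, map_neg, map_ofNat, map_one, map_natCast, C_0,
    map_zero, mul_zero, zero_mul, add_zero, zero_add, sub_zero, zero_sub, neg_mul, mul_neg,
    sub_self, neg_zero, tD_two_mul, mul_one, h1', h2', h3'] <;>
  ring

end

noncomputable section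

open Polynomial

/-! ### Irreducibility in the polynomial model -/

/-- `N` is stable under the operators with coefficients in `T`. -/
def ModelStable (β : ℂ) (T : Set (Fin 18 → ℂ)) (N : Submodule ℂ PM) : Prop :=
  ∀ t ∈ T, ∀ p ∈ N, pmOp β t p ∈ N

/-- `N` is irreducible under the operators with coefficients in `T`. -/
def ModelIrred (β : ℂ) (T : Set (Fin 18 → ℂ)) (N : Submodule ℂ PM) : Prop :=
  ModelStable β T N ∧ N ≠ ⊥ ∧ ∀ N' ≤ N, ModelStable β T N' → N' = ⊥ ∨ N' = N

/-- `T` contains a nonzero multiple of `t`. -/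
def HasOp (T : Set (Fin 18 → ℂ)) (t : Fin 18 → ℂ) : Prop := ∃ c : ℂ, c ≠ 0 ∧ c • t ∈ T

theorem ModelStable.mem {β : ℂ} {T : Set (Fin 18 → ℂ)} {N : Submodule ℂ PM}
    (h : ModelStable β T N) {t : Fin 18 → ℂ} (ht : HasOp T t) {p : PM} (hp : p ∈ N) :
    pmOp β t p ∈ N := by
  obtain ⟨c, hc, hct⟩ := ht
  have := h _ hct p hp
  rwa [pmOp_smul, Submodule.smul_mem_iff _ hc] at this

/-- The coefficients of the odd derivation `e₁ ↦ ξ`. -/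
def oddDerCoef : Fin 18 → ℂ := ![0, 0, 0, 0, 0, 0, 1, -1, 0, 0, 0, 0, 0, 0, 0, 0, 0, 0]

/-- The coefficients of an element of `𝔨` outside of `𝔨₀`. -/
def compactCoef : Fin 18 → ℂ := ![0, -4, 0, 0, 0, 0, 0, 0, 0, 0, 0, 0, 0, 0, 1, 0, 0, 0]

/-- The coefficients of a shifted Euler operator. -/
def eulerCoef (β : ℂ) : Fin 18 → ℂ := ![0, 0, 0, 0, 1, 0, 0, 0, 0, 0, 0, 0, 0, 0, 0, 0, 0, -β]

/-- The properties of the coefficients of `𝔨₀` that are used. -/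
structure K0Like (T : Set (Fin 18 → ℂ)) : Prop where
  sub : T ⊆ k0Coef
  oddDer : HasOp T oddDerCoef
  raise : HasOp T (Pi.single 10 1)
  lower : HasOp T (Pi.single 11 1)

/-- The properties of the coefficients of `𝔨` that are used. -/
structure KLike (T : Set (Fin 18 → ℂ)) : Prop where
  sub : T ⊆ kCoef
  oddDer : HasOp T oddDerCoef
  raise : HasOp T (Pi.single 10 1)
  lower : HasOp T (Pi.single 11 1)
  compact : HasOp T compactCoef

/-- The properties of the coefficients of `𝔤` that are used. -/
structure GLike (β : ℂ) (T : Set (Fin 18 → ℂ)) : Prop where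
  mul : ∀ i : Fin 4, HasOp T (Pi.single (Fin.castLE (by norm_num) i) 1)
  bessel_x : HasOp T (Pi.single 13 1)
  bessel_y : HasOp T (Pi.single 14 1)
  euler : HasOp T (eulerCoef β)

theorem oddDerCoef_mem : oddDerCoef ∈ kCoef := by simp [kCoef, oddDerCoef]

theorem compactCoef_mem : compactCoef ∈ kCoef := by simp [kCoef, compactCoef]

theorem raise_mem : Pi.single 10 1 ∈ kCoef := by simp [kCoef, Pi.single_apply]

theorem lower_mem : Pi.single 11 1 ∈ kCoef := by simp [kCoef, Pi.single_apply]

/-- The even vector of the model of `K_{λ,k}`. -/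
def mV (β : ℂ) (n : ℕ) : PM := mA β (n + 1) + (n - β) • mB β n

/-- The generator of the model of `R_{λ,k}`. -/
def mR (β : ℂ) (n : ℕ) : PM := mA β (n + 1) + ((n : ℂ) + 1) • mB β n

/-- The model of `W_{λ,k}` for `k = n + 1`. -/
def mW (β : ℂ) (n : ℕ) : Submodule ℂ PM :=
  Submodule.span ℂ {mA β (n + 1), mB β n, mC β n, mD β n}

/-- The model of `W_{λ,0}`. -/
def mW0 (β : ℂ) : Submodule ℂ PM := Submodule.span ℂ {mA β 0}

/-- The model of `K_{λ,k}` for `k = n + 1`. -/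
def mK (β : ℂ) (n : ℕ) : Submodule ℂ PM := Submodule.span ℂ {mV β n, mC β n, mD β n}

/-- The model of `R_{λ,k}` for `k = n + 1`. -/
def mRk (β : ℂ) (n : ℕ) : Submodule ℂ PM := Submodule.span ℂ {mR β n}

section

variable {β : ℂ} {n : ℕ}

theorem mem_mW {w : PM} : w ∈ mW β n ↔
    ∃ x y c d : ℂ, w = x • mA β (n + 1) + y • mB β n + c • mC β n + d • mD β n := by
  simp only [mW, Submodule.mem_span_insert, Submodule.mem_span_singleton]
  constructor
  · rintro ⟨x, _, ⟨y, _, ⟨c, _, ⟨d, rfl⟩, rfl⟩, rfl⟩, rfl⟩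
    exact ⟨x, y, c, d, by abel⟩
  · rintro ⟨x, y, c, d, rfl⟩
    exact ⟨x, _, ⟨y, _, ⟨c, _, ⟨d, rfl⟩, rfl⟩, rfl⟩, by abel⟩

theorem mem_mK {w : PM} : w ∈ mK β n ↔
    ∃ x c d : ℂ, x • mV β n + c • mC β n + d • mD β n = w := by
  rw [mK, Submodule.mem_span_triple]

theorem mA_mem : mA β (n + 1) ∈ mW β n := Submodule.subset_span (by simp)
theorem mB_mem : mB β n ∈ mW β n := Submodule.subset_span (by simp)
theorem mC_mem : mC β n ∈ mW β n := Submodule.subset_span (by simp)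
theorem mD_mem : mD β n ∈ mW β n := Submodule.subset_span (by simp)

theorem mK_le : mK β n ≤ mW β n := by
  rw [mK, Submodule.span_le]
  rintro _ (rfl | rfl | rfl)
  · exact add_mem mA_mem (Submodule.smul_mem _ _ mB_mem)
  · exact mC_mem
  · exact mD_mem

/-- Twice the constant component minus the y component isolates A. -/
theorem combination_eq_zero {x y c d : ℂ}
    (h : x • mA β (n + 1) + y • mB β n + c • mC β n + d • mD β n = 0) :
    x = 0 ∧ y = 0 ∧ c = 0 ∧ d = 0 := by
  have h0 := congrFun h 0
  have h1 := congrFun h 1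
  have h2 := congrFun h 2
  have h3 := congrFun h 3
  simp only [mA, mB, mC, mD, Pi.add_apply, Pi.smul_apply, Matrix.cons_val, smul_eq_C_mul,
    Pi.zero_apply, mul_zero, add_zero, zero_add] at h0 h1 h2 h3
  have two : (2 : ℂ[X]) ≠ 0 := two_ne_zero
  have e1 : C x * omP β (n + 1) = 0 := by
    have : 4 * (C x * omP β (n + 1)) = 0 := by linear_combination 2 * h0 - h1
    simpa using this
  have e2 : C y * omP β n = 0 := by linear_combination h0 - e1
  simp only [mul_eq_zero, omP_ne_zero, vP_ne_zero, or_false, C_eq_zero] at e1 e2 h2 h3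
  exact ⟨e1, e2, h2, h3⟩

theorem mC_ne_zero : mC β n ≠ 0 := fun h => one_ne_zero
  (combination_eq_zero (β := β) (n := n) (x := 0) (y := 0) (c := 1) (d := 0) (by simp [h])).2.2.1

theorem mV_ne_zero : mV β n ≠ 0 := fun h => one_ne_zero
  (combination_eq_zero (β := β) (n := n) (x := 1) (y := n - β) (c := 0) (d := 0)
    (by simpa [mV] using h)).1

theorem mR_ne_zero : mR β n ≠ 0 := fun h => one_ne_zero
  (combination_eq_zero (β := β) (n := n) (x := 1) (y := (n : ℂ) + 1) (c := 0) (d := 0)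
    (by simpa [mR] using h)).1

/-- This formula governs the 𝔨₀-structure: the even part goes to C unless it is a multiple of R, and
D goes to a nonzero multiple of V. -/
theorem pmOp_oddDer (x y c d : ℂ) :
    pmOp β oddDerCoef (x • mA β (n + 1) + y • mB β n + c • mC β n + d • mD β n) =
      (4 * ((n + 1) * x - y)) • mC β n - (d * 2⁻¹) • mV β n := by
  simp only [map_add, map_smul, pmOp_mA_succ oddDerCoef_mem, pmOp_mB oddDerCoef_mem,
    pmOp_mC oddDerCoef_mem, pmOp_mD oddDerCoef_mem, mV]
  simp only [oddDerCoef, Matrix.cons_val]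
  module

theorem pmOp_raise (x y c d : ℂ) :
    pmOp β (Pi.single 10 1) (x • mA β (n + 1) + y • mB β n + c • mC β n + d • mD β n) =
      d • mC β n := by
  simp only [map_add, map_smul, pmOp_mA_succ raise_mem, pmOp_mB raise_mem,
    pmOp_mC raise_mem, pmOp_mD raise_mem, Pi.single_apply, Fin.reduceEq, if_true, if_false]
  module

theorem pmOp_lower (x y c d : ℂ) :
    pmOp β (Pi.single 11 1) (x • mA β (n + 1) + y • mB β n + c • mC β n + d • mD β n) =
      c • mD β n := by
  simp only [map_add, map_smul, pmOp_mA_succ lower_mem, pmOp_mB lower_mem,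
    pmOp_mC lower_mem, pmOp_mD lower_mem, Pi.single_apply, Fin.reduceEq, if_true, if_false]
  module

/-- An operator with eigenvalues 2, -2, 0, 0, which tells A from B. -/
theorem pmOp_compact (x y c d : ℂ) :
    pmOp β compactCoef (x • mA β (n + 1) + y • mB β n + c • mC β n + d • mD β n) =
      (2 * x) • mA β (n + 1) - (2 * y) • mB β n := by
  simp only [map_add, map_smul, pmOp_mA_succ compactCoef_mem, pmOp_mB compactCoef_mem,
    pmOp_mC compactCoef_mem, pmOp_mD compactCoef_mem]
  simp only [compactCoef, Matrix.cons_val]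
  module

variable {T : Set (Fin 18 → ℂ)} {N : Submodule ℂ PM}

/-- C is lowered to D, and the odd derivation carries D to a multiple of V. -/
theorem mK_le_of_mC (hN : ModelStable β T N) (hP : HasOp T oddDerCoef)
    (hF : HasOp T (Pi.single 11 1)) (h : mC β n ∈ N) : mK β n ≤ N := by
  have hD : mD β n ∈ N := by
    have := hN.mem hF h
    have e := pmOp_lower (β := β) (n := n) 0 0 1 0
    simp only [zero_smul, zero_add, add_zero, one_smul] at e
    rwa [e] at this
  have hV : mV β n ∈ N := by
    have := hN.mem hP hD
    have e := pmOp_oddDer (β := β) (n := n) 0 0 0 1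
    simp only [zero_smul, zero_add, add_zero, one_smul, mul_zero, sub_self, zero_sub, one_mul] at e
    rw [e, ← neg_smul] at this
    exact (Submodule.smul_mem_iff _ (by norm_num)).1 this
  rw [mK, Submodule.span_le]
  rintro _ (rfl | rfl | rfl) <;> assumption

/-- The excluded vectors are the multiples of R. From any other vector, raising, lowering followed
by raising, or the odd derivation gives a nonzero multiple of C. -/
theorem mK_le_of_mem (hN : ModelStable β T N) (hP : HasOp T oddDerCoef)
    (hE : HasOp T (Pi.single 10 1)) (hF : HasOp T (Pi.single 11 1)) {x y c d : ℂ}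
    (h : x • mA β (n + 1) + y • mB β n + c • mC β n + d • mD β n ∈ N)
    (h0 : ¬(c = 0 ∧ d = 0 ∧ (n + 1) * x = y)) : mK β n ≤ N := by
  refine mK_le_of_mC hN hP hF ?_
  by_cases hd : d = 0
  · by_cases hc : c = 0
    · have := hN.mem hP h
      rw [pmOp_oddDer, hd, zero_mul, zero_smul, sub_zero] at this
      refine (Submodule.smul_mem_iff _ (mul_ne_zero (by norm_num) (sub_ne_zero.2 ?_))).1 this
      exact fun h => h0 ⟨hc, hd, h⟩
    · have := hN.mem hF h
      rw [pmOp_lower] at this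
      have hD := (Submodule.smul_mem_iff _ hc).1 this
      have := hN.mem hE hD
      have e := pmOp_raise (β := β) (n := n) 0 0 0 1
      simp only [zero_smul, zero_add, add_zero, one_smul] at e
      rwa [e] at this
  · have := hN.mem hE h
    rw [pmOp_raise] at this
    exact (Submodule.smul_mem_iff _ hd).1 this

theorem mK_stable (hT : T ⊆ k0Coef) : ModelStable β T (mK β n) := by
  intro t ht w hw
  obtain ⟨hk, h0, h1, h2, h3⟩ := hT ht
  obtain ⟨x, c, d, rfl⟩ := mem_mK.1 hw
  have k := hk
  obtain ⟨h4, h5, h17, h7, h9, h10, h11, h12, h13⟩ := k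
  -- On 𝔨₀ the multiplications vanish, and with them the Bessel operators tied to them.
  have e13 : t 13 = 0 := by linear_combination (h0 - h10) * (-1 / 4)
  have e14 : t 14 = 0 := by linear_combination (h1 - h11) * (-1 / 4)
  have e15 : t 15 = 0 := by linear_combination (h2 - h12) * (-1 / 4)
  have e16 : t 16 = 0 := by linear_combination (h3 - h13) * (-1 / 4)
  refine mem_mK.2 ⟨c * (t 8 * 2⁻¹) - d * (t 6 * 2⁻¹),
    x * (4 * (1 + β) * t 6) + c * t 12 + d * t 10,
    x * (4 * (1 + β) * t 8) + c * t 11 - d * t 12, ?_⟩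
  simp only [map_add, map_smul, pmOp_mA_succ hk, pmOp_mB hk, pmOp_mC hk, pmOp_mD hk, mV, e13, e14,
    e15, e16]
  module

/-- The odd images of A and (n + 1)B are opposite, and 𝔨₀ has nothing else acting on the even
vectors. -/
theorem mR_killed (hT : T ⊆ k0Coef) {t : Fin 18 → ℂ} (ht : t ∈ T) : pmOp β t (mR β n) = 0 := by
  obtain ⟨hk, h0, h1, h2, h3⟩ := hT ht
  have k := hk
  obtain ⟨h4, h5, h17, h7, h9, h10, h11, h12, h13⟩ := k
  have e13 : t 13 = 0 := by linear_combination (h0 - h10) * (-1 / 4)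
  have e14 : t 14 = 0 := by linear_combination (h1 - h11) * (-1 / 4)
  have e15 : t 15 = 0 := by linear_combination (h2 - h12) * (-1 / 4)
  have e16 : t 16 = 0 := by linear_combination (h3 - h13) * (-1 / 4)
  simp only [mR, map_add, map_smul, pmOp_mA_succ hk, pmOp_mB hk, e13, e14, e15, e16]
  module

theorem mW_stable (hT : T ⊆ kCoef) : ModelStable β T (mW β n) := by
  intro t ht w hw
  have hk := hT ht
  obtain ⟨x, y, c, d, rfl⟩ := mem_mW.1 hw
  refine mem_mW.2 ⟨x * (t 13 * (2 * β - 4 * (n + 1)) + 2 * t 14) + c * (t 16 + t 8 * 2⁻¹)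
      - d * (t 15 + t 6 * 2⁻¹),
    y * (t 13 * (2 * β - 4 * n) - 2 * t 14) + (n - β) * (c * (t 8 * 2⁻¹ - t 16)
      + d * (t 15 - t 6 * 2⁻¹)),
    x * ((n + 1) * (4 * t 6 - 8 * t 15)) + y * (-4 * t 6 - 8 * t 15)
      + c * (t 12 - t 13 * (4 * n + 2 - 2 * β)) + d * t 10,
    x * ((n + 1) * (4 * t 8 - 8 * t 16)) + y * (-4 * t 8 - 8 * t 16) + c * t 11
      + d * (-t 12 - t 13 * (4 * n + 2 - 2 * β)), ?_⟩
  simp only [map_add, map_smul, pmOp_mA_succ hk, pmOp_mB hk, pmOp_mC hk, pmOp_mD hk]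
  module

/-- A nonzero multiple of V is a multiple of R only if n - β = n + 1, so for β ≠ -1 every nonzero
vector of K generates K. -/
theorem mK_irred (hT : K0Like T) (hβ : β ≠ -1) : ModelIrred β T (mK β n) := by
  refine ⟨mK_stable hT.sub, fun h => mC_ne_zero (β := β) (n := n) ?_, fun N hle hN => ?_⟩
  · have : mC β n ∈ mK β n := Submodule.subset_span (by simp)
    rwa [h, Submodule.mem_bot] at this
  · rw [or_iff_not_imp_left]
    intro hne
    obtain ⟨w, hw, hw0⟩ := Submodule.exists_mem_ne_zero_of_ne_bot hne
    obtain ⟨x, c, d, rfl⟩ := mem_mK.1 (hle hw)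
    refine le_antisymm hle (mK_le_of_mem hN hT.oddDer hT.raise hT.lower
      (x := x) (y := x * (n - β)) (c := c) (d := d) ?_ ?_)
    · convert hw using 1
      rw [mV]
      module
    · rintro ⟨rfl, rfl, h⟩
      have : x * (1 + β) = 0 := by linear_combination h
      rcases mul_eq_zero.1 this with rfl | h
      · simp at hw0
      · exact hβ (by linear_combination h)

theorem span_singleton_irred {v : PM} (hv : v ≠ 0)
    (h : ModelStable β T (Submodule.span ℂ {v})) : ModelIrred β T (Submodule.span ℂ {v}) :=
  ⟨h, by simpa using hv, fun _ hle _ => (nonzero_span_atom v hv).le_iff.1 hle⟩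

theorem mRk_irred (hT : K0Like T) : ModelIrred β T (mRk β n) := by
  refine span_singleton_irred mR_ne_zero fun t ht w hw => ?_
  obtain ⟨c, rfl⟩ := Submodule.mem_span_singleton.1 hw
  rw [map_smul, mR_killed hT.sub ht, smul_zero]
  exact Submodule.zero_mem _

theorem mK_inf_mRk (hβ : β ≠ -1) : mK β n ⊓ mRk β n = ⊥ := by
  rw [Submodule.eq_bot_iff]
  rintro w ⟨hw, hw'⟩
  obtain ⟨x, c, d, rfl⟩ := mem_mK.1 hw
  obtain ⟨r, hr⟩ := Submodule.mem_span_singleton.1 hw'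
  have := combination_eq_zero (β := β) (n := n) (x := x - r) (y := x * (n - β) - r * (n + 1))
    (c := c) (d := d) (by
      rw [← sub_eq_zero] at hr
      rw [← neg_eq_zero, ← hr, mV, mR]
      module)
  obtain ⟨h1, h2, rfl, rfl⟩ := this
  have : x * (1 + β) = 0 := by linear_combination (n + 1) * h1 - h2
  rcases mul_eq_zero.1 this with rfl | h
  · simp
  · exact absurd (by linear_combination h) hβ

/-- A and B are recovered from V and R by a linear system of determinant 1 + β. -/
theorem mK_sup_mRk (hβ : β ≠ -1) : mK β n ⊔ mRk β n = mW β n := by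
  have hb : 1 + β ≠ 0 := fun h => hβ (by linear_combination h)
  apply le_antisymm
  · refine sup_le mK_le ?_
    rw [mRk, Submodule.span_singleton_le_iff_mem]
    exact add_mem mA_mem (Submodule.smul_mem _ _ mB_mem)
  · have hV : mV β n ∈ mK β n ⊔ mRk β n :=
      Submodule.mem_sup_left (Submodule.subset_span (by simp))
    have hR : mR β n ∈ mK β n ⊔ mRk β n :=
      Submodule.mem_sup_right (Submodule.subset_span (by simp))
    rw [mW, Submodule.span_le]
    rintro _ (rfl | rfl | rfl | rfl)
    · rw [SetLike.mem_coe, ← Submodule.smul_mem_iff _ hb]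
      have : (1 + β) • mA β (n + 1) = ((n : ℂ) + 1) • mV β n - (n - β) • mR β n := by
        rw [mV, mR]; module
      rw [this]
      exact sub_mem (Submodule.smul_mem _ _ hV) (Submodule.smul_mem _ _ hR)
    · rw [SetLike.mem_coe, ← Submodule.smul_mem_iff _ hb]
      have : (1 + β) • mB β n = mR β n - mV β n := by
        rw [mV, mR]; module
      rw [this]
      exact sub_mem hR hV
    · exact Submodule.mem_sup_left (Submodule.subset_span (by simp))
    · exact Submodule.mem_sup_left (Submodule.subset_span (by simp))

/-- Here V = R. A nonzero submodule contains either a multiple of R, which is V, or a vector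
generating K, which contains V. -/
theorem mW_socle (hT : K0Like T) (hβ : β = -1) (hN : ModelStable β T N) (hle : N ≤ mW β n)
    (hne : N ≠ ⊥) : mV β n ∈ N := by
  obtain ⟨w, hw, hw0⟩ := Submodule.exists_mem_ne_zero_of_ne_bot hne
  obtain ⟨x, y, c, d, rfl⟩ := mem_mW.1 (hle hw)
  by_cases h : c = 0 ∧ d = 0 ∧ (n + 1) * x = y
  · obtain ⟨rfl, rfl, rfl⟩ := h
    have e : x • mA β (n + 1) + ((n + 1) * x) • mB β n + (0 : ℂ) • mC β n + (0 : ℂ) • mD β n =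
        x • mV β n := by
      rw [mV, hβ]; module
    rw [e] at hw hw0
    exact (Submodule.smul_mem_iff _ (left_ne_zero_of_smul hw0)).1 hw
  · exact mK_le_of_mem hN hT.oddDer hT.raise hT.lower hw h (Submodule.subset_span (by simp))

/-- Two nonzero submodules share V, so they cannot meet trivially. -/
theorem mW_indecomp (hT : K0Like T) (hβ : β = -1) {N₁ N₂ : Submodule ℂ PM} (h₁ : N₁ ≤ mW β n)
    (h₂ : N₂ ≤ mW β n) (s₁ : ModelStable β T N₁) (s₂ : ModelStable β T N₂) (h : N₁ ⊓ N₂ = ⊥) :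
    N₁ = ⊥ ∨ N₂ = ⊥ := by
  by_contra! hne
  have : mV β n ∈ N₁ ⊓ N₂ :=
    ⟨mW_socle hT hβ s₁ h₁ hne.1, mW_socle hT hβ s₂ h₂ hne.2⟩
  rw [h, Submodule.mem_bot] at this
  exact mV_ne_zero this

theorem mA_ne_zero (k : ℕ) : mA β k ≠ 0 := fun h => omP_ne_zero β k (by simpa [mA] using congrFun h 0)

theorem mW_ne_bot : mW β n ≠ ⊥ := fun h => mA_ne_zero (β := β) (n + 1)
  ((Submodule.mem_bot ℂ).1 (h ▸ mA_mem))

/-- K is a nonzero submodule that does not contain A. -/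
theorem mW_not_irred (hT : K0Like T) (hβ : β = -1) : ¬ ModelIrred β T (mW β n) := by
  intro h
  rcases h.2.2 _ mK_le (mK_stable hT.sub) with h | h
  · have : mC β n ∈ mK β n := Submodule.subset_span (by simp)
    rw [h, Submodule.mem_bot] at this
    exact mC_ne_zero this
  · have hA := mA_mem (β := β) (n := n)
    rw [← h, mem_mK] at hA
    obtain ⟨x, c, d, e⟩ := hA
    obtain ⟨h1, h2, -, -⟩ := combination_eq_zero (β := β) (n := n) (x := x - 1) (y := x * (n - β))
      (c := c) (d := d) (by
        rw [← sub_eq_zero] at e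
        rw [← e, mV]
        module)
    have hn : (n : ℂ) + 1 = 0 := by
      rw [hβ] at h2
      linear_combination h2 - (n + 1) * h1
    exact Nat.cast_add_one_ne_zero n hn

/-- The operator `compactCoef` breaks both obstructions met over 𝔨₀: it moves R off its line, and it
splits V into A and (n - β)B. -/
theorem mW_irred (hT : KLike T) (hβ : (n : ℂ) ≠ β) : ModelIrred β T (mW β n) := by
  refine ⟨mW_stable hT.sub, mW_ne_bot, fun N hle hN => ?_⟩
  rw [or_iff_not_imp_left]
  intro hne
  refine le_antisymm hle ?_
  have split {x y : ℂ} (h : x • mA β (n + 1) + y • mB β n ∈ N) :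
      x • mA β (n + 1) ∈ N ∧ y • mB β n ∈ N := by
    have h' := hN.mem hT.compact h
    have e := pmOp_compact (β := β) (n := n) x y 0 0
    simp only [zero_smul, add_zero] at e
    rw [e] at h'
    have hx : x • mA β (n + 1) ∈ N := by
      -- With eigenvalues 2 and -2, the projection onto A is 1/2 plus 1/4 of the operator.
      have := add_mem (Submodule.smul_mem N (2⁻¹ : ℂ) h) (Submodule.smul_mem N (4⁻¹ : ℂ) h')
      convert this using 1
      module
    exact ⟨hx, (Submodule.add_mem_iff_right _ hx).1 h⟩
  have hK : mK β n ≤ N := by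
    obtain ⟨w, hw, hw0⟩ := Submodule.exists_mem_ne_zero_of_ne_bot hne
    obtain ⟨x, y, c, d, rfl⟩ := mem_mW.1 (hle hw)
    by_cases h : c = 0 ∧ d = 0 ∧ (n + 1) * x = y
    · obtain ⟨rfl, rfl, rfl⟩ := h
      simp only [zero_smul, add_zero] at hw hw0
      have hx : x ≠ 0 := by rintro rfl; simp at hw0
      have hA := (split hw).1
      refine mK_le_of_mem hN hT.oddDer hT.raise hT.lower (x := x) (y := 0) (c := 0) (d := 0)
        (by simpa using hA) ?_
      rintro ⟨-, -, h⟩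
      exact (mul_ne_zero (Nat.cast_add_one_ne_zero n) hx) h
    · exact mK_le_of_mem hN hT.oddDer hT.raise hT.lower hw h
  have hV : mV β n ∈ N := hK (Submodule.subset_span (by simp))
  rw [mV, ← one_smul ℂ (mA β (n + 1))] at hV
  obtain ⟨hA, hB⟩ := split hV
  rw [one_smul] at hA
  rw [mW, Submodule.span_le]
  rintro _ (rfl | rfl | rfl | rfl)
  · exact hA
  -- Here β ≠ n is used: otherwise V = A and B would not be reached.
  · exact (Submodule.smul_mem_iff _ (sub_ne_zero.2 hβ)).1 hB
  · exact hK (Submodule.subset_span (by simp))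
  · exact hK (Submodule.subset_span (by simp))

theorem mW0_irred (hT : KLike T) : ModelIrred β T (mW0 β) := by
  refine span_singleton_irred (mA_ne_zero 0) fun t ht w hw => ?_
  obtain ⟨c, rfl⟩ := Submodule.mem_span_singleton.1 hw
  rw [map_smul, pmOp_mA_zero (hT.sub ht)]
  exact Submodule.smul_mem _ _ (Submodule.smul_mem _ _ (Submodule.mem_span_singleton_self _))

end

/-! ### The sum of the `𝔨`-types -/

/-- The model of `W_{λ,k}`. -/
def mWk (β : ℂ) : ℕ → Submodule ℂ PM
  | 0 => mW0 β
  | n + 1 => mW β n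

/-- The coefficients of an operator that acts on each `𝔨`-type by a scalar. -/
def centralCoef : Fin 18 → ℂ := ![-4, -4, 0, 0, 0, 0, 0, 0, 0, 0, 0, 0, 0, 1, 1, 0, 0, 0]

theorem centralCoef_mem : centralCoef ∈ kCoef := by simp [kCoef, centralCoef]

theorem mWk_le_eigenspace (β : ℂ) (k : ℕ) :
    mWk β k ≤ Module.End.eigenspace (pmOp β centralCoef) (2 * β + 2 - 4 * k) := by
  intro w hw
  rw [Module.End.mem_eigenspace_iff]
  cases k with
  | zero =>
    obtain ⟨c, rfl⟩ := Submodule.mem_span_singleton.1 hw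
    rw [map_smul, pmOp_mA_zero centralCoef_mem]
    simp only [centralCoef, Matrix.cons_val, Nat.cast_zero]
    module
  | succ n =>
    obtain ⟨x, y, c, d, rfl⟩ := mem_mW.1 hw
    simp only [map_add, map_smul, pmOp_mA_succ centralCoef_mem, pmOp_mB centralCoef_mem,
      pmOp_mC centralCoef_mem, pmOp_mD centralCoef_mem]
    simp only [centralCoef, Matrix.cons_val, Nat.cast_succ]
    module

/-- The pieces lie in eigenspaces of one operator, with eigenvalues 2β + 2 - 4k that are distinct
for distinct k. -/
theorem mWk_iSupIndep (β : ℂ) : iSupIndep (mWk β) := by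
  have hi : Function.Injective fun k : ℕ => 2 * β + 2 - 4 * (k : ℂ) := by
    intro k l h
    have : (k : ℂ) = l := by linear_combination (-1 / 4) * h
    exact_mod_cast this
  exact ((Module.End.eigenspaces_iSupIndep (pmOp β centralCoef)).comp hi).mono
    (mWk_le_eigenspace β)

theorem span_range_of_degree {p : ℕ → ℂ[X]} (hp : ∀ n, (p n).degree = n) :
    Submodule.span ℂ (Set.range p) = ⊤ := by
  let S : Polynomial.Sequence ℂ := ⟨p, hp⟩
  exact S.span fun i => isUnit_iff_ne_zero.2 (leadingCoeff_ne_zero.2 (S.ne_zero i))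

theorem single_mem_of_degree {p : ℕ → ℂ[X]} (hp : ∀ n, (p n).degree = n) {N : Submodule ℂ PM}
    {i : Fin 4} (h : ∀ n, Pi.single i (p n) ∈ N) (q : ℂ[X]) : Pi.single i q ∈ N := by
  have : (⊤ : Submodule ℂ ℂ[X]) ≤ N.comap (LinearMap.single ℂ (fun _ : Fin 4 => ℂ[X]) i) := by
    rw [← span_range_of_degree hp, Submodule.span_le]
    rintro _ ⟨n, rfl⟩
    exact h n
  exact this (Submodule.mem_top (x := q))

theorem eq_top_of_single_mem {N : Submodule ℂ PM} (h : ∀ i q, Pi.single i q ∈ N) : N = ⊤ := by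
  rw [Submodule.eq_top_iff']
  intro p
  rw [← Finset.univ_sum_single p]
  exact Submodule.sum_mem _ fun i _ => h i _

/-- `mA n` and `mB n` belong to the neighbouring pieces n and n + 1. Their half sum and quarter
difference put Ω_n alone in the first or second slot, and C and D put V_n in the others. -/
theorem mWk_iSup (β : ℂ) : ⨆ k, mWk β k = ⊤ := by
  have hA (k : ℕ) : mA β k ∈ ⨆ k, mWk β k := by
    refine Submodule.mem_iSup_of_mem k ?_
    cases k with
    | zero => exact Submodule.mem_span_singleton_self _
    | succ n => exact mA_mem
  have hB (k : ℕ) : mB β k ∈ ⨆ k, mWk β k := Submodule.mem_iSup_of_mem (k + 1) mB_mem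
  have hC (k : ℕ) : mC β k ∈ ⨆ k, mWk β k := Submodule.mem_iSup_of_mem (k + 1) mC_mem
  have hD (k : ℕ) : mD β k ∈ ⨆ k, mWk β k := Submodule.mem_iSup_of_mem (k + 1) mD_mem
  refine eq_top_of_single_mem fun i => ?_
  fin_cases i
  · refine single_mem_of_degree (degree_omP β) fun n => ?_
    convert Submodule.smul_mem _ (2⁻¹ : ℂ) (add_mem (hA n) (hB n)) using 1
    funext i
    fin_cases i <;> simp [mA, mB]
    rw [← two_smul ℂ, smul_smul]
    simp
  · refine single_mem_of_degree (degree_omP β) fun n => ?_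
    convert Submodule.smul_mem _ (4⁻¹ : ℂ) (sub_mem (hB n) (hA n)) using 1
    funext i
    fin_cases i <;> simp [mA, mB]
    rw [← smul_add, ← add_mul, show (2 + 2 : ℂ[X]) = C 4 by norm_num [map_ofNat], ← smul_eq_C_mul,
      smul_smul]
    simp
  · refine single_mem_of_degree (degree_vP β) fun n => ?_
    convert hC n using 1
    funext i
    fin_cases i <;> simp [mC]
  · refine single_mem_of_degree (degree_vP β) fun n => ?_
    convert hD n using 1
    funext i
    fin_cases i <;> simp [mD]

/-! ### Irreducibility under `𝔤` -/

/-- A nonzero space of polynomials that is stable under `X`, `X d/dX` and `X d²/dX² - β d/dX` is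
everything, unless `β ∈ ℕ`. -/
theorem eq_top_of_stable {β : ℂ} (hβ : ∀ n : ℕ, β ≠ n) {S : Submodule ℂ ℂ[X]} (hS : S ≠ ⊥)
    (hX : ∀ q ∈ S, X * q ∈ S)
    (hB : ∀ q ∈ S, X * derivative (derivative q) - C β * derivative q ∈ S) : S = ⊤ := by
  have key : ∀ n : ℕ, ∀ q ∈ S, q.natDegree = n → q ≠ 0 → (1 : ℂ[X]) ∈ S := by
    intro n
    induction n with
    | zero =>
      intro q hq hn h0
      rw [natDegree_eq_zero] at hn
      obtain ⟨c, rfl⟩ := hn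
      rw [← mul_one (C c), ← smul_eq_C_mul] at hq
      exact (Submodule.smul_mem_iff _ (by simpa using h0)).1 hq
    | succ n ih =>
      intro q hq hn h0
      -- On the leading term the operator acts by (n + 1)(n - β), nonzero as β ∉ ℕ. The degree
      -- therefore drops by exactly one until a nonzero constant is reached.
      have hc : (X * derivative (derivative q) - C β * derivative q).coeff n =
          (n - β) * ((n + 1) * q.coeff (n + 1)) := by
        rw [coeff_sub, coeff_C_mul, coeff_derivative]
        cases n with
        | zero => simp
        | succ m =>
          rw [coeff_X_mul, coeff_derivative, coeff_derivative]
          push_cast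
          ring
      have hne : (X * derivative (derivative q) - C β * derivative q).coeff n ≠ 0 := by
        rw [hc]
        refine mul_ne_zero (sub_ne_zero.2 (hβ n).symm)
          (mul_ne_zero (Nat.cast_add_one_ne_zero n) ?_)
        rw [← hn]
        exact leadingCoeff_ne_zero.2 h0
      refine ih _ (hB q hq) (le_antisymm ?_ (le_natDegree_of_ne_zero hne)) fun h => hne (by simp [h])
      have h1 : (derivative q).natDegree ≤ n := by
        have := natDegree_derivative_le q
        omega
      refine (natDegree_sub_le_of_le (m := n) (n := n) ?_
        ((natDegree_C_mul_le _ _).trans h1)).trans (max_self n).le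
      by_cases hd : (derivative q).natDegree = 0
      · rw [natDegree_eq_zero] at hd
        obtain ⟨c, hd⟩ := hd
        simp [← hd]
      · have h2 := natDegree_derivative_lt hd
        refine natDegree_mul_le.trans ?_
        rw [natDegree_X]
        omega
  obtain ⟨q, hq, hq0⟩ := Submodule.exists_mem_ne_zero_of_ne_bot hS
  have h1 := key _ q hq rfl hq0
  have hpow (n : ℕ) : (X ^ n : ℂ[X]) ∈ S := by
    induction n with
    | zero => simpa using h1
    | succ n ih => rw [pow_succ']; exact hX _ ih
  rw [Submodule.eq_top_iff']
  intro p
  rw [p.as_sum_range_C_mul_X_pow]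
  refine Submodule.sum_mem _ fun i _ => ?_
  rw [← smul_eq_C_mul]
  exact Submodule.smul_mem _ _ (hpow i)

/-- A nonzero submodule is pushed into the y slot, moved to the first slot by the Bessel operator of
y, and filled there by `eq_top_of_stable`. Multiplication by y, x₃, x₄ then fills the other slots.
-/
theorem model_irred {β : ℂ} (hβ : ∀ n : ℕ, β ≠ n) {T : Set (Fin 18 → ℂ)} (hT : GLike β T) :
    ModelIrred β T ⊤ := by
  refine ⟨fun _ _ _ _ => Submodule.mem_top, top_ne_bot, fun N _ hN => ?_⟩
  rw [or_iff_not_imp_left]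
  intro hne
  have mx {p : PM} (hp : p ∈ N) := hN.mem (hT.mul 0) hp
  have my {p : PM} (hp : p ∈ N) := hN.mem (hT.mul 1) hp
  have m3 {p : PM} (hp : p ∈ N) := hN.mem (hT.mul 2) hp
  have m4 {p : PM} (hp : p ∈ N) := hN.mem (hT.mul 3) hp
  simp only [Fin.isValue, Fin.castLE] at mx my m3 m4
  have e0 (p : PM) : pmOp β (Pi.single 0 1) p = ![X * p 0, X * p 1, X * p 2, X * p 3] := by
    refine vec_ext_four ?_ ?_ ?_ ?_ <;>
    simp [pmOp_apply_zero, pmOp_apply_one, pmOp_apply_two, pmOp_apply_three, Pi.single_apply]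
  have e1 (p : PM) : pmOp β (Pi.single 1 1) p = ![0, p 0, 0, 0] := by
    refine vec_ext_four ?_ ?_ ?_ ?_ <;>
    simp [pmOp_apply_zero, pmOp_apply_one, pmOp_apply_two, pmOp_apply_three, Pi.single_apply]
  have e2 (p : PM) : pmOp β (Pi.single 2 1) p = ![0, -(2 * (X * p 3)), p 0, 0] := by
    refine vec_ext_four ?_ ?_ ?_ ?_ <;>
    simp [pmOp_apply_zero, pmOp_apply_one, pmOp_apply_two, pmOp_apply_three, Pi.single_apply]
  have e3 (p : PM) : pmOp β (Pi.single 3 1) p = ![0, 2 * (X * p 2), 0, p 0] := by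
    refine vec_ext_four ?_ ?_ ?_ ?_ <;>
    simp [pmOp_apply_zero, pmOp_apply_one, pmOp_apply_two, pmOp_apply_three, Pi.single_apply]
  have eb (q : ℂ[X]) : pmOp β (Pi.single 13 1) ![q, 0, 0, 0] =
      ![X * tD (tD q) - C β * tD q, 0, 0, 0] := by
    refine vec_ext_four ?_ ?_ ?_ ?_ <;>
    simp [pmOp_apply_zero, pmOp_apply_one, pmOp_apply_two, pmOp_apply_three, Pi.single_apply]
  have ey (q : ℂ[X]) : pmOp β (Pi.single 14 1) ![0, q, 0, 0] = ![-q, 0, 0, 0] := by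
    refine vec_ext_four ?_ ?_ ?_ ?_ <;>
    simp [pmOp_apply_zero, pmOp_apply_one, pmOp_apply_two, pmOp_apply_three, Pi.single_apply]
  have ee (q : ℂ[X]) : pmOp β (eulerCoef β) ![q, 0, 0, 0] =
      ![2 * (X * tD q) - C β * q, 0, 0, 0] := by
    refine vec_ext_four ?_ ?_ ?_ ?_ <;>
    simp [pmOp_apply_zero, pmOp_apply_one, pmOp_apply_two, pmOp_apply_three, eulerCoef]
    ring
  have hs (q : ℂ[X]) : (![q, 0, 0, 0] : PM) = Pi.single 0 q := by
    refine vec_ext_four ?_ ?_ ?_ ?_ <;> simp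
  -- Multiplication by y keeps only a. If a = 0, multiplication by x₄ keeps only c and by x₃ only d;
  -- if these vanish too, the vector is already of the required form.
  obtain ⟨q, hq, hq0⟩ : ∃ q : ℂ[X], (![0, q, 0, 0] : PM) ∈ N ∧ q ≠ 0 := by
    obtain ⟨p, hp, hp0⟩ := Submodule.exists_mem_ne_zero_of_ne_bot hne
    by_cases h0 : p 0 = 0
    swap
    · exact ⟨p 0, e1 p ▸ my hp, h0⟩
    by_cases h2 : p 2 = 0
    swap
    · refine ⟨2 * (X * p 2), ?_, by simp [h2]⟩
      have := m4 hp
      erw [e3, h0] at this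
      exact this
    by_cases h3 : p 3 = 0
    swap
    · refine ⟨-(2 * (X * p 3)), ?_, by simp [h3]⟩
      have := m3 hp
      erw [e2, h0] at this
      exact this
    refine ⟨p 1, ?_, fun h1 => hp0 (vec_ext_four h0 h1 h2 h3)⟩
    convert hp using 1
    exact vec_ext_four h0.symm rfl h2.symm h3.symm
  set S : Submodule ℂ ℂ[X] := N.comap (LinearMap.single ℂ (fun _ : Fin 4 => ℂ[X]) 0) with hSd
  have memS (q : ℂ[X]) : q ∈ S ↔ (![q, 0, 0, 0] : PM) ∈ N := by rw [hs]; rfl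
  have hSX (q : ℂ[X]) (h : q ∈ S) : X * q ∈ S := by
    rw [memS] at h ⊢
    have := mx h
    erw [e0] at this
    simpa using this
  have hSE (q : ℂ[X]) (h : q ∈ S) : X * tD q ∈ S := by
    have h' := h
    rw [memS] at h
    have := hN.mem hT.euler h
    rw [ee, ← memS] at this
    have := add_mem this (Submodule.smul_mem S β h')
    rw [smul_eq_C_mul, sub_add_cancel, show (2 : ℂ[X]) = C 2 from rfl, ← smul_eq_C_mul] at this
    exact (Submodule.smul_mem_iff _ two_ne_zero).1 this
  have hS : S = ⊤ := by
    refine eq_top_of_stable hβ (fun h => ?_) hSX fun q h => ?_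
    · have := hN.mem hT.bessel_y hq
      rw [ey, ← memS, h, Submodule.mem_bot, neg_eq_zero] at this
      exact hq0 this
    · have h' := (memS q).1 h
      have := hN.mem hT.bessel_x h'
      rw [eb, ← memS] at this
      -- Undoing the twist: with d/dX = `tD` + 2, the operator X d²/dX² - β d/dX equals X `tD`² - β
      -- `tD` + 4X `tD` + 4X - 2β. The Euler operator is needed for the term X `tD`.
      have h2 := add_mem (add_mem this (Submodule.smul_mem S (4 : ℂ) (hSE q h)))
        (Submodule.smul_mem S (4 : ℂ) (hSX q h))
      have h3 := add_mem h2 (Submodule.smul_mem S (-(2 * β)) h)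
      convert h3 using 1
      simp only [tD_apply, map_sub, derivative_C_mul, smul_eq_C_mul, map_neg, map_mul]
      simp only [map_ofNat]
      ring
  have hq (q : ℂ[X]) : (![q, 0, 0, 0] : PM) ∈ N := by
    rw [← memS, hS]; exact Submodule.mem_top
  refine eq_top_of_single_mem fun i q => ?_
  fin_cases i
  · exact hs q ▸ hq q
  · convert my (hq q) using 1
    erw [e1]
    refine vec_ext_four ?_ ?_ ?_ ?_ <;> simp
  · convert m3 (hq q) using 1
    erw [e2]
    refine vec_ext_four ?_ ?_ ?_ ?_ <;> simp
  · convert m4 (hq q) using 1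
    erw [e3]
    refine vec_ext_four ?_ ?_ ?_ ?_ <;> simp

end

noncomputable section

open Polynomial

variable {𝕜 : Type*} [Field 𝕜] [Algebra 𝕜 ℂ]

/-! ### The parameter `β` -/

theorem betaC_ne_natCast {α lam : 𝕜} (h : Admissible α lam) (n : ℕ) : betaC α lam ≠ n := by
  rw [betaC, ← map_natCast (algebraMap 𝕜 ℂ), (algebraMap 𝕜 ℂ).injective.ne_iff]
  rcases h with ⟨rfl, h⟩ | ⟨rfl, -, h⟩
  · simpa using h n
  · split_ifs with h1
    -- λ = 1 = α is excluded, since then α⁻¹ = 1 is a natural number.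
    · exact absurd (by simp [← h1]) (h 1)
    · exact h n

theorem betaC_eq_neg_one_iff {α lam : 𝕜} : betaC α lam = -1 ↔ α = -1 := by
  have : (-1 : ℂ) = algebraMap 𝕜 ℂ (-1) := by simp
  rw [betaC, this, (algebraMap 𝕜 ℂ).injective.eq_iff]
  split_ifs
  · rfl
  · rw [inv_eq_iff_eq_inv, inv_neg_one]

/-! ### Parity -/

/-- A superfunction is homogeneous of parity `q`. -/
def SHom (q : ZMod 2) (F : SF) : Prop := ∀ i, sfPar i ≠ q → F i = 0

/-- An operator on superfunctions is homogeneous of parity `p`. -/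
def OpHom (p : ZMod 2) (T : Module.End ℂ SF) : Prop := ∀ q F, SHom q F → SHom (p + q) (T F)

theorem OpHom.add {p : ZMod 2} {T U : Module.End ℂ SF} (hT : OpHom p T) (hU : OpHom p U) :
    OpHom p (T + U) := fun q F hF i hi => by
  rw [LinearMap.add_apply, Pi.add_apply, hT q F hF i hi, hU q F hF i hi, add_zero]

theorem OpHom.sub {p : ZMod 2} {T U : Module.End ℂ SF} (hT : OpHom p T) (hU : OpHom p U) :
    OpHom p (T - U) := fun q F hF i hi => by
  rw [LinearMap.sub_apply, Pi.sub_apply, hT q F hF i hi, hU q F hF i hi, sub_zero]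

theorem OpHom.smul {p : ZMod 2} {T : Module.End ℂ SF} (c : ℂ) (hT : OpHom p T) :
    OpHom p (c • T) := fun q F hF i hi => by
  rw [LinearMap.smul_apply, Pi.smul_apply, hT q F hF i hi, smul_zero]

theorem OpHom.mul {p p' r : ZMod 2} {T U : Module.End ℂ SF} (hT : OpHom p T) (hU : OpHom p' U)
    (h : p + p' = r) : OpHom r (T * U) := fun q F hF => by
  rw [← h, add_assoc]
  exact hT _ _ (hU q F hF)

theorem opHom_one : OpHom 0 1 := fun q F hF => by rwa [zero_add]

theorem zmod_two_cases (q : ZMod 2) : q = 0 ∨ q = 1 := by decide +revert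

theorem opHom_mulX (i : Fin 4) : OpHom (par i) (mulX i) := by
  intro q F hF j hj
  have h0 := hF 0
  have h1 := hF 1
  have h2 := hF 2
  have h3 := hF 3
  rcases zmod_two_cases q with rfl | rfl <;> fin_cases i <;> fin_cases j <;>
  simp_all [par, sfPar, mulX_zero, mulX_one, mulX_two, mulX_three,
    show (1 : ZMod 2) + 1 = 0 from rfl]

theorem opHom_del (i : Fin 4) : OpHom (par i) (del i) := by
  intro q F hF j hj
  have h0 := hF 0
  have h1 := hF 1
  have h2 := hF 2
  have h3 := hF 3
  rcases zmod_two_cases q with rfl | rfl <;> fin_cases i <;> fin_cases j <;>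
  simp_all [par, sfPar, del_zero, del_one, del_two, del_three,
    show (1 : ZMod 2) + 1 = 0 from rfl]

/-- The parities of the elementary operators. -/
def elemPar : Fin 18 → ZMod 2 := ![0, 0, 1, 1, 0, 0, 1, 1, 1, 1, 0, 0, 0, 0, 0, 1, 1, 0]

theorem opHom_sfElem (a l : ℂ) (i : Fin 18) : OpHom (elemPar i) (sfElem a l i) := by
  fin_cases i
  · exact opHom_mulX 0
  · exact opHom_mulX 1
  · exact opHom_mulX 2
  · exact opHom_mulX 3
  all_goals
    simp only [elemPar, sfElem, bessel, Fin.reduceFinMk, Matrix.cons_val]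
    repeat' first
      | with_reducible exact opHom_one
      | with_reducible exact opHom_mulX _
      | with_reducible exact opHom_del _
      | with_reducible apply OpHom.add
      | with_reducible apply OpHom.sub
      | with_reducible apply OpHom.smul
      | with_reducible apply OpHom.mul
      | rfl

theorem sfCoef_eq_zero {α lam : 𝕜} {p : ZMod 2} {X : Amb 𝕜} (hX : X ∈ gAlg α) (hp : AmbHom p X)
    {i : Fin 18} (hi : elemPar i ≠ p) : sfCoef α lam X i = 0 := by
  rcases zmod_two_cases p with rfl | rfl
  · obtain ⟨e, rfl⟩ := exists_evenAmb hX hp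
    fin_cases i <;> simp [elemPar] at hi <;> simp [sfCoef, evenAmb, derMat]
  · obtain ⟨e, rfl⟩ := exists_oddAmb hX hp
    fin_cases i <;> simp [elemPar] at hi <;> simp [sfCoef, oddAmb, derMat]

/-- Each elementary operator is homogeneous, and a homogeneous X has nonzero coefficients only at
those of its own parity. -/
theorem QHom.rep {α lam : 𝕜} (h : Admissible α lam) {p q : ZMod 2} {X : gAlg α}
    (hX : AmbHom p X.1) {w : QF α lam} (hw : QHom α lam q w) :
    QHom α lam (p + q) (rep h X w) := by
  obtain ⟨F, hF, rfl⟩ := hw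
  refine ⟨piOp α lam X.1 F, fun j hj => ?_, rfl⟩
  rw [piOp_eq α lam X.1 X.2, LinearMap.sum_apply, Finset.sum_apply]
  refine Finset.sum_eq_zero fun i _ => ?_
  rw [LinearMap.smul_apply, Pi.smul_apply]
  by_cases hi : elemPar i = p
  · rw [opHom_sfElem _ _ i q F hF j (hi ▸ hj), smul_zero]
  · rw [sfCoef_eq_zero X.2 hX hi, zero_smul]

/-! ### The polynomial model of `π_λ` -/

/-- The class of `F` is mapped to the class of `π_λ(X) F`. -/
theorem rep_toQF {α lam : 𝕜} (h : Admissible α lam) (S : Chart α lam) {β : ℂ}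
    {τ : (Fin 18 → ℂ) → Fin 18 → ℂ} (hadd : ∀ s t, τ (s + t) = τ s + τ t)
    (hsmul : ∀ (c : ℂ) t, τ (c • t) = c • τ t)
    (hS : ∀ p i, sfElem (algebraMap 𝕜 ℂ α) (algebraMap 𝕜 ℂ lam) i (S.lift p) -
      S.lift (pmOp β (τ (Pi.single i 1)) p) ∈ ideal α lam) (X : gAlg α) (p : PM) :
    rep h X (S.toQF p) = S.toQF (pmOp β (τ (sfCoef α lam X.1)) p) := by
  change cls α lam (piOp α lam X.1 (S.lift p)) = cls α lam (S.lift _)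
  -- Both sides are linear in the coefficient vector, so the unit vectors suffice.
  let L : (Fin 18 → ℂ) →ₗ[ℂ] PM :=
    { toFun := fun t => pmOp β (τ t) p
      map_add' := fun s t => by rw [hadd, pmOp_add]
      map_smul' := fun c t => by rw [hsmul, pmOp_smul]; rfl }
  have hL : pmOp β (τ (sfCoef α lam X.1)) p =
      ∑ i, sfCoef α lam X.1 i • pmOp β (τ (Pi.single i 1)) p := by
    change L _ = ∑ i, _ • L (Pi.single i 1)
    conv_lhs => rw [← Finset.univ_sum_single (sfCoef α lam X.1), map_sum]
    refine Finset.sum_congr rfl fun i _ => ?_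
    rw [← map_smul, ← Pi.single_smul, smul_eq_mul, mul_one]
  rw [Chart.cls_eq_iff, hL, piOp_eq α lam X.1 X.2, LinearMap.sum_apply, map_sum,
    ← Finset.sum_sub_distrib]
  refine Submodule.sum_mem _ fun i _ => ?_
  rw [LinearMap.smul_apply, map_smul, ← smul_sub]
  exact Submodule.smul_mem _ _ (hS p i)

/-- The coefficients of the elements of a subset of `𝔤`. -/
def coefSet {α : 𝕜} (κ : Amb 𝕜 → Fin 18 → ℂ) (l : Set (gAlg α)) : Set (Fin 18 → ℂ) :=
  (fun X : gAlg α => κ X.1) '' l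

/-- A description of `π_λ` on `W_λ` by operators on quadruples of polynomials. -/
structure Model {α lam : 𝕜} (h : Admissible α lam) where
  /-- the coordinates -/
  S : Chart α lam
  /-- the coefficients of the operators -/
  κ : Amb 𝕜 → Fin 18 → ℂ
  rep_eq : ∀ (X : gAlg α) (p : PM), rep h X (S.toQF p) = S.toQF (pmOp (betaC α lam) (κ X.1) p)
  κ_add : ∀ X Y, κ (X + Y) = κ X + κ Y
  κ_smul : ∀ (c : 𝕜) X, κ (c • X) = algebraMap 𝕜 ℂ c • κ X
  bracket_eq : ∀ {p q : ZMod 2} {X Y : Amb 𝕜}, X ∈ gAlg α → Y ∈ gAlg α → AmbHom p X →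
    AmbHom q Y → bracket α (sgn p q) X Y ∈ gAlg α ∧
      ∀ w, pmOp (betaC α lam) (κ (bracket α (sgn p q) X Y)) w =
        pmOp (betaC α lam) (κ X) (pmOp (betaC α lam) (κ Y) w) -
        sgn p q • pmOp (betaC α lam) (κ Y) (pmOp (betaC α lam) (κ X) w)
  k0Like : K0Like (coefSet κ (k0Alg α))
  kLike : KLike (coefSet κ (kAlg α))
  gLike : GLike (betaC α lam) (coefSet κ (Set.univ : Set (gAlg α)))

theorem hasOp_coefSet {𝕜 : Type*} [Field 𝕜] {α : 𝕜} {κ : Amb 𝕜 → Fin 18 → ℂ} {l : Set (gAlg α)} {t : Fin 18 → ℂ}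
    (X : gAlg α) (hX : X ∈ l) (c : ℂ) (hc : c ≠ 0) (h : κ X.1 = c • t) :
    HasOp (coefSet κ l) t := ⟨c, hc, X, hX, h⟩

/-- The derivation with matrix `derMat` as an element of `𝔤`. -/
def derElem (α m n r s t : 𝕜) : gAlg α := ⟨(0, 0, derMat α m n r s t, 0), derMat_mem α m n r s t⟩

theorem derElem_mem (α m n r s t : 𝕜) : derElem α m n r s t ∈ k0Alg α :=
  ⟨⟨rfl, neg_zero.symm⟩, rfl, rfl⟩

theorem k0Alg_subset {𝕜 : Type*} [Field 𝕜] (α : 𝕜) : k0Alg α ⊆ kAlg α := fun _ h => h.1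

/-- The element `(u, a, x)` of `D_α⁻ ⊕ ⟨L_a⟩ ⊕ D_α⁺`. -/
def vecElem (α : 𝕜) (u a x : Fin 4 → 𝕜) : gAlg α := ⟨(u, a, 0, x), (jDer α).zero_mem⟩

theorem sfCoef_mem_kCoef (α lam : 𝕜) {X : gAlg α} (hX : X ∈ kAlg α) :
    sfCoef α lam X.1 ∈ kCoef := by
  obtain ⟨⟨u, a, M, x⟩, hM⟩ := X
  obtain ⟨h1, h2⟩ := hX
  dsimp only at h1 h2
  subst h1 h2
  simp only [kCoef, sfCoef, Set.mem_ofPred_eq, Matrix.cons_val, Pi.zero_apply, Pi.neg_apply,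
    map_zero, map_neg, zero_div, neg_zero, sub_zero, zero_mul, add_zero, true_and]
  refine ⟨?_, ?_, ?_, ?_⟩ <;> ring

theorem sfCoef_mem_k0Coef (α lam : 𝕜) {X : gAlg α} (hX : X ∈ k0Alg α) :
    sfCoef α lam X.1 ∈ k0Coef := by
  refine ⟨sfCoef_mem_kCoef α lam hX.1, ?_⟩
  simp [sfCoef, hX.2.1]

theorem swapCoef_mem_kCoef (a : ℂ) {t : Fin 18 → ℂ} (ht : t ∈ kCoef) : swapCoef a t ∈ kCoef := by
  obtain ⟨h4, h5, h17, h7, h9, h0, h1, h2, h3⟩ := ht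
  simp only [kCoef, swapCoef, Set.mem_ofPred_eq, Matrix.cons_val, h4, h5, h17, h7, h9, h0, h1, h2,
    h3, mul_neg, neg_neg, true_and, and_true]
  ring

theorem swapCoef_mem_k0Coef (a : ℂ) {t : Fin 18 → ℂ} (ht : t ∈ k0Coef) :
    swapCoef a t ∈ k0Coef := by
  obtain ⟨hk, h0, h1, h2, h3⟩ := ht
  refine ⟨swapCoef_mem_kCoef a hk, ?_⟩
  simp [swapCoef, h0, h1, h2, h3]

/-! ### The operators that 𝔨₀, 𝔨 and 𝔤 provide in each of the two cases. -/

section Models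

theorem k0Like_sfCoef (α lam : 𝕜) : K0Like (coefSet (sfCoef α lam) (k0Alg α)) where
  sub := by
    rintro _ ⟨X, hX, rfl⟩
    exact sfCoef_mem_k0Coef α lam hX
  oddDer := hasOp_coefSet (derElem α 1 0 0 0 0) (derElem_mem ..) 1 one_ne_zero <| by
    funext i
    fin_cases i <;> simp only [sfCoef, derElem, derMat, oddDerCoef, Fin.zero_eta, Fin.mk_one,
      Fin.reduceFinMk, Fin.isValue, Matrix.cons_val, Matrix.cons_val', Matrix.of_apply,
      Pi.smul_apply, Pi.zero_apply, Pi.neg_apply, smul_eq_mul, map_zero, map_one, map_neg, mul_zero,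
      zero_mul, mul_one, one_mul, mul_neg, neg_mul, neg_neg, zero_div, neg_zero, add_zero,
      zero_add, sub_zero,
      zero_sub, if_true, if_false, Fin.reduceEq, one_ne_zero, zero_ne_one, Matrix.zero_apply,
      Fin.reduceCastLE]
  raise := hasOp_coefSet (derElem α 0 0 0 1 0) (derElem_mem ..) 1 one_ne_zero <| by
    funext i
    fin_cases i <;> simp only [sfCoef, derElem, derMat, Pi.single_apply, Fin.zero_eta, Fin.mk_one,
      Fin.reduceFinMk, Fin.isValue, Matrix.cons_val, Matrix.cons_val', Matrix.of_apply,
      Pi.smul_apply, Pi.zero_apply, Pi.neg_apply, smul_eq_mul, map_zero, map_one, map_neg, mul_zero,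
      zero_mul, mul_one, one_mul, mul_neg, neg_mul, neg_neg, zero_div, neg_zero, add_zero,
      zero_add, sub_zero,
      zero_sub, if_true, if_false, Fin.reduceEq, one_ne_zero, zero_ne_one, Matrix.zero_apply,
      Fin.reduceCastLE]
  lower := hasOp_coefSet (derElem α 0 0 0 0 1) (derElem_mem ..) 1 one_ne_zero <| by
    funext i
    fin_cases i <;> simp only [sfCoef, derElem, derMat, Pi.single_apply, Fin.zero_eta, Fin.mk_one,
      Fin.reduceFinMk, Fin.isValue, Matrix.cons_val, Matrix.cons_val', Matrix.of_apply,
      Pi.smul_apply, Pi.zero_apply, Pi.neg_apply, smul_eq_mul, map_zero, map_one, map_neg, mul_zero,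
      zero_mul, mul_one, one_mul, mul_neg, neg_mul, neg_neg, zero_div, neg_zero, add_zero,
      zero_add, sub_zero,
      zero_sub, if_true, if_false, Fin.reduceEq, one_ne_zero, zero_ne_one, Matrix.zero_apply,
      Fin.reduceCastLE]

theorem HasOp.mono {T U : Set (Fin 18 → ℂ)} (h : T ⊆ U) {t : Fin 18 → ℂ} (ht : HasOp T t) :
    HasOp U t := by
  obtain ⟨c, hc, h'⟩ := ht
  exact ⟨c, hc, h h'⟩

theorem K0Like.kLike {𝕜 : Type*} [Field 𝕜] {α : 𝕜} {κ : Amb 𝕜 → Fin 18 → ℂ} (h : K0Like (coefSet κ (k0Alg α)))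
    (hk : coefSet κ (kAlg α) ⊆ kCoef) (hc : HasOp (coefSet κ (kAlg α)) compactCoef) :
    KLike (coefSet κ (kAlg α)) where
  sub := hk
  oddDer := h.oddDer.mono (Set.image_mono (k0Alg_subset α))
  raise := h.raise.mono (Set.image_mono (k0Alg_subset α))
  lower := h.lower.mono (Set.image_mono (k0Alg_subset α))
  compact := hc

theorem kLike_sfCoef (α lam : 𝕜) : KLike (coefSet (sfCoef α lam) (kAlg α)) := by
  refine (k0Like_sfCoef α lam).kLike ?_ ?_
  · rintro _ ⟨X, hX, rfl⟩
    exact sfCoef_mem_kCoef α lam hX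
  -- The element (e₂, 0, -e₂) acts by -2i y + (i/2)𝓑(e₂), which is i/2 times -4y + 𝓑(e₂).
  · refine hasOp_coefSet (vecElem α ![0, 1, 0, 0] 0 (-![0, 1, 0, 0])) ⟨rfl, rfl⟩ (Complex.I / 2)
      (by simp) ?_
    funext i
    fin_cases i <;> simp only [sfCoef, vecElem, compactCoef, Fin.zero_eta, Fin.mk_one,
      Fin.reduceFinMk, Fin.isValue, Matrix.cons_val, Matrix.cons_val', Matrix.of_apply,
      Pi.smul_apply, Pi.zero_apply, Pi.neg_apply, smul_eq_mul, map_zero, map_one, map_neg, mul_zero,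
      zero_mul, mul_one, one_mul, mul_neg, neg_mul, neg_neg, zero_div, neg_zero, add_zero,
      zero_add, sub_zero,
      zero_sub, if_true, if_false, Fin.reduceEq, one_ne_zero, zero_ne_one, Matrix.zero_apply,
      Fin.reduceCastLE]
    ring

theorem gLike_sfCoef (α : 𝕜) :
    GLike (algebraMap 𝕜 ℂ α) (coefSet (sfCoef α α) (Set.univ : Set (gAlg α))) where
  mul j := hasOp_coefSet (vecElem α (Pi.single j 1) 0 0) trivial (-2 * Complex.I) (by simp) <| by
    funext i
    fin_cases j <;> fin_cases i <;> simp only [sfCoef, vecElem, Pi.single_apply, Fin.zero_eta,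
      Fin.mk_one,
      Fin.reduceFinMk, Fin.isValue, Matrix.cons_val, Matrix.cons_val', Matrix.of_apply,
      Pi.smul_apply, Pi.zero_apply, Pi.neg_apply, smul_eq_mul, map_zero, map_one, map_neg, mul_zero,
      zero_mul, mul_one, one_mul, mul_neg, neg_mul, neg_neg, zero_div, neg_zero, add_zero,
      zero_add, sub_zero,
      zero_sub, if_true, if_false, Fin.reduceEq, one_ne_zero, zero_ne_one, Matrix.zero_apply,
      Fin.reduceCastLE]
  bessel_x := hasOp_coefSet (vecElem α 0 0 ![1, 0, 0, 0]) trivial (-(Complex.I / 2)) (by simp) <| by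
    funext i
    fin_cases i <;> simp only [sfCoef, vecElem, Pi.single_apply, Fin.zero_eta, Fin.mk_one,
      Fin.reduceFinMk, Fin.isValue, Matrix.cons_val, Matrix.cons_val', Matrix.of_apply,
      Pi.smul_apply, Pi.zero_apply, Pi.neg_apply, smul_eq_mul, map_zero, map_one, map_neg, mul_zero,
      zero_mul, mul_one, one_mul, mul_neg, neg_mul, neg_neg, zero_div, neg_zero, add_zero,
      zero_add, sub_zero,
      zero_sub, if_true, if_false, Fin.reduceEq, one_ne_zero, zero_ne_one, Matrix.zero_apply,
      Fin.reduceCastLE]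
  bessel_y := hasOp_coefSet (vecElem α 0 0 ![0, 1, 0, 0]) trivial (-(Complex.I / 2)) (by simp) <| by
    funext i
    fin_cases i <;> simp only [sfCoef, vecElem, Pi.single_apply, Fin.zero_eta, Fin.mk_one,
      Fin.reduceFinMk, Fin.isValue, Matrix.cons_val, Matrix.cons_val', Matrix.of_apply,
      Pi.smul_apply, Pi.zero_apply, Pi.neg_apply, smul_eq_mul, map_zero, map_one, map_neg, mul_zero,
      zero_mul, mul_one, one_mul, mul_neg, neg_mul, neg_neg, zero_div, neg_zero, add_zero,
      zero_add, sub_zero,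
      zero_sub, if_true, if_false, Fin.reduceEq, one_ne_zero, zero_ne_one, Matrix.zero_apply,
      Fin.reduceCastLE]
  euler := hasOp_coefSet (vecElem α 0 ![1, 0, 0, 0] 0) trivial (-1 / 2) (by norm_num) <| by
    funext i
    fin_cases i <;> simp only [sfCoef, vecElem, eulerCoef, Fin.zero_eta, Fin.mk_one,
      Fin.reduceFinMk, Fin.isValue, Matrix.cons_val, Matrix.cons_val', Matrix.of_apply,
      Pi.smul_apply, Pi.zero_apply, Pi.neg_apply, smul_eq_mul, map_zero, map_one, map_neg, mul_zero,
      zero_mul, mul_one, one_mul, mul_neg, neg_mul, neg_neg, zero_div, neg_zero, add_zero,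
      zero_add, sub_zero,
      zero_sub, if_true, if_false, Fin.reduceEq, one_ne_zero, zero_ne_one, Matrix.zero_apply,
      Fin.reduceCastLE]
    ring

/-- The coefficients of `π_λ(X)` in the model for `λ = 1`. -/
def oneCoef (α : 𝕜) (Z : Amb 𝕜) : Fin 18 → ℂ := swapCoef (algebraMap 𝕜 ℂ α) (sfCoef α 1 Z)

theorem k0Like_oneCoef (α : 𝕜) (hα : α ≠ 0) :
    K0Like (coefSet (oneCoef α) (k0Alg α)) where
  sub := by
    rintro _ ⟨X, hX, rfl⟩
    exact swapCoef_mem_k0Coef _ (sfCoef_mem_k0Coef α 1 hX)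
  -- Exchanging e₁ and e₂ reverses the sign of this derivation, and rescaling x₃ contributes α.
  oddDer := hasOp_coefSet (derElem α 1 0 0 0 0) (derElem_mem ..) (-algebraMap 𝕜 ℂ α)
    (by simpa using hα) <| by
      funext i
      fin_cases i <;> simp only [oneCoef, sfCoef, swapCoef, derElem, derMat, oddDerCoef,
        Fin.zero_eta, Fin.mk_one,
      Fin.reduceFinMk, Fin.isValue, Matrix.cons_val, Matrix.cons_val', Matrix.of_apply,
      Pi.smul_apply, Pi.zero_apply, Pi.neg_apply, smul_eq_mul, map_zero, map_one, map_neg, mul_zero,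
      zero_mul, mul_one, one_mul, mul_neg, neg_mul, neg_neg, zero_div, neg_zero, add_zero,
      zero_add, sub_zero,
      zero_sub, if_true, if_false, Fin.reduceEq, one_ne_zero, zero_ne_one, Matrix.zero_apply,
      Fin.reduceCastLE]
  raise := hasOp_coefSet (derElem α 0 0 0 1 0) (derElem_mem ..) (algebraMap 𝕜 ℂ α)
    (by simpa using hα) <| by
      funext i
      fin_cases i <;> simp only [oneCoef, sfCoef, swapCoef, derElem, derMat, Pi.single_apply,
        Fin.zero_eta, Fin.mk_one,
      Fin.reduceFinMk, Fin.isValue, Matrix.cons_val, Matrix.cons_val', Matrix.of_apply,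
      Pi.smul_apply, Pi.zero_apply, Pi.neg_apply, smul_eq_mul, map_zero, map_one, map_neg, mul_zero,
      zero_mul, mul_one, one_mul, mul_neg, neg_mul, neg_neg, zero_div, neg_zero, add_zero,
      zero_add, sub_zero,
      zero_sub, if_true, if_false, Fin.reduceEq, one_ne_zero, zero_ne_one, Matrix.zero_apply,
      Fin.reduceCastLE]
  lower := hasOp_coefSet (derElem α 0 0 0 0 1) (derElem_mem ..) (algebraMap 𝕜 ℂ α)⁻¹
    (by simpa using hα) <| by
      funext i
      fin_cases i <;> simp only [oneCoef, sfCoef, swapCoef, derElem, derMat, Pi.single_apply,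
        Fin.zero_eta, Fin.mk_one,
      Fin.reduceFinMk, Fin.isValue, Matrix.cons_val, Matrix.cons_val', Matrix.of_apply,
      Pi.smul_apply, Pi.zero_apply, Pi.neg_apply, smul_eq_mul, map_zero, map_one, map_neg, mul_zero,
      zero_mul, mul_one, one_mul, mul_neg, neg_mul, neg_neg, zero_div, neg_zero, add_zero,
      zero_add, sub_zero,
      zero_sub, if_true, if_false, Fin.reduceEq, one_ne_zero, zero_ne_one, Matrix.zero_apply,
      Fin.reduceCastLE]

theorem kLike_oneCoef (α : 𝕜) (hα : α ≠ 0) :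
    KLike (coefSet (oneCoef α) (kAlg α)) := by
  refine (k0Like_oneCoef α hα).kLike ?_ ?_
  · rintro _ ⟨X, hX, rfl⟩
    exact swapCoef_mem_kCoef _ (sfCoef_mem_kCoef α 1 hX)
  · refine hasOp_coefSet (vecElem α ![1, 0, 0, 0] 0 (-![1, 0, 0, 0])) ⟨rfl, rfl⟩ (Complex.I / 2)
      (by simp) ?_
    funext i
    fin_cases i <;> simp only [oneCoef, sfCoef, swapCoef, vecElem, compactCoef, Fin.zero_eta,
      Fin.mk_one,
      Fin.reduceFinMk, Fin.isValue, Matrix.cons_val, Matrix.cons_val', Matrix.of_apply,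
      Pi.smul_apply, Pi.zero_apply, Pi.neg_apply, smul_eq_mul, map_zero, map_one, map_neg, mul_zero,
      zero_mul, mul_one, one_mul, mul_neg, neg_mul, neg_neg, zero_div, neg_zero, add_zero,
      zero_add, sub_zero,
      zero_sub, if_true, if_false, Fin.reduceEq, one_ne_zero, zero_ne_one, Matrix.zero_apply,
      Fin.reduceCastLE]
    ring

theorem gLike_oneCoef (α : 𝕜) (hα : α ≠ 0) :
    GLike (algebraMap 𝕜 ℂ α)⁻¹ (coefSet (oneCoef α) (Set.univ : Set (gAlg α))) where
  mul j := hasOp_coefSet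
    (vecElem α (![Pi.single 1 1, Pi.single 0 1, Pi.single 2 1, Pi.single 3 1] j) 0 0) trivial
    (![-2 * Complex.I, -2 * Complex.I, -2 * Complex.I * algebraMap 𝕜 ℂ α, -2 * Complex.I] j)
    (by fin_cases j <;> simp [hα]) <| by
      funext i
      fin_cases j <;> fin_cases i <;> simp only [oneCoef, sfCoef, swapCoef, vecElem,
        Pi.single_apply, Fin.zero_eta, Fin.mk_one,
      Fin.reduceFinMk, Fin.isValue, Matrix.cons_val, Matrix.cons_val', Matrix.of_apply,
      Pi.smul_apply, Pi.zero_apply, Pi.neg_apply, smul_eq_mul, map_zero, map_one, map_neg, mul_zero,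
      zero_mul, mul_one, one_mul, mul_neg, neg_mul, neg_neg, zero_div, neg_zero, add_zero,
      zero_add, sub_zero,
      zero_sub, if_true, if_false, Fin.reduceEq, one_ne_zero, zero_ne_one, Matrix.zero_apply,
      Fin.reduceCastLE]
      ring
  bessel_x := hasOp_coefSet (vecElem α 0 0 ![0, 1, 0, 0]) trivial (-(Complex.I / 2)) (by simp) <| by
    funext i
    fin_cases i <;> simp only [oneCoef, sfCoef, swapCoef, vecElem, Pi.single_apply, Fin.zero_eta,
      Fin.mk_one,
      Fin.reduceFinMk, Fin.isValue, Matrix.cons_val, Matrix.cons_val', Matrix.of_apply,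
      Pi.smul_apply, Pi.zero_apply, Pi.neg_apply, smul_eq_mul, map_zero, map_one, map_neg, mul_zero,
      zero_mul, mul_one, one_mul, mul_neg, neg_mul, neg_neg, zero_div, neg_zero, add_zero,
      zero_add, sub_zero,
      zero_sub, if_true, if_false, Fin.reduceEq, one_ne_zero, zero_ne_one, Matrix.zero_apply,
      Fin.reduceCastLE]
  bessel_y := hasOp_coefSet (vecElem α 0 0 ![1, 0, 0, 0]) trivial (-(Complex.I / 2)) (by simp) <| by
    funext i
    fin_cases i <;> simp only [oneCoef, sfCoef, swapCoef, vecElem, Pi.single_apply, Fin.zero_eta,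
      Fin.mk_one,
      Fin.reduceFinMk, Fin.isValue, Matrix.cons_val, Matrix.cons_val', Matrix.of_apply,
      Pi.smul_apply, Pi.zero_apply, Pi.neg_apply, smul_eq_mul, map_zero, map_one, map_neg, mul_zero,
      zero_mul, mul_one, one_mul, mul_neg, neg_mul, neg_neg, zero_div, neg_zero, add_zero,
      zero_add, sub_zero,
      zero_sub, if_true, if_false, Fin.reduceEq, one_ne_zero, zero_ne_one, Matrix.zero_apply,
      Fin.reduceCastLE]
  euler := hasOp_coefSet (vecElem α 0 ![0, 1, 0, 0] 0) trivial (-1 / 2) (by norm_num) <| by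
    funext i
    fin_cases i <;> simp only [oneCoef, sfCoef, swapCoef, vecElem, eulerCoef, Fin.zero_eta,
      Fin.mk_one,
      Fin.reduceFinMk, Fin.isValue, Matrix.cons_val, Matrix.cons_val', Matrix.of_apply,
      Pi.smul_apply, Pi.zero_apply, Pi.neg_apply, smul_eq_mul, map_zero, map_one, map_neg, mul_zero,
      zero_mul, mul_one, one_mul, mul_neg, neg_mul, neg_neg, zero_div, neg_zero, add_zero,
      zero_add, sub_zero,
      zero_sub, if_true, if_false, Fin.reduceEq, one_ne_zero, zero_ne_one, Matrix.zero_apply,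
      Fin.reduceCastLE]
    ring

end Models

end

/-! ### Existence of the model, and its use. -/

noncomputable section

open Polynomial

variable {𝕜 : Type*} [Field 𝕜] [Algebra 𝕜 ℂ]

theorem exists_model {α lam : 𝕜} (h : Admissible α lam) : Nonempty (Model h) := by
  have h' := h
  rcases h' with ⟨rfl, hα⟩ | ⟨rfl, hα, hn⟩
  · have hα : lam ≠ 0 := by simpa using hα 0
    have hβ : betaC lam lam = algebraMap 𝕜 ℂ lam := by simp [betaC]
    exact ⟨{
      S := chartAlpha lam
      κ := sfCoef lam lam
      rep_eq := by rw [hβ]; exact rep_toQF h _ (τ := id) (fun _ _ => rfl) (fun _ _ => rfl) (chartAlpha_sfElem lam hα)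
      κ_add := sfCoef_add lam lam
      κ_smul := sfCoef_smul lam lam
      bracket_eq := fun hX hY hp hq => by rw [hβ]; exact pmOp_sfCoef_bracket hα hX hY hp hq
      k0Like := k0Like_sfCoef lam lam
      kLike := kLike_sfCoef lam lam
      gLike := by rw [hβ]; exact gLike_sfCoef lam }⟩
  · have h1 : (1 : 𝕜) ≠ α := fun h1 => hn 1 (by simp [← h1])
    have hβ : betaC α 1 = (algebraMap 𝕜 ℂ α)⁻¹ := by simp [betaC, h1]
    exact ⟨{
      S := chartOne α hα h1
      κ := oneCoef α
      rep_eq := by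
        rw [hβ]
        exact rep_toQF h _ (swapCoef_add _) (swapCoef_smul _) (chartOne_sfElem α hα h1)
      κ_add := fun X Y => by simp only [oneCoef, sfCoef_add, swapCoef_add]
      κ_smul := fun c X => by simp only [oneCoef, sfCoef_smul, swapCoef_smul]
      bracket_eq := fun hX hY hp hq => by
        rw [hβ]
        exact pmOp_swapCoef_bracket hα hX hY hp hq (oneCoef α) fun _ => rfl
      k0Like := k0Like_oneCoef α hα
      kLike := kLike_oneCoef α hα
      gLike := by rw [hβ]; exact gLike_oneCoef α hα }⟩

/-! ### Transfer to `W_λ` -/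

namespace Model

variable {α lam : 𝕜} {h : Admissible α lam} (M : Model h)

theorem invariant_map {l : Set (gAlg α)} {N : Submodule ℂ PM} :
    Invariant h l (N.map M.S.toQF) ↔ ModelStable (betaC α lam) (coefSet M.κ l) N := by
  constructor
  · rintro hN _ ⟨X, hX, rfl⟩ p hp
    obtain ⟨q, hq, e⟩ := hN X hX _ (Submodule.mem_map_of_mem hp)
    rw [M.rep_eq] at e
    exact M.S.toQF_injective e ▸ hq
  · rintro hN X hX _ ⟨p, hp, rfl⟩
    rw [M.rep_eq]
    exact Submodule.mem_map_of_mem (hN _ ⟨X, hX, rfl⟩ p hp)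

theorem map_comap {N : Submodule ℂ PM} {N' : Submodule ℂ (QF α lam)}
    (hN : N' ≤ N.map M.S.toQF) : (N'.comap M.S.toQF).map M.S.toQF = N' :=
  Submodule.map_comap_eq_self (hN.trans LinearMap.map_le_range)

theorem comap_le {N : Submodule ℂ PM} {N' : Submodule ℂ (QF α lam)}
    (hN : N' ≤ N.map M.S.toQF) : N'.comap M.S.toQF ≤ N :=
  (Submodule.comap_mono hN).trans
    (Submodule.comap_map_eq_of_injective M.S.toQF_injective N).le

theorem map_eq_bot {N : Submodule ℂ PM} : N.map M.S.toQF = ⊥ ↔ N = ⊥ := by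
  rw [← Submodule.map_bot M.S.toQF]
  exact (Submodule.map_injective_of_injective M.S.toQF_injective).eq_iff

/-- Since `toQF` is injective and intertwines the operators, submodules below N correspond to those
below its image. -/
theorem isIrred_map {l : Set (gAlg α)} {N : Submodule ℂ PM} :
    IsIrred h l (N.map M.S.toQF) ↔ ModelIrred (betaC α lam) (coefSet M.κ l) N := by
  rw [IsIrred, ModelIrred, M.invariant_map, Ne, M.map_eq_bot]
  refine and_congr_right fun _ => and_congr_right fun _ => ⟨fun H N' hle hN' => ?_,
    fun H N' hle hN' => ?_⟩
  · have := H _ (Submodule.map_mono hle) (M.invariant_map.2 hN')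
    rwa [M.map_eq_bot, (Submodule.map_injective_of_injective M.S.toQF_injective).eq_iff] at this
  · rw [← M.map_comap hle, M.invariant_map] at hN'
    rcases H _ (M.comap_le hle) hN' with e | e
    · left
      rw [← M.map_comap hle, e, Submodule.map_bot]
    · right
      rw [← M.map_comap hle, e]

theorem isIndecomp_map {l : Set (gAlg α)} {N : Submodule ℂ PM}
    (hN : ModelStable (betaC α lam) (coefSet M.κ l) N) (hne : N ≠ ⊥)
    (H : ∀ N₁ ≤ N, ∀ N₂ ≤ N, ModelStable (betaC α lam) (coefSet M.κ l) N₁ →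
      ModelStable (betaC α lam) (coefSet M.κ l) N₂ → N₁ ⊓ N₂ = ⊥ → N₁ = ⊥ ∨ N₂ = ⊥) :
    IsIndecomp h l (N.map M.S.toQF) := by
  refine ⟨M.invariant_map.2 hN, mt M.map_eq_bot.1 hne, fun N₁ h₁ N₂ h₂ i₁ i₂ hinf _ => ?_⟩
  rw [← M.map_comap h₁] at i₁ ⊢
  rw [← M.map_comap h₂] at i₂ ⊢
  rw [M.map_eq_bot, M.map_eq_bot]
  refine H _ (M.comap_le h₁) _ (M.comap_le h₂) (M.invariant_map.1 i₁) (M.invariant_map.1 i₂) ?_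
  rw [← Submodule.comap_inf, hinf, ← M.map_eq_bot, M.map_comap (N := ⊥) bot_le]

end Model

namespace Chart

variable {α lam : 𝕜} (S : Chart α lam)

theorem aeval_four_smul (p : ℂ[X]) :
    aeval ((4 : ℂ) • mainVar α lam) p = aeval S.x (p.comp (C 4 * X)) := by
  rw [aeval_comp, S.x_eq]
  congr 1
  simp [csmul]

theorem genA_eq (k : ℕ) : genA α lam k = S.toQF (mA (betaC α lam) k) := by
  rw [genA, Omega, S.aeval_four_smul, S.cls_ofFun, mA, omP]
  simp [map_ofNat]

theorem genB_eq (n : ℕ) : genB α lam (n + 1) = S.toQF (mB (betaC α lam) n) := by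
  rw [genB, Omega, S.aeval_four_smul, S.cls_ofFun, mB, omP]
  simp [map_ofNat]

/-- The factor δ from the normalization of x₃ is nonzero, so it disappears in the spans. -/
theorem genC_eq (n : ℕ) : genC α lam (n + 1) = S.δ • S.toQF (mC (betaC α lam) n) := by
  rw [genC, Vfun, S.aeval_four_smul, S.cls_mulX_two, mC, vP, ← map_smul]
  congr 1
  funext i
  fin_cases i <;> simp [smul_eq_C_mul]

theorem genD_eq (n : ℕ) : genD α lam (n + 1) = S.toQF (mD (betaC α lam) n) := by
  rw [genD, Vfun, S.aeval_four_smul, S.cls_mulX_three, mD, vP]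
  simp

theorem Wk_eq (k : ℕ) : Wk α lam k = (mWk (betaC α lam) k).map S.toQF := by
  cases k with
  | zero =>
    rw [Wk, if_pos rfl, mWk, mW0, Submodule.map_span, Set.image_singleton, ← S.genA_eq, genA,
      Omega, tricomiU_zero, map_one, one_mul, S.exp_eq]
  | succ n =>
    rw [Wk, if_neg n.succ_ne_zero, mWk, mW, Submodule.map_span, S.genA_eq, S.genB_eq, S.genC_eq,
      S.genD_eq]
    simp only [Set.image_insert_eq, Set.image_singleton, Submodule.span_insert]
    rw [Submodule.span_singleton_smul_eq (isUnit_iff_ne_zero.2 S.δ_ne_zero)]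

theorem Kk_eq (n : ℕ) : Kk α lam (n + 1) = (mK (betaC α lam) n).map S.toQF := by
  rw [Kk, mK, Submodule.map_span, S.genA_eq, S.genB_eq, S.genC_eq, S.genD_eq]
  simp only [Set.image_insert_eq, Set.image_singleton, Submodule.span_insert]
  -- With k = n + 1 the coefficient k - 1 - β becomes n - β.
  rw [Submodule.span_singleton_smul_eq (isUnit_iff_ne_zero.2 S.δ_ne_zero), mV, map_add, map_smul,
    Nat.cast_succ, add_sub_cancel_right]

theorem Rk_eq (n : ℕ) : Rk α lam (n + 1) = (mRk (betaC α lam) n).map S.toQF := by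
  rw [Rk, mRk, Submodule.map_span, S.genA_eq, S.genB_eq, Set.image_singleton, mR, map_add,
    map_smul, Nat.cast_succ]

theorem W_eq : W α lam = (⊤ : Submodule ℂ PM).map S.toQF := by
  rw [Submodule.map_top, S.range_toQF]

end Chart

theorem Model.isSuperModule {α lam : 𝕜} {h : Admissible α lam} (M : Model h) :
    IsSuperModule h (W α lam) := by
  refine ⟨?_, ?_, fun p q X hX w _ hw => hw.rep h hX, fun p q X Y hX hY => ?_⟩
  · rw [M.S.W_eq, M.invariant_map]
    exact fun _ _ _ _ => Submodule.mem_top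
  · intro c X Y w hw
    rw [← M.S.range_toQF] at hw
    obtain ⟨p, rfl⟩ := hw
    have : M.κ (c • X + Y : gAlg α).1 = algebraMap 𝕜 ℂ c • M.κ X.1 + M.κ Y.1 := by
      rw [← M.κ_smul, ← M.κ_add]; rfl
    rw [M.rep_eq, M.rep_eq, M.rep_eq, this, pmOp_add, pmOp_smul, map_add, map_smul]
  · obtain ⟨hZ, hb⟩ := M.bracket_eq X.2 Y.2 hX hY
    refine ⟨⟨_, hZ⟩, rfl, fun w hw => ?_⟩
    rw [← M.S.range_toQF] at hw
    obtain ⟨p, rfl⟩ := hw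
    rw [M.rep_eq, hb, M.rep_eq, M.rep_eq, M.rep_eq, M.rep_eq, map_sub, map_zsmul]

end

end DTwoOneAlpha

/-! ### The theorem, transferred from the polynomial model. -/

theorem mainTheorem3 {𝕜 : Type*} [Field 𝕜] [Algebra 𝕜 ℂ] (α lam : 𝕜)
    (h : DTwoOneAlpha.Admissible α lam) :
    -- for `α ≠ -1`: decomposition of `W_{λ,k}` into irreducible `𝔨₀`-modules
    (α ≠ -1 → ∀ k : ℕ, 1 ≤ k →
      DTwoOneAlpha.IsIrred h (DTwoOneAlpha.k0Alg α) (DTwoOneAlpha.Kk α lam k) ∧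
      DTwoOneAlpha.IsIrred h (DTwoOneAlpha.k0Alg α) (DTwoOneAlpha.Rk α lam k) ∧
      DTwoOneAlpha.Kk α lam k ⊓ DTwoOneAlpha.Rk α lam k = ⊥ ∧
      DTwoOneAlpha.Kk α lam k ⊔ DTwoOneAlpha.Rk α lam k = DTwoOneAlpha.Wk α lam k) ∧
    -- for `α = -1`: `W_{λ,k}` is indecomposable but not irreducible over `𝔨₀`
    (α = -1 → ∀ k : ℕ, 1 ≤ k →
      DTwoOneAlpha.IsIndecomp h (DTwoOneAlpha.k0Alg α) (DTwoOneAlpha.Wk α lam k) ∧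
      ¬ DTwoOneAlpha.IsIrred h (DTwoOneAlpha.k0Alg α) (DTwoOneAlpha.Wk α lam k)) ∧
    -- `W_{λ,k}` is an irreducible `𝔨`-module
    (∀ k : ℕ, DTwoOneAlpha.IsIrred h (DTwoOneAlpha.kAlg α) (DTwoOneAlpha.Wk α lam k)) ∧
    -- `W_λ` is an irreducible `𝔤`-module, and the direct sum of the `W_{λ,k}`
    DTwoOneAlpha.IsSuperModule h (DTwoOneAlpha.W α lam) ∧
    DTwoOneAlpha.IsIrred h Set.univ (DTwoOneAlpha.W α lam) ∧
    iSupIndep (DTwoOneAlpha.Wk α lam) ∧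
    ⨆ k : ℕ, DTwoOneAlpha.Wk α lam k = DTwoOneAlpha.W α lam := by
  obtain ⟨M⟩ := DTwoOneAlpha.exists_model h
  have hn := DTwoOneAlpha.betaC_ne_natCast h
  have hinj := M.S.toQF_injective
  have hW : DTwoOneAlpha.Wk α lam =
      fun k => (DTwoOneAlpha.mWk (DTwoOneAlpha.betaC α lam) k).map M.S.toQF :=
    funext M.S.Wk_eq
  refine ⟨fun hα k hk => ?_, fun hα k hk => ?_, fun k => ?_, M.isSuperModule, ?_, ?_, ?_⟩
  · obtain ⟨n, rfl⟩ := Nat.exists_eq_succ_of_ne_zero (Nat.one_le_iff_ne_zero.1 hk)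
    -- As -1 is its own inverse, the exceptional value is the same for β = α and β = α⁻¹.
    have hβ : DTwoOneAlpha.betaC α lam ≠ -1 := mt DTwoOneAlpha.betaC_eq_neg_one_iff.1 hα
    rw [M.S.Kk_eq, M.S.Rk_eq, M.S.Wk_eq, M.isIrred_map, M.isIrred_map, ← Submodule.map_inf _ hinj,
      ← Submodule.map_sup, DTwoOneAlpha.mK_inf_mRk hβ, DTwoOneAlpha.mK_sup_mRk hβ]
    exact ⟨DTwoOneAlpha.mK_irred M.k0Like hβ, DTwoOneAlpha.mRk_irred M.k0Like,
      Submodule.map_bot _, rfl⟩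
  · obtain ⟨n, rfl⟩ := Nat.exists_eq_succ_of_ne_zero (Nat.one_le_iff_ne_zero.1 hk)
    have hβ := (DTwoOneAlpha.betaC_eq_neg_one_iff (lam := lam)).2 hα
    rw [M.S.Wk_eq, M.isIrred_map]
    exact ⟨M.isIndecomp_map (DTwoOneAlpha.mW_stable fun t ht => (M.k0Like.sub ht).1)
      DTwoOneAlpha.mW_ne_bot fun N₁ h₁ N₂ h₂ => DTwoOneAlpha.mW_indecomp M.k0Like hβ h₁ h₂,
      DTwoOneAlpha.mW_not_irred M.k0Like hβ⟩
  · rw [M.S.Wk_eq, M.isIrred_map]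
    cases k with
    | zero => exact DTwoOneAlpha.mW0_irred M.kLike
    | succ n => exact DTwoOneAlpha.mW_irred M.kLike (hn n).symm
  · rw [M.S.W_eq, M.isIrred_map]
    exact DTwoOneAlpha.model_irred hn M.gLike
  · rw [hW]
    exact M.S.toQF.iSupIndep_map hinj (DTwoOneAlpha.mWk_iSupIndep _)
  · rw [hW, ← Submodule.map_iSup, DTwoOneAlpha.mWk_iSup, M.S.W_eq]
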